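/- **Theorem (Spectral Decomposition).** *Framework.* An operational-probabilistic theory (OPT) consists of: a symmetric monoidal category whose objects are the systems (the unit $I$ being the trivial system) and whose morphisms $A\to B$ are the events (transformations); for every pair of systems $A,B$, a collection of finite families of events $\{T_x\}_{x\in X}$ of type $A\to B$, called tests, closed under sequential and parallel composition, containing $\{U\}$ for every reversible event (isomorphism) $U$, such that every event occurs in some test and every system admits a preparation-test (type $I\to A$) and an observation-test, or measurement (type $A\to I$); and a map $\mathrm{Prob}:\mathsf{Transf}(I\to I)\to[0,1]$ with $\sum_x \mathrm{Prob}(s_x)=1$ for every test $\{s_x\}$ of type $I\to I$ and $\mathrm{Prob}(s\otimes t)=\mathrm{Prob}(s)\,\mathrm{Prob}(t)$. States of $A$ are the events $\rho: I\to A$, effects the events $m: A\to I$, and $(m|\rho)=\mathrm{Prob}(m\circ\rho)$. Events $f:A\to B$ are represented as the functions $(R,\rho,m)\mapsto \mathrm{Prob}\big(m\circ(f\otimes \mathrm{id}_R)\circ\rho\big)$, where $R$ is a system, $\rho:I\to A\otimes R$ and $m:B\otimes R\to I$; sums, multiples and the real span $\mathsf{Transf}_{\mathbb R}(A\to B)$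 are taken among such functions. $\mathsf{St}_{\mathbb R}(A)$ is the real span of the functions $m\mapsto (m|\rho)$ on effects, $\rho$ a state of $A$, and $\mathsf{Eff}_{\mathbb R}(A)$ is the real span of the linear functionals on $\mathsf{St}_{\mathbb R}(A)$ induced by the effects. An event $f$ is deterministic if $\{f\}$ is a test. A test $T$ is a coarse-graining of $T'=\{T'_z\}_{z\in Z}$, and $T'$ refines $T=\{T_x\}_{x\in X}$, if $T_x=\sum_{z\in Z_x}T'_z$ for a partition $\{Z_x\}_{x\in X}$ of $Z$ into disjoint, possibly empty, subsets. An event $f$ is pure if, whenever a test $T$ with $T_{x_0}=f$ is refined by a test $T'$, one has $T'_z=p_z f$ for all $z\in Z_{x_0}$, with $\{p_z\}_{z\in Z_{x_0}}$ a probability distribution (no condition if $Z_{x_0}=\emptyset$). An event $f$ is internal if for every event $g$ of the same type there are $\lambda>0$ and an event $h$ with $f=\lambda g+h$ such that $\lambda g$ and $h$ are the events of two distinct outcomes of one test. A state $\rho$ is normalized if $\sup_a(a|\rho)=1$ over effects $a$. States $\{\rho_x\}_{x\in X}$ are perfectly distinguishable if some measurement $\{m_x\}_{x\in X}$, then called discriminating,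 has $(m_x|\rho_{x'})=\delta_{xx'}$. *Assumptions.* The OPT satisfies: - Separation: events represented by the same function are equal. - Closure under coarse-graining: every coarse-graining of a test, over any finite outcome set, exists as a test. - Finite dimensionality: every $\mathsf{St}_{\mathbb R}(A)$ is finite dimensional. - Non-determinism: some scalar has probability different from $0$ and $1$. - Closure under operational limits: if events $T_n:A\to B$ converge pointwise, as functions, to an element of $\mathsf{Transf}_{\mathbb R}(A\to B)$, then this limit is an event. - Causality: for a preparation-test $\{\rho_x\}$ of $A$, the probability $\sum_y(m_y|\rho_x)$ does not depend on the choice of the measurement $\{m_y\}$; and conditional tests (a test $\{T_x\}_{x\in X}$ followed, on outcome $x$, by a test $\{S^x_y\}_{y\in Y_x}$, giving $\{S^x_y\circ T_x\}_{x\in X,\,y\in Y_x}$) are tests. - Purity of Composition: if $f:A\to B$ and $g:B\to D$ are pure, so is $g\circ f$. - Local Tomography: two states of $A\otimes B$ that give the same probabilities for all product effects $a\otimes b$ are equal. - Perfect State Discrimination: every normalized non-internal state is perfectly distinguishable from some other state. - Ideal Compression: for every deterministic state $\rho$ of a system $A$ there are a system $B$ and a deterministic $E:A\to B$ such that (i)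 for every preparation-test $\{\rho_x\}$ with $\sum_x\rho_x=\rho$ (ensemble decomposition of $\rho$) there is a deterministic $D:B\to A$ with $D\circ E\circ\rho_x=\rho_x$ for all $x$, and (ii) every state of $B$ equals $\lambda\,E\circ\rho_{x_0}$ for some $\lambda\ge0$ and some $\rho_{x_0}$ belonging to an ensemble decomposition of $\rho$. - Purification: every state $\rho$ of a system $A$ has a purification, i.e. a system $E$, a pure state $\Psi$ of $A\otimes E$ and a deterministic effect $e$ of $E$ with $(\mathrm{id}_A\otimes e)\circ\Psi=\rho$; and for any two purifications $(E,\Psi,e)$, $(E,\Psi',e')$ of $\rho$ with the same system $E$ there is a reversible $U:E\to E$ with $\Psi'=(\mathrm{id}_A\otimes U)\circ\Psi$ and $e'\circ U=e$. *Conclusion.* A pure maximal set of a system $A$ is a set of perfectly distinguishable pure states of $A$ that is not properly contained in any set of perfectly distinguishable states of $A$. For every system $A$, all pure maximal sets of $A$ have the same cardinality $d_A$, and: 1. for every $v\in\mathsf{St}_{\mathbb R}(A)$ there are a pure maximal set $\{\alpha_x\}_{x=1}^{d_A}$ and real coefficients $\{c_x\}_{x=1}^{d_A}$ with $v=\sum_{x=1}^{d_A}c_x\,\alpha_x$;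 2. for every $w\in\mathsf{Eff}_{\mathbb R}(A)$ there are a pure discriminating measurement $\{a_x\}_{x=1}^{d_A}$ (a discriminating measurement consisting of pure effects) and real coefficients $\{d_x\}_{x=1}^{d_A}$ with $w=\sum_{x=1}^{d_A}d_x\,a_x$. -/

import Mathlib

open CategoryTheory MonoidalCategory Filter Topology

universe v u

/-- An operational structure.  Systems are the objects and events the morphisms of a symmetric
monoidal category `C` (the trivial system is the unit `𝟙_ C`); `IsTest T` says that the finite
family of events `T` is a test. -/
structure OperationalStructure (C : Type u) [Category.{v} C] [MonoidalCategory C]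
    [SymmetricCategory C] where
  /-- which finite families of events of type `A ⟶ B` are tests -/
  IsTest : ∀ {X : Type} [Finite X] {A B : C}, (X → (A ⟶ B)) → Prop
  /-- sequential composition of tests -/
  isTest_comp : ∀ {X Y : Type} [Finite X] [Finite Y] {A B D : C} (S : X → (A ⟶ B))
    (T : Y → (B ⟶ D)), IsTest S → IsTest T → IsTest (fun p : X × Y => S p.1 ≫ T p.2)
  /-- parallel composition of tests -/
  isTest_tensor : ∀ {X Y : Type} [Finite X] [Finite Y] {A A' B B' : C} (S : X → (A ⟶ A'))
    (T : Y → (B ⟶ B')), IsTest S → IsTest T → IsTest (fun p : X × Y => S p.1 ⊗ₘ T p.2)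
  /-- reversible events are deterministic tests -/
  isTest_iso : ∀ {A B : C} (U : A ≅ B), IsTest (fun _ : Unit => U.hom)
  /-- an event is something that can occur in some test -/
  exists_test_of_event : ∀ {A B : C} (f : A ⟶ B),
    ∃ (X : Type) (_ : Finite X) (T : X → (A ⟶ B)), IsTest T ∧ ∃ x, T x = f
  /-- every system can be prepared -/
  exists_preparation_test : ∀ A : C,
    ∃ (X : Type) (_ : Finite X) (T : X → (𝟙_ C ⟶ A)), IsTest T
  /-- every system can be observed -/
  exists_observation_test : ∀ A : C,
    ∃ (X : Type) (_ : Finite X) (T : X → (A ⟶ 𝟙_ C)), IsTest T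

/-- An operational-probabilistic theory: an operational structure together with a probabilistic
structure on its scalars. -/
structure OPT (C : Type u) [Category.{v} C] [MonoidalCategory C] [SymmetricCategory C]
    extends OperationalStructure C where
  /-- the probability of a scalar -/
  prob : (𝟙_ C ⟶ 𝟙_ C) → ℝ
  prob_nonneg : ∀ s, 0 ≤ prob s
  prob_le_one : ∀ s, prob s ≤ 1
  /-- consistency -/
  sum_prob : ∀ {X : Type} [Fintype X] (s : X → (𝟙_ C ⟶ 𝟙_ C)), IsTest s → ∑ x, prob (s x) = 1
  /-- independence -/
  prob_tensor : ∀ s t : 𝟙_ C ⟶ 𝟙_ C,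
    prob ((λ_ (𝟙_ C)).inv ≫ (s ⊗ₘ t) ≫ (λ_ (𝟙_ C)).hom) = prob s * prob t

namespace OPT

variable {C : Type u} [Category.{v} C] [MonoidalCategory C] [SymmetricCategory C] (O : OPT C)

/-! ### Vector space representation -/

/-- A closed circuit with an open slot of type `A ⟶ B`: a reference system `R`, a
preparation-event of `A ⊗ R` and an observation-event of `B ⊗ R`. -/
abbrev Context (A B : C) : Type (max u v) :=
  Σ R : C, (𝟙_ C ⟶ A ⊗ R) × (B ⊗ R ⟶ 𝟙_ C)

/-- The event `f`, as the real function that gives its probability in every context. -/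
def transfVec {A B : C} (f : A ⟶ B) : Context A B → ℝ :=
  fun c => O.prob (c.2.1 ≫ (f ▷ c.1) ≫ c.2.2)

/-- The real vector space spanned by the transformations of type `A ⟶ B`. -/
def TransfR (A B : C) : Submodule ℝ (Context A B → ℝ) :=
  Submodule.span ℝ (Set.range fun f : A ⟶ B => O.transfVec f)

/-- The state `ρ`, as the real function `m ↦ (m|ρ)` on effects. -/
def stVec {A : C} (ρ : 𝟙_ C ⟶ A) : (A ⟶ 𝟙_ C) → ℝ :=
  fun m => O.prob (ρ ≫ m)

/-- The real vector space spanned by the states of `A`. -/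
def StR (A : C) : Submodule ℝ ((A ⟶ 𝟙_ C) → ℝ) :=
  Submodule.span ℝ (Set.range fun ρ : 𝟙_ C ⟶ A => O.stVec ρ)

/-- The effect `m`, as the linear functional on `StR A` with `ρ ↦ (m|ρ)` for every state `ρ`. -/
def effVec {A : C} (m : A ⟶ 𝟙_ C) : Module.Dual ℝ (O.StR A) :=
  (LinearMap.proj m : ((A ⟶ 𝟙_ C) → ℝ) →ₗ[ℝ] ℝ) ∘ₗ (O.StR A).subtype

/-- The real vector space spanned by the effects of `A`. -/
def EffR (A : C) : Submodule ℝ (Module.Dual ℝ (O.StR A)) :=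
  Submodule.span ℝ (Set.range fun m : A ⟶ 𝟙_ C => O.effVec m)

/-! ### Requirements of the framework and standing assumptions -/

/-- Separation property: statistically equivalent events are equal. -/
def Separation : Prop :=
  ∀ (A B : C) (f g : A ⟶ B),
    (∀ (R : C) (ρ : 𝟙_ C ⟶ A ⊗ R) (m : B ⊗ R ⟶ 𝟙_ C),
      O.prob (ρ ≫ (f ▷ R) ≫ m) = O.prob (ρ ≫ (g ▷ R) ≫ m)) → f = g

open Classical in
/-- The family `T` is obtained from the family `T'` by joining together the outcomes with the same
image under `p`; equivalently, `T'` refines `T`.  The outcomes of `T` that have no preimage carry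
the zero event. -/
def IsCoarseGraining {X Z : Type} [Fintype Z] {A B : C} (p : Z → X)
    (T' : Z → (A ⟶ B)) (T : X → (A ⟶ B)) : Prop :=
  ∀ x, O.transfVec (T x) = ∑ z with p z = x, O.transfVec (T' z)

/-- Closure under coarse-graining. -/
def ClosedUnderCoarseGraining : Prop :=
  ∀ (X Z : Type) [Fintype X] [Fintype Z] (A B : C) (p : Z → X) (T' : Z → (A ⟶ B)),
    O.IsTest T' → ∃ T : X → (A ⟶ B), O.IsTest T ∧ O.IsCoarseGraining p T' T

/-- All state spaces are finite dimensional. -/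
def FiniteDimensionality : Prop :=
  ∀ A : C, FiniteDimensional ℝ (O.StR A)

/-- Some scalar has a probability different from `0` and `1`. -/
def NonDeterminism : Prop :=
  ∃ s : 𝟙_ C ⟶ 𝟙_ C, O.prob s ≠ 0 ∧ O.prob s ≠ 1

/-- Closure under operational limits. -/
def ClosedUnderLimits : Prop :=
  ∀ (A B : C) (T : ℕ → (A ⟶ B)) (τ : Context A B → ℝ), τ ∈ O.TransfR A B →
    (∀ c : Context A B, Tendsto (fun n => O.transfVec (T n) c) atTop (𝓝 (τ c))) →
    ∃ T' : A ⟶ B, O.transfVec T' = τ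

/-! ### Operational notions -/

/-- `f` is a deterministic transformation. -/
def IsDet {A B : C} (f : A ⟶ B) : Prop :=
  O.IsTest (fun _ : Unit => f)

open Classical in
/-- `f` is pure: in every refinement of every test containing `f`, the events refining `f` are
`f` times a probability distribution.  The normalization is only demanded when there are such
events (the outcome of a zero event may have an empty set of refining outcomes). -/
def IsPure {A B : C} (f : A ⟶ B) : Prop :=
  ∀ (X Z : Type) [Fintype X] [Fintype Z] (T : X → (A ⟶ B)) (T' : Z → (A ⟶ B)) (q : Z → X)
    (x₀ : X), O.IsTest T → O.IsTest T' → O.IsCoarseGraining q T' T → T x₀ = f →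
    ∃ p : Z → ℝ, (∀ z, 0 ≤ p z) ∧ ((∃ z, q z = x₀) → ∑ z with q z = x₀, p z = 1) ∧
      ∀ z, q z = x₀ → O.transfVec (T' z) = p z • O.transfVec f

/-- Two events coexist: they are the events of two distinct outcomes of one test. -/
def Coexist {A B : C} (f g : A ⟶ B) : Prop :=
  ∃ (X : Type) (_ : Finite X) (T : X → (A ⟶ B)) (x y : X),
    O.IsTest T ∧ x ≠ y ∧ T x = f ∧ T y = g

/-- `f` is internal: for every `g` of the same type, `f = r g + h` for some `r > 0` and some `h`
such that `r g` and `h` coexist (`g'` is the event `r g`). -/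
def IsInternal {A B : C} (f : A ⟶ B) : Prop :=
  ∀ g : A ⟶ B, ∃ (r : ℝ) (g' h : A ⟶ B), 0 < r ∧ O.transfVec g' = r • O.transfVec g ∧
    O.transfVec f = O.transfVec g' + O.transfVec h ∧ O.Coexist g' h

/-- `ρ` is normalized: its operational norm `sup_a (a|ρ)` is `1`. -/
def IsNormalized {A : C} (ρ : 𝟙_ C ⟶ A) : Prop :=
  sSup (Set.range fun a : A ⟶ 𝟙_ C => O.prob (ρ ≫ a)) = 1

open Classical in
/-- The measurement `m` discriminates perfectly the states of the family `ρ`. -/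
def Discriminates {X : Type} [Finite X] {A : C} (m : X → (A ⟶ 𝟙_ C))
    (ρ : X → (𝟙_ C ⟶ A)) : Prop :=
  O.IsTest m ∧ ∀ x x' : X, O.prob (ρ x' ≫ m x) = if x = x' then 1 else 0

/-- The states of the family `ρ` are perfectly distinguishable. -/
def PerfectlyDistinguishable {X : Type} [Finite X] {A : C} (ρ : X → (𝟙_ C ⟶ A)) : Prop :=
  ∃ m : X → (A ⟶ 𝟙_ C), O.Discriminates m ρ

/-- The preparation-test `ρs` is an ensemble decomposition of `ρ`. -/
def IsEnsembleOf {X : Type} [Fintype X] {A : C} (ρs : X → (𝟙_ C ⟶ A)) (ρ : 𝟙_ C ⟶ A) : Prop :=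
  O.IsTest ρs ∧ ∑ x, O.transfVec (ρs x) = O.transfVec ρ

/-- `E` is a lossless encoding for every ensemble decomposition of `ρ`. -/
def IsLossless {A B : C} (E : A ⟶ B) (ρ : 𝟙_ C ⟶ A) : Prop :=
  ∀ (X : Type) [Fintype X] (ρs : X → (𝟙_ C ⟶ A)), O.IsEnsembleOf ρs ρ →
    ∃ D : B ⟶ A, O.IsDet D ∧ ∀ x, ρs x ≫ E ≫ D = ρs x

/-- Every state of the output system is proportional to the encoding of a state that belongs to an
ensemble decomposition of `ρ`. -/
def IsMaximallyEfficient {A B : C} (E : A ⟶ B) (ρ : 𝟙_ C ⟶ A) : Prop :=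
  ∀ σ : 𝟙_ C ⟶ B, ∃ (r : ℝ) (X : Type) (_ : Fintype X) (ρs : X → (𝟙_ C ⟶ A)) (x₀ : X),
    0 ≤ r ∧ O.IsEnsembleOf ρs ρ ∧ O.stVec σ = r • O.stVec (ρs x₀ ≫ E)

/-- `E` is an ideal compression of `ρ`. -/
def IsIdealCompression {A B : C} (E : A ⟶ B) (ρ : 𝟙_ C ⟶ A) : Prop :=
  O.IsDet E ∧ O.IsLossless E ρ ∧ O.IsMaximallyEfficient E ρ

/-- `(E, Ψ, e)` is a purification of `ρ`: the state `Ψ` of `A ⊗ E` is pure, and discarding `E` with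
the deterministic effect `e` leaves `ρ`. -/
def IsPurification {A : C} (ρ : 𝟙_ C ⟶ A) (E : C) (Ψ : 𝟙_ C ⟶ A ⊗ E) (e : E ⟶ 𝟙_ C) : Prop :=
  O.IsPure Ψ ∧ O.IsDet e ∧ Ψ ≫ (A ◁ e) ≫ (ρ_ A).hom = ρ

/-! ### The principles -/

/-- Causality: the choice of an observation-test does not influence the outcome probabilities of
the preceding preparation-test; and conditional tests are tests. -/
def Causality : Prop :=
  (∀ (A : C) (X Y₀ Y₁ : Type) [Fintype X] [Fintype Y₀] [Fintype Y₁] (ρ : X → (𝟙_ C ⟶ A))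
    (m₀ : Y₀ → (A ⟶ 𝟙_ C)) (m₁ : Y₁ → (A ⟶ 𝟙_ C)), O.IsTest ρ → O.IsTest m₀ → O.IsTest m₁ →
    ∀ x, ∑ y, O.prob (ρ x ≫ m₀ y) = ∑ y, O.prob (ρ x ≫ m₁ y)) ∧
  (∀ (A B D : C) (X : Type) (Y : X → Type) [Finite X] [∀ x, Finite (Y x)] (T : X → (A ⟶ B))
    (S : ∀ x, Y x → (B ⟶ D)), O.IsTest T → (∀ x, O.IsTest (S x)) →
    O.IsTest (fun z : Σ x, Y x => T z.1 ≫ S z.1 z.2))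

/-- Purity of Composition. -/
def PurityOfComposition : Prop :=
  ∀ (A B D : C) (f : A ⟶ B) (g : B ⟶ D), O.IsPure f → O.IsPure g → O.IsPure (f ≫ g)

/-- Local Tomography: product effects separate the states of every bipartite system. -/
def LocalTomography : Prop :=
  ∀ (A B : C) (ρ ρ' : 𝟙_ C ⟶ A ⊗ B),
    (∀ (a : A ⟶ 𝟙_ C) (b : B ⟶ 𝟙_ C),
      O.prob (ρ ≫ (a ⊗ₘ b) ≫ (λ_ (𝟙_ C)).hom) = O.prob (ρ' ≫ (a ⊗ₘ b) ≫ (λ_ (𝟙_ C)).hom)) →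
    ρ = ρ'

/-- Perfect State Discrimination: every normalized non-internal state is perfectly distinguishable
from some other state. -/
def PerfectStateDiscrimination : Prop :=
  ∀ (A : C) (ρ₀ : 𝟙_ C ⟶ A), O.IsNormalized ρ₀ → ¬ O.IsInternal ρ₀ →
    ∃ ρ₁ : 𝟙_ C ⟶ A, O.PerfectlyDistinguishable ![ρ₀, ρ₁]

/-- Ideal Compression: every deterministic state has an ideal compression. -/
def IdealCompression : Prop :=
  ∀ (A : C) (ρ : 𝟙_ C ⟶ A), O.IsDet ρ → ∃ (B : C) (E : A ⟶ B), O.IsIdealCompression E ρ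

/-- Purification: every state has a purification, and any two purifications of it with the same
purifying system differ by a reversible transformation of that system. -/
def Purification : Prop :=
  ∀ (A : C) (ρ : 𝟙_ C ⟶ A),
    (∃ (E : C) (Ψ : 𝟙_ C ⟶ A ⊗ E) (e : E ⟶ 𝟙_ C), O.IsPurification ρ E Ψ e) ∧
    ∀ (E : C) (Ψ Ψ' : 𝟙_ C ⟶ A ⊗ E) (e e' : E ⟶ 𝟙_ C),
      O.IsPurification ρ E Ψ e → O.IsPurification ρ E Ψ' e' →
      ∃ U : E ≅ E, Ψ' = Ψ ≫ (A ◁ U.hom) ∧ U.hom ≫ e' = e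

/-! ### Pure maximal sets and pure discriminating measurements -/

/-- The family `α` enumerates (without repetitions, by distinguishability) a pure maximal set: its
states are pure and perfectly distinguishable, and no strictly larger set of states is perfectly
distinguishable. -/
def IsPureMaximal {X : Type} [Finite X] {A : C} (α : X → (𝟙_ C ⟶ A)) : Prop :=
  (∀ x, O.IsPure (α x)) ∧ O.PerfectlyDistinguishable α ∧
  ∀ (Y : Type) [Finite Y] (σ : Y → (𝟙_ C ⟶ A)), O.PerfectlyDistinguishable σ →
    Set.range α ⊆ Set.range σ → Set.range σ = Set.range α

/-- The informational dimension `d_A`: the cardinality of the pure maximal sets of `A` (written as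
the least one, so that it is defined before the cardinalities are known to agree). -/
noncomputable def infoDim (A : C) : ℕ :=
  sInf {n | ∃ α : Fin n → (𝟙_ C ⟶ A), O.IsPureMaximal α}

/-- The family `a` is a pure discriminating measurement: a test that consists of pure effects and
discriminates perfectly some family of states. -/
def IsPureDiscriminating {X : Type} [Finite X] {A : C} (a : X → (A ⟶ 𝟙_ C)) : Prop :=
  (∀ x, O.IsPure (a x)) ∧ ∃ ρ : X → (𝟙_ C ⟶ A), O.Discriminates a ρ

end OPT

namespace OPT

variable {C : Type u} [Category.{v} C] [MonoidalCategory C] [SymmetricCategory C]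

/-! Causality, coarse-graining and limits turn the theory into convex geometry. The states of a
system are the vectors of norm at most one in a closed cone (`exists_normalize`, `state_of_inCone`),
and every finite family of states of total norm one is a preparation-test (`isTest_states`). By
local tomography, linear relations between events can be checked without reference systems
(`transfVec_of_mat`).

Purification together with one perfectly distinguishable pair of states gives steering
(`exists_steering`): every decomposition of a marginal of a pure bipartite state is prepared by an
effect on the other side. When the marginals are faithful this is a dictionary between effects of
one system and states of the other. It yields pure instruments, measurements that do not disturb the
states on which they are certain (`exists_nondisturbing`), and uniqueness of the state on which a
pure effect is certain (`eq_of_pure_effect`). Non-disturbing measurements can be chained, so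
distinguishable families grow one state at a time (`pd_adjoin`). Perfect State Discrimination makes
the barycenter of a pure maximal set faithful, and then the discriminating effects are pure
(`isPure_of_discriminates`).

For the cardinality, take a state `χ` fixed by all reversible transformations. These act
transitively on pure states, so every pure state has the same largest weight `p` in `χ`; steering
back and forth shows that every pure effect that is certain on some state has probability exactly
`p` on `χ` (`exists_balanced`). Summing over a discriminating measurement, the cardinality times `p`
is one.

An effect `b` is diagonalized greedily: at a pure state `β` maximizing `b`, split off `b(β)` times a
pure effect certain on `β` (`exists_split_effect`); the remainder vanishes on `β` and on the states
found before, and finite dimension stops the process. Adding multiples of the deterministic effect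
covers the whole span. A vector of the state space is a combination of a state `ρ` and of `χ`;
purify `χ`, steer to `ρ` by an effect, and diagonalize that effect. Its pure components prepare `p`
times pure states (`stVec_marginal`) that sum to `χ` and form a pure maximal set.

The bit needed for steering exists as soon as `A` has two deterministic states (`hasBit_of_ne`).
Otherwise the state space of `A` is a line and the claims are immediate. -/

/-- The standing assumptions and the principles, bundled together. -/
structure Principles (O : OPT C) : Prop where
  sep : O.Separation
  cg : O.ClosedUnderCoarseGraining
  fin : O.FiniteDimensionality
  nd : O.NonDeterminism
  lim : O.ClosedUnderLimits
  caus : O.Causality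
  pur : O.PurityOfComposition
  loc : O.LocalTomography
  pdisc : O.PerfectStateDiscrimination
  compr : O.IdealCompression
  purif : O.Purification

variable {O : OPT C}

/-! ### Scalars and matrix elements -/

/-- Eckmann–Hilton: on the unit object, composition and tensor product agree up to unitors, so
independence makes `prob` multiplicative. -/
lemma prob_comp (s t : 𝟙_ C ⟶ 𝟙_ C) : O.prob (s ≫ t) = O.prob s * O.prob t := by
  rw [← O.prob_tensor]
  congr 1
  rw [MonoidalCategory.tensorHom_def]
  simp [unitors_equal, unitors_inv_equal]

lemma isTest_id (A : C) : O.IsTest (fun _ : Unit => 𝟙 A) := O.isTest_iso (Iso.refl A)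

lemma prob_id : O.prob (𝟙 (𝟙_ C)) = 1 := by
  have := O.sum_prob _ (O.isTest_id (𝟙_ C))
  simpa using this

/-- The context of type `A ⟶ B` without reference system. -/
def simpleContext {A B : C} (ρ : 𝟙_ C ⟶ A) (m : B ⟶ 𝟙_ C) : Context A B :=
  ⟨𝟙_ C, ρ ≫ (ρ_ A).inv, (ρ_ B).hom ≫ m⟩

lemma transfVec_simpleContext {A B : C} (f : A ⟶ B) (ρ : 𝟙_ C ⟶ A) (m : B ⟶ 𝟙_ C) :
    O.transfVec f (simpleContext ρ m) = O.prob (ρ ≫ f ≫ m) := by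
  simp [transfVec, simpleContext]

/-- The effect on the output of a preparation that is defined by a context. -/
def stateContext {A : C} (c : Context (𝟙_ C) A) : A ⟶ 𝟙_ C :=
  (ρ_ A).inv ≫ (A ◁ (c.2.1 ≫ (λ_ c.1).hom)) ≫ c.2.2

/-- With trivial input, the reference preparation slides past the state and is absorbed into an
effect. States are thus tested by effects alone, with no reference system. -/
lemma transfVec_state {A : C} (ρ : 𝟙_ C ⟶ A) (c : Context (𝟙_ C) A) :
    O.transfVec ρ c = O.stVec ρ (stateContext c) := by
  obtain ⟨R, σ, m⟩ := c
  simp only [transfVec, stVec, stateContext]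
  congr 1
  have h : σ = (σ ≫ (λ_ R).hom) ≫ (λ_ R).inv := by simp
  conv_lhs => rw [h]
  generalize σ ≫ (λ_ R).hom = τ
  rw [leftUnitor_inv_naturality, Category.assoc, whisker_exchange_assoc, unitors_inv_equal,
    rightUnitor_inv_naturality_assoc]

lemma transfVec_effect {A : C} (a : A ⟶ 𝟙_ C) (c : Context A (𝟙_ C)) :
    O.transfVec a c =
      O.prob ((c.2.1 ≫ (A ◁ ((λ_ c.1).inv ≫ c.2.2)) ≫ (ρ_ A).hom) ≫ a) := by
  obtain ⟨R, σ, m⟩ := c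
  simp only [transfVec]
  congr 1
  have h : m = (λ_ R).hom ≫ ((λ_ R).inv ≫ m) := by simp
  conv_lhs => rw [h]
  generalize (λ_ R).inv ≫ m = τ
  simp only [Category.assoc]
  rw [← leftUnitor_naturality, ← whisker_exchange_assoc, unitors_equal, rightUnitor_naturality]

/-- The matrix element `(m|f|ρ)`, as a function of the preparation and of the effect. -/
def mat (O : OPT C) {A B : C} (f : A ⟶ B) : (𝟙_ C ⟶ A) × (B ⟶ 𝟙_ C) → ℝ :=
  fun x => O.prob (x.1 ≫ f ≫ x.2)

lemma stVec_apply {A : C} (ρ : 𝟙_ C ⟶ A) (m : A ⟶ 𝟙_ C) : O.stVec ρ m = O.prob (ρ ≫ m) := rfl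

lemma stVec_comp {A B : C} (ρ : 𝟙_ C ⟶ A) (f : A ⟶ B) (m : B ⟶ 𝟙_ C) :
    O.stVec (ρ ≫ f) m = O.stVec ρ (f ≫ m) := by simp [stVec]

lemma stVec_scalar_comp {A : C} (s : 𝟙_ C ⟶ 𝟙_ C) (ρ : 𝟙_ C ⟶ A) :
    O.stVec (s ≫ ρ) = O.prob s • O.stVec ρ := by
  ext m; simp [stVec, prob_comp]

lemma stVec_nonneg {A : C} (ρ : 𝟙_ C ⟶ A) (m) : 0 ≤ O.stVec ρ m := O.prob_nonneg _
lemma stVec_le_one {A : C} (ρ : 𝟙_ C ⟶ A) (m) : O.stVec ρ m ≤ 1 := O.prob_le_one _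

lemma stVec_mem {A : C} (ρ : 𝟙_ C ⟶ A) : O.stVec ρ ∈ O.StR A :=
  Submodule.subset_span ⟨ρ, rfl⟩

namespace Principles

variable (H : O.Principles)
include H

lemma event_ext {A B : C} {f g : A ⟶ B} (h : O.transfVec f = O.transfVec g) : f = g :=
  H.sep A B f g fun R ρ m => congrFun h ⟨R, ρ, m⟩

lemma state_ext {A : C} {ρ σ : 𝟙_ C ⟶ A} (h : O.stVec ρ = O.stVec σ) : ρ = σ :=
  H.event_ext (by ext c; rw [transfVec_state, transfVec_state, h])

lemma effect_ext {A : C} {a b : A ⟶ 𝟙_ C} (h : ∀ ρ, O.stVec ρ a = O.stVec ρ b) : a = b :=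
  H.event_ext (by ext c; rw [transfVec_effect, transfVec_effect]; exact h _)

lemma scalar_ext {s t : 𝟙_ C ⟶ 𝟙_ C} (h : O.prob s = O.prob t) : s = t :=
  H.state_ext (by ext m; simp [stVec, prob_comp, h])

/-! ### Coarse-graining -/

open Classical in
-- Separation identifies the given events with those that closure under coarse-graining only asserts
-- to exist, which turns closure into a criterion for being a test.
lemma isTest_of_coarse {X Z : Type} [Fintype X] [Fintype Z] {A B : C} {T' : Z → (A ⟶ B)}
    (hT' : O.IsTest T') (p : Z → X) (T : X → (A ⟶ B))
    (h : ∀ x, O.transfVec (T x) = ∑ z, if p z = x then O.transfVec (T' z) else 0) :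
    O.IsTest T := by
  obtain ⟨S, hS, hS'⟩ := H.cg X Z A B p T' hT'
  have : S = T := by
    funext x
    apply H.event_ext
    rw [hS' x, h x, Finset.sum_filter]
  exact this ▸ hS

open Classical in
lemma exists_coarse {X Z : Type} [Fintype X] [Fintype Z] {A B : C} {T' : Z → (A ⟶ B)}
    (hT' : O.IsTest T') (p : Z → X) : ∃ T : X → (A ⟶ B), O.IsTest T ∧
      ∀ x, O.transfVec (T x) = ∑ z, if p z = x then O.transfVec (T' z) else 0 := by
  obtain ⟨S, hS, hS'⟩ := H.cg X Z A B p T' hT'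
  refine ⟨S, hS, fun x => ?_⟩
  rw [hS' x, Finset.sum_filter]

lemma isTest_reindex {X Z : Type} [Finite X] [Finite Z] {A B : C} {T : Z → (A ⟶ B)}
    (hT : O.IsTest T) (e : X ≃ Z) : O.IsTest (T ∘ e) := by
  classical
  have := Fintype.ofFinite X
  have := Fintype.ofFinite Z
  refine H.isTest_of_coarse hT e.symm _ fun x => ?_
  rw [Finset.sum_eq_single (e x)]
  · simp
  · intro z _ hz
    rw [if_neg]
    rintro rfl
    simp at hz
  · simp

/-- Joining together all the outcomes of a test. -/
lemma exists_det_sum {X : Type} [Fintype X] {A B : C} {T : X → (A ⟶ B)} (hT : O.IsTest T) :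
    ∃ f : A ⟶ B, O.IsDet f ∧ O.transfVec f = ∑ x, O.transfVec (T x) := by
  obtain ⟨S, hS, hS'⟩ := H.exists_coarse hT (fun _ => ())
  exact ⟨S (), hS, by simp [hS']⟩

/-- Every event has a complementary event. -/
lemma exists_binary {A B : C} {X : Type} [Finite X] {T : X → (A ⟶ B)} (hT : O.IsTest T) (x : X) :
    ∃ g, O.IsTest ![T x, g] := by
  classical
  have := Fintype.ofFinite X
  obtain ⟨S, hS, hS'⟩ := H.exists_coarse hT (fun z => if z = x then (0 : Fin 2) else 1)
  refine ⟨S 1, ?_⟩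
  have : ![T x, S 1] = S := by
    funext i
    fin_cases i
    · apply H.event_ext
      simp only [Fin.zero_eta, Matrix.cons_val_zero, hS']
      rw [Finset.sum_eq_single x] <;> simp +contextual
    · simp
  exact this ▸ hS

lemma exists_compl {A B : C} (f : A ⟶ B) : ∃ g, O.IsTest ![f, g] := by
  obtain ⟨X, _, T, hT, x, rfl⟩ := O.exists_test_of_event f
  exact H.exists_binary hT x

lemma isTest_swap {A B : C} {f g : A ⟶ B} (h : O.IsTest ![f, g]) : O.IsTest ![g, f] := by
  convert H.isTest_reindex h (Equiv.swap 0 1) using 1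
  funext i
  fin_cases i <;> simp

lemma isTest_comp_det {X : Type} [Finite X] {A B D : C} {T : X → (A ⟶ B)} (hT : O.IsTest T)
    {f : B ⟶ D} (hf : O.IsDet f) : O.IsTest (fun x => T x ≫ f) :=
  H.isTest_reindex (O.isTest_comp T (fun _ : Unit => f) hT hf) (Equiv.prodPUnit X).symm

lemma isTest_det_comp {X : Type} [Finite X] {A B D : C} {T : X → (B ⟶ D)} (hT : O.IsTest T)
    {f : A ⟶ B} (hf : O.IsDet f) : O.IsTest (fun x => f ≫ T x) :=
  H.isTest_reindex (O.isTest_comp (fun _ : Unit => f) T hf hT) (Equiv.punitProd X).symm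

lemma isDet_comp {A B D : C} {f : A ⟶ B} {g : B ⟶ D} (hf : O.IsDet f) (hg : O.IsDet g) :
    O.IsDet (f ≫ g) := H.isTest_comp_det hf hg

lemma isTest_whiskerLeft {X : Type} [Finite X] {A B : C} {T : X → (A ⟶ B)} (hT : O.IsTest T)
    (R : C) : O.IsTest (fun x => R ◁ T x) := by
  have := H.isTest_reindex (O.isTest_tensor _ T (O.isTest_id R) hT) (Equiv.punitProd X).symm
  convert this using 2
  simp [id_tensorHom]

lemma isTest_whiskerRight {X : Type} [Finite X] {A B : C} {T : X → (A ⟶ B)} (hT : O.IsTest T)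
    (R : C) : O.IsTest (fun x => T x ▷ R) := by
  have := H.isTest_reindex (O.isTest_tensor T _ hT (O.isTest_id R)) (Equiv.prodPUnit X).symm
  convert this using 2
  simp [tensorHom_id]

omit H in
lemma isDet_iso {A B : C} (U : A ≅ B) : O.IsDet U.hom := O.isTest_iso U

/-! ### The deterministic effect -/

lemma exists_det_effect (A : C) : ∃ e : A ⟶ 𝟙_ C, O.IsDet e := by
  obtain ⟨X, _, T, hT⟩ := O.exists_observation_test A
  have := Fintype.ofFinite X
  obtain ⟨e, he, -⟩ := H.exists_det_sum hT
  exact ⟨e, he⟩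

/-- The deterministic effect. -/
noncomputable def disc (A : C) : A ⟶ 𝟙_ C := (H.exists_det_effect A).choose

lemma isDet_disc (A : C) : O.IsDet (H.disc A) := (H.exists_det_effect A).choose_spec

/-- Causality in usable form: the total probability is the same for every measurement, so it can be
compared with the one-outcome measurement. -/
lemma sum_stVec {X : Type} [Fintype X] {A : C} {m : X → (A ⟶ 𝟙_ C)} (hm : O.IsTest m)
    (ρ : 𝟙_ C ⟶ A) : ∑ x, O.stVec ρ (m x) = O.stVec ρ (H.disc A) := by
  obtain ⟨Z, _, T, hT, z, rfl⟩ := O.exists_test_of_event ρ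
  have := Fintype.ofFinite Z
  have := H.caus.1 A Z X Unit T m _ hT hm (H.isDet_disc A) z
  simpa [stVec] using this

lemma eq_disc {A : C} {e : A ⟶ 𝟙_ C} (he : O.IsDet e) : e = H.disc A :=
  H.effect_ext fun ρ => by simpa using H.sum_stVec he ρ

lemma det_comp_disc {A B : C} {f : A ⟶ B} (hf : O.IsDet f) : f ≫ H.disc B = H.disc A :=
  H.eq_disc (H.isDet_comp hf (H.isDet_disc B))

lemma disc_unit : H.disc (𝟙_ C) = 𝟙 _ := (H.eq_disc (O.isTest_id _)).symm

lemma sum_norm {X : Type} [Fintype X] {A : C} {T : X → (𝟙_ C ⟶ A)} (hT : O.IsTest T) :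
    ∑ x, O.stVec (T x) (H.disc A) = 1 :=
  O.sum_prob _ (H.isTest_comp_det hT (H.isDet_disc A))

lemma stVec_compl {A : C} {a b : A ⟶ 𝟙_ C} (h : O.IsTest ![a, b]) (ρ : 𝟙_ C ⟶ A) :
    O.stVec ρ a + O.stVec ρ b = O.stVec ρ (H.disc A) := by
  simpa using H.sum_stVec h ρ

lemma stVec_le_disc {A : C} (a : A ⟶ 𝟙_ C) (ρ : 𝟙_ C ⟶ A) :
    O.stVec ρ a ≤ O.stVec ρ (H.disc A) := by
  obtain ⟨b, hb⟩ := H.exists_compl a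
  have := H.stVec_compl hb ρ
  have := stVec_nonneg (O := O) ρ b
  linarith

lemma norm_of_isDet {A : C} {ρ : 𝟙_ C ⟶ A} (h : O.IsDet ρ) : O.stVec ρ (H.disc A) = 1 := by
  simpa using H.sum_norm h

lemma stVec_eq_zero {A : C} {ρ : 𝟙_ C ⟶ A} (h : O.stVec ρ (H.disc A) = 0) : O.stVec ρ = 0 := by
  ext a
  exact le_antisymm ((H.stVec_le_disc a ρ).trans_eq h) (stVec_nonneg _ _)

/-- The complementary event of a state of norm one has norm zero, hence is the zero vector, and
merging it into the state changes nothing. -/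
lemma isDet_of_norm {A : C} {ρ : 𝟙_ C ⟶ A} (h : O.stVec ρ (H.disc A) = 1) : O.IsDet ρ := by
  obtain ⟨σ, hσ⟩ := H.exists_compl ρ
  have h1 : O.stVec σ (H.disc A) = 0 := by
    have := H.sum_norm hσ
    simp at this
    linarith
  refine H.isTest_of_coarse hσ (fun _ => ()) _ fun x => ?_
  have h2 := H.stVec_eq_zero h1
  ext c
  simp [transfVec_state, h2]

lemma exists_isDet_state (A : C) : ∃ ρ : 𝟙_ C ⟶ A, O.IsDet ρ := by
  obtain ⟨X, _, T, hT⟩ := O.exists_preparation_test A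
  have := Fintype.ofFinite X
  obtain ⟨e, he, -⟩ := H.exists_det_sum hT
  exact ⟨e, he⟩

end Principles

/-! ### Scalars acting on events -/

/-- The scalar `s`, acting on the system `A`. -/
def scale (s : 𝟙_ C ⟶ 𝟙_ C) (A : C) : A ⟶ A := (λ_ A).inv ≫ s ▷ A ≫ (λ_ A).hom

omit [SymmetricCategory C] in
lemma comp_scale (s : 𝟙_ C ⟶ 𝟙_ C) {A : C} (ρ : 𝟙_ C ⟶ A) : ρ ≫ scale s A = s ≫ ρ := by
  unfold scale
  rw [leftUnitor_inv_naturality_assoc, whisker_exchange_assoc, leftUnitor_naturality,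
    unitors_inv_equal, unitors_equal]
  simp

omit [SymmetricCategory C] in
lemma scale_whiskerRight (s : 𝟙_ C ⟶ 𝟙_ C) (A R : C) : scale s A ▷ R = scale s (A ⊗ R) := by
  unfold scale
  simp

lemma transfVec_scale_comp (s : 𝟙_ C ⟶ 𝟙_ C) {A B : C} (f : A ⟶ B) :
    O.transfVec (scale s A ≫ f) = O.prob s • O.transfVec f := by
  ext ⟨R, ρ, m⟩
  simp only [transfVec, comp_whiskerRight, scale_whiskerRight, Category.assoc, Pi.smul_apply,
    smul_eq_mul]
  rw [← Category.assoc, comp_scale, Category.assoc, prob_comp]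

lemma transfVec_scalar (s : 𝟙_ C ⟶ 𝟙_ C) :
    O.transfVec s = O.prob s • O.transfVec (𝟙 (𝟙_ C)) := by
  ext c
  simp [transfVec_state, stVec, prob_comp]

/-- Vectors that are a nonnegative multiple of a state. -/
def InCone (O : OPT C) {A : C} (v : (A ⟶ 𝟙_ C) → ℝ) : Prop :=
  ∃ (r : ℝ) (ρ : 𝟙_ C ⟶ A), 0 ≤ r ∧ v = r • O.stVec ρ

lemma inCone_stVec {A : C} (ρ : 𝟙_ C ⟶ A) : O.InCone (O.stVec ρ) := ⟨1, ρ, by simp⟩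

lemma InCone.smul {A : C} {v : (A ⟶ 𝟙_ C) → ℝ} (hv : O.InCone v) {r : ℝ} (hr : 0 ≤ r) :
    O.InCone (r • v) := by
  obtain ⟨t, ρ, ht, rfl⟩ := hv
  exact ⟨r * t, ρ, by positivity, by rw [mul_smul]⟩

lemma InCone.nonneg {A : C} {v : (A ⟶ 𝟙_ C) → ℝ} (hv : O.InCone v) (m) : 0 ≤ v m := by
  obtain ⟨t, ρ, ht, rfl⟩ := hv
  exact mul_nonneg ht (stVec_nonneg _ _)

lemma inCone_zero (A : C) (ρ : 𝟙_ C ⟶ A) : O.InCone (0 : (A ⟶ 𝟙_ C) → ℝ) := ⟨0, ρ, by simp⟩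

namespace Principles

variable (H : O.Principles)
include H

omit H in
lemma prob_compl {s t : 𝟙_ C ⟶ 𝟙_ C} (h : O.IsTest ![s, t]) : O.prob t = 1 - O.prob s := by
  have := O.sum_prob _ h
  simp at this
  linarith

/-! ### Mixtures and limits -/

/-- Toss the coin with weight `prob s`, then perform a test containing `f` or one containing `g`,
and forget the coin by coarse-graining. -/
lemma exists_mix_prob (s : 𝟙_ C ⟶ 𝟙_ C) {A B : C} (f g : A ⟶ B) : ∃ h : A ⟶ B,
    O.transfVec h = O.prob s • O.transfVec f + (1 - O.prob s) • O.transfVec g := by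
  obtain ⟨t, ht⟩ := H.exists_compl s
  obtain ⟨f', hf⟩ := H.exists_compl f
  obtain ⟨g', hg⟩ := H.exists_compl g
  have hs : O.IsTest (fun i => scale (![s, t] i) A) :=
    H.isTest_comp_det (H.isTest_det_comp (H.isTest_whiskerRight ht A) (isDet_iso (λ_ A).symm))
      (isDet_iso (λ_ A)) |> fun h => by simpa [scale] using h
  have h2 : O.IsTest (fun z : Σ _ : Fin 2, Fin 2 =>
      scale (![s, t] z.1) A ≫ (![![f, f'], ![g, g']] : Fin 2 → Fin 2 → (A ⟶ B)) z.1 z.2) := by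
    refine H.caus.2 A A B (Fin 2) (fun _ => Fin 2) _
      (![![f, f'], ![g, g']] : Fin 2 → Fin 2 → (A ⟶ B)) hs fun i => ?_
    fin_cases i
    · exact hf
    · exact hg
  obtain ⟨T, -, hT⟩ := H.exists_coarse h2 (fun z => z.2)
  refine ⟨T 0, ?_⟩
  rw [hT, Fintype.sum_sigma]
  simp [transfVec_scale_comp, prob_compl ht]

lemma isClosed_StR (A : C) : IsClosed (O.StR A : Set ((A ⟶ 𝟙_ C) → ℝ)) :=
  have := H.fin A
  Submodule.closed_of_finiteDimensional _

/-- Closure under limits requires the limit to lie in the span. Finite dimensionality supplies this,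
since a finite-dimensional subspace is closed under pointwise convergence. -/
lemma exists_state_of_tendsto {A : C} (ρ : ℕ → (𝟙_ C ⟶ A)) {v : (A ⟶ 𝟙_ C) → ℝ}
    (h : ∀ m, Tendsto (fun n => O.stVec (ρ n) m) atTop (𝓝 (v m))) : ∃ σ, O.stVec σ = v := by
  have hv : v ∈ O.StR A :=
    (H.isClosed_StR A).mem_of_tendsto (tendsto_pi_nhds.2 h)
      (Eventually.of_forall fun n => stVec_mem (ρ n))
  let L : ((A ⟶ 𝟙_ C) → ℝ) →ₗ[ℝ] (Context (𝟙_ C) A → ℝ) :=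
    LinearMap.funLeft ℝ ℝ stateContext
  have hL : ∀ σ : 𝟙_ C ⟶ A, L (O.stVec σ) = O.transfVec σ := fun σ => by
    ext c; simp [L, LinearMap.funLeft, transfVec_state]
  have hLv : L v ∈ O.TransfR (𝟙_ C) A := by
    have := Submodule.mem_map_of_mem (f := L) hv
    rw [StR, Submodule.map_span, ← Set.range_comp] at this
    have e : Set.range (fun σ : 𝟙_ C ⟶ A => O.transfVec σ) =
        Set.range (L ∘ fun σ => O.stVec σ) := congrArg Set.range (funext fun σ => (hL σ).symm)
    rwa [TransfR, e]
  obtain ⟨σ, hσ⟩ := H.lim _ _ ρ (L v) hLv fun c => by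
    simp only [transfVec_state]
    exact h _
  refine ⟨σ, ?_⟩
  ext m
  have := congrFun hσ (simpleContext (𝟙 _) m)
  rw [transfVec_simpleContext] at this
  have hc : stateContext (simpleContext (𝟙 _) m) = m := by
    simp [stateContext, simpleContext, unitors_equal]
  simpa [L, LinearMap.funLeft, stVec, hc] using this

/-- The attained probabilities form a closed set that contains 1, contains 0 as the limit of powers
of a nontrivial probability, and is stable under mixing with a fixed weight strictly between 0 and
1. Such a set has no gaps. -/
lemma exists_scalar {p : ℝ} (h0 : 0 ≤ p) (h1 : p ≤ 1) : ∃ s : 𝟙_ C ⟶ 𝟙_ C, O.prob s = p := by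
  let S : Set ℝ := {p | ∃ s : 𝟙_ C ⟶ 𝟙_ C, O.prob s = p}
  have hS01 : ∀ x ∈ S, 0 ≤ x ∧ x ≤ 1 := by
    rintro x ⟨s, rfl⟩
    exact ⟨O.prob_nonneg s, O.prob_le_one s⟩
  have hSc : IsClosed S := by
    rw [← isSeqClosed_iff_isClosed]
    intro x y hx hxy
    choose s hs using hx
    obtain ⟨σ, hσ⟩ := H.exists_state_of_tendsto s (v := y • O.stVec (𝟙 _)) fun m => by
      simp only [stVec, prob_comp, hs, Pi.smul_apply, smul_eq_mul, prob_id, one_mul]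
      exact hxy.mul_const _
    exact ⟨σ, by simpa [stVec, prob_id] using congrFun hσ (𝟙 _)⟩
  obtain ⟨s, hs0, hs1⟩ := H.nd
  have hmix : ∀ x ∈ S, ∀ y ∈ S, O.prob s * x + (1 - O.prob s) * y ∈ S := by
    rintro _ ⟨a, rfl⟩ _ ⟨b, rfl⟩
    obtain ⟨t, ht⟩ := H.exists_mix_prob s a b
    refine ⟨t, ?_⟩
    have := congrFun ht (simpleContext (𝟙 _) (𝟙 _))
    simpa [transfVec_simpleContext] using this
  have hp0 : 0 < O.prob s := lt_of_le_of_ne (O.prob_nonneg s) hs0.symm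
  have hp1 : O.prob s < 1 := lt_of_le_of_ne (O.prob_le_one s) hs1
  have hS1 : (1 : ℝ) ∈ S := ⟨𝟙 _, prob_id⟩
  have hpow : ∀ n : ℕ, O.prob s ^ n ∈ S := by
    intro n
    induction n with
    | zero => simpa using hS1
    | succ n ih =>
      obtain ⟨t, ht⟩ := ih
      exact ⟨t ≫ s, by rw [prob_comp, ht, pow_succ]⟩
  have hS0 : (0 : ℝ) ∈ S :=
    hSc.mem_of_tendsto (tendsto_pow_atTop_nhds_zero_of_lt_one hp0.le hp1)
      (Eventually.of_forall hpow)
  by_contra hp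
  have hpS : p ∉ S := hp
  -- If `p` is missed, both ends of the gap around it are attained, and their mixture falls strictly
  -- inside the gap.
  have hq := (hSc.inter isClosed_Iic).csSup_mem (s := S ∩ Set.Iic p) ⟨0, hS0, h0⟩
    ⟨p, fun x hx => hx.2⟩
  have hr := (hSc.inter isClosed_Ici).csInf_mem (s := S ∩ Set.Ici p) ⟨1, hS1, h1⟩
    ⟨p, fun x hx => hx.2⟩
  set q := sSup (S ∩ Set.Iic p)
  set r := sInf (S ∩ Set.Ici p)
  have hqp : q < p := lt_of_le_of_ne hq.2 fun h => hpS (h ▸ hq.1)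
  have hpr : p < r := lt_of_le_of_ne hr.2 fun h => hpS (h ▸ hr.1)
  have hm := hmix q hq.1 r hr.1
  rcases le_total (O.prob s * q + (1 - O.prob s) * r) p with h | h
  · have : O.prob s * q + (1 - O.prob s) * r ≤ q :=
      le_csSup (s := S ∩ Set.Iic p) ⟨p, fun x hx => hx.2⟩ ⟨hm, h⟩
    nlinarith
  · have : r ≤ O.prob s * q + (1 - O.prob s) * r :=
      csInf_le (s := S ∩ Set.Ici p) ⟨p, fun x hx => hx.2⟩ ⟨hm, h⟩
    nlinarith

lemma exists_mix {p : ℝ} (h0 : 0 ≤ p) (h1 : p ≤ 1) {A B : C} (f g : A ⟶ B) : ∃ h : A ⟶ B,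
    O.transfVec h = p • O.transfVec f + (1 - p) • O.transfVec g := by
  obtain ⟨s, rfl⟩ := H.exists_scalar h0 h1
  exact H.exists_mix_prob s f g

omit H in
lemma stVec_of_transfVec {A : C} {X : Type} [Fintype X] (c : X → ℝ) (ρ : X → (𝟙_ C ⟶ A))
    {σ : 𝟙_ C ⟶ A} (h : O.transfVec σ = ∑ x, c x • O.transfVec (ρ x)) :
    O.stVec σ = ∑ x, c x • O.stVec (ρ x) := by
  ext m
  have := congrFun h (simpleContext (𝟙 _) m)
  simpa [transfVec_simpleContext, stVec] using this

omit H in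
lemma transfVec_of_stVec {A : C} {X : Type} [Fintype X] (c : X → ℝ) (ρ : X → (𝟙_ C ⟶ A))
    {σ : 𝟙_ C ⟶ A} (h : O.stVec σ = ∑ x, c x • O.stVec (ρ x)) :
    O.transfVec σ = ∑ x, c x • O.transfVec (ρ x) := by
  ext m
  simp [transfVec_state, h]

lemma exists_mix_state {p : ℝ} (h0 : 0 ≤ p) (h1 : p ≤ 1) {A : C} (ρ σ : 𝟙_ C ⟶ A) :
    ∃ τ : 𝟙_ C ⟶ A, O.stVec τ = p • O.stVec ρ + (1 - p) • O.stVec σ := by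
  obtain ⟨τ, hτ⟩ := H.exists_mix h0 h1 ρ σ
  refine ⟨τ, ?_⟩
  have := stVec_of_transfVec ![p, 1 - p] ![ρ, σ] (σ := τ) (by simpa using hτ)
  simpa using this

lemma exists_scale_state {p : ℝ} (h0 : 0 ≤ p) (h1 : p ≤ 1) {A : C} (ρ : 𝟙_ C ⟶ A) :
    ∃ τ : 𝟙_ C ⟶ A, O.stVec τ = p • O.stVec ρ := by
  obtain ⟨s, rfl⟩ := H.exists_scalar h0 h1
  exact ⟨s ≫ ρ, stVec_scalar_comp s ρ⟩

/-- Every nonzero state is proportional to a deterministic one. -/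
lemma exists_normalize {A : C} (ρ : 𝟙_ C ⟶ A) (hρ : O.stVec ρ (H.disc A) ≠ 0) :
    ∃ σ : 𝟙_ C ⟶ A, O.IsDet σ ∧ O.stVec ρ = O.stVec ρ (H.disc A) • O.stVec σ := by
  set n := O.stVec ρ (H.disc A) with hn
  have hn0 : 0 < n := lt_of_le_of_ne (stVec_nonneg _ _) (Ne.symm hρ)
  let S : Set ℝ := {c | ∃ σ : 𝟙_ C ⟶ A, O.stVec σ = c • O.stVec ρ}
  have hS1 : (1 : ℝ) ∈ S := ⟨ρ, by simp⟩
  have hbd : ∀ c ∈ S, c ≤ 1 / n := by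
    rintro c ⟨σ, hσ⟩
    rw [le_div_iff₀ hn0]
    have := congrFun hσ (H.disc A)
    simp only [Pi.smul_apply, smul_eq_mul] at this
    rw [hn, ← this]
    exact stVec_le_one _ _
  have hclosed : IsClosed S := by
    rw [← isSeqClosed_iff_isClosed]
    intro x y hx hxy
    choose s hs using hx
    obtain ⟨σ, hσ⟩ := H.exists_state_of_tendsto s (v := y • O.stVec ρ) fun m => by
      simp only [hs, Pi.smul_apply, smul_eq_mul]
      exact hxy.mul_const _
    exact ⟨σ, hσ⟩
  have hc := hclosed.csSup_mem ⟨1, hS1⟩ ⟨1 / n, hbd⟩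
  set c := sSup S
  -- Retry after failure: run a test containing `ρ`, keep `ρ` on success, and otherwise discard and
  -- prepare the best multiple `c • ρ` found so far. The success event is `ρ` plus `(1 - n)` times
  -- `c • ρ`. Maximality of `c` then forces `c * n = 1`.
  have hstep : 1 + (1 - n) * c ∈ S := by
    obtain ⟨σ, hσ⟩ := hc
    obtain ⟨ρ', hρ'⟩ := H.exists_compl ρ
    obtain ⟨σ', hσ'⟩ := H.exists_compl σ
    obtain ⟨z, hz⟩ := H.exists_scale_state le_rfl zero_le_one ρ
    -- The identity is padded with a zero event so that both branches of the conditional test have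
    -- two outcomes.
    have hid : O.IsTest ![𝟙 A, scale (H.exists_scalar le_rfl zero_le_one).choose A] := by
      refine H.isTest_of_coarse (isTest_id A) (fun _ => (0 : Fin 2)) _ fun x => ?_
      fin_cases x
      · simp
      · have := (H.exists_scalar le_rfl zero_le_one).choose_spec
        simp only [Fin.mk_one, Matrix.cons_val_one, Matrix.cons_val_zero, zero_ne_one, if_false,
          Finset.sum_const_zero]
        rw [← Category.comp_id (scale _ A), transfVec_scale_comp, this, zero_smul]
    set z' := scale (H.exists_scalar le_rfl zero_le_one).choose A
    have h2 : O.IsTest (fun w : Σ _ : Fin 2, Fin 2 => (![ρ, ρ'] w.1) ≫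
        (![![𝟙 A, z'], ![H.disc A ≫ σ, H.disc A ≫ σ']] : Fin 2 → Fin 2 → (A ⟶ A)) w.1 w.2) := by
      refine H.caus.2 _ A A (Fin 2) (fun _ => Fin 2) _ (![![𝟙 A, z'],
        ![H.disc A ≫ σ, H.disc A ≫ σ']] : Fin 2 → Fin 2 → (A ⟶ A)) hρ' fun i => ?_
      fin_cases i
      · exact hid
      · have := H.isTest_det_comp hσ' (H.isDet_disc A)
        convert this using 1
        funext j
        fin_cases j <;> rfl
    obtain ⟨T, -, hT⟩ := H.exists_coarse h2 (fun z => z.2)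
    refine ⟨T 0, ?_⟩
    have h3 := hT 0
    rw [Fintype.sum_sigma] at h3
    simp only [Fin.sum_univ_two] at h3
    have h4 := stVec_of_transfVec ![1, 1] ![ρ ≫ 𝟙 A, ρ' ≫ H.disc A ≫ σ] (σ := T 0)
      (by simpa using h3)
    rw [h4]
    simp only [Fin.sum_univ_two, Matrix.cons_val_zero, Matrix.cons_val_one, one_smul,
      Category.comp_id]
    rw [← Category.assoc, stVec_scalar_comp, hσ]
    have h5 : O.prob (ρ' ≫ H.disc A) = 1 - n := by
      have := H.sum_norm hρ'
      simp at this
      rw [← stVec_apply]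
      linarith
    rw [h5, smul_smul, add_smul, one_smul]
  have hle : 1 + (1 - n) * c ≤ c := le_csSup ⟨1 / n, hbd⟩ hstep
  have hc1 : c * n = 1 := by
    have := hbd c hc
    rw [le_div_iff₀ hn0] at this
    nlinarith
  obtain ⟨σ, hσ⟩ := hc
  refine ⟨σ, H.isDet_of_norm ?_, ?_⟩
  · rw [hσ]
    exact hc1
  · rw [hσ, smul_smul, mul_comm, hc1, one_smul]

/-! ### The cone of states -/

lemma state_of_inCone {A : C} {v : (A ⟶ 𝟙_ C) → ℝ} (hv : O.InCone v) (h1 : v (H.disc A) ≤ 1) :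
    ∃ ρ, O.stVec ρ = v := by
  obtain ⟨r, ρ, hr, rfl⟩ := hv
  by_cases hρ : O.stVec ρ (H.disc A) = 0
  · rw [H.stVec_eq_zero hρ, smul_zero]
    exact ⟨ρ, H.stVec_eq_zero hρ⟩
  · obtain ⟨σ, -, hσ2⟩ := H.exists_normalize ρ hρ
    obtain ⟨τ, hτ⟩ := H.exists_scale_state (mul_nonneg hr (stVec_nonneg ρ (H.disc A))) h1 σ
    exact ⟨τ, by rw [hτ, mul_smul, ← hσ2]⟩

lemma exists_det_smul {A : C} {v : (A ⟶ 𝟙_ C) → ℝ} (hv : O.InCone v) :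
    ∃ ρ, O.IsDet ρ ∧ v = v (H.disc A) • O.stVec ρ := by
  obtain ⟨r, ρ, hr, rfl⟩ := hv
  by_cases hρ : O.stVec ρ (H.disc A) = 0
  · obtain ⟨σ, hσ⟩ := H.exists_isDet_state A
    exact ⟨σ, hσ, by simp [H.stVec_eq_zero hρ]⟩
  · obtain ⟨σ, hσ, hσ2⟩ := H.exists_normalize ρ hρ
    refine ⟨σ, hσ, ?_⟩
    rw [Pi.smul_apply, smul_eq_mul, mul_smul, ← hσ2]

lemma inCone_add {A : C} {v w : (A ⟶ 𝟙_ C) → ℝ} (hv : O.InCone v) (hw : O.InCone w) :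
    O.InCone (v + w) := by
  obtain ⟨r, ρ, hr, rfl⟩ := hv
  obtain ⟨t, σ, ht, rfl⟩ := hw
  by_cases h : r + t = 0
  · have h1 : r = 0 := by linarith
    have h2 : t = 0 := by linarith
    exact ⟨0, ρ, le_rfl, by simp [h1, h2]⟩
  · have hpos : 0 < r + t := lt_of_le_of_ne (by linarith) (Ne.symm h)
    obtain ⟨τ, hτ⟩ := H.exists_mix_state (p := r / (r + t)) (by positivity)
      (by rw [div_le_one hpos]; linarith) ρ σ
    refine ⟨r + t, τ, hpos.le, ?_⟩
    have e1 : (r + t) * (r / (r + t)) = r := by field_simp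
    have e2 : (r + t) * (1 - r / (r + t)) = t := by field_simp; ring
    rw [hτ, smul_add, smul_smul, smul_smul, e1, e2]

lemma inCone_sum {A : C} {X : Type*} (s : Finset X) {v : X → (A ⟶ 𝟙_ C) → ℝ}
    (hv : ∀ x ∈ s, O.InCone (v x)) : O.InCone (∑ x ∈ s, v x) := by
  classical
  obtain ⟨ρ, -⟩ := H.exists_isDet_state A
  induction s using Finset.induction_on with
  | empty => simpa using inCone_zero A ρ
  | insert a s ha ih =>
    rw [Finset.sum_insert ha]
    exact H.inCone_add (hv a (by simp)) (ih fun x hx => hv x (by simp [hx]))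

/-- Norms along a convergent sequence are bounded, so a single rescaling turns all its terms into
states, whose limit is again a state. -/
lemma inCone_of_tendsto {A : C} {v : ℕ → (A ⟶ 𝟙_ C) → ℝ} {w : (A ⟶ 𝟙_ C) → ℝ}
    (hv : ∀ n, O.InCone (v n)) (h : ∀ m, Tendsto (fun n => v n m) atTop (𝓝 (w m))) :
    O.InCone w := by
  have hb := (h (H.disc A)).bddAbove_range
  obtain ⟨M, hM⟩ := hb
  have hM' : ∀ n, v n (H.disc A) ≤ M := fun n => hM ⟨n, rfl⟩
  have hpos : 0 < |M| + 1 := by positivity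
  have hst : ∀ n, ∃ ρ, O.stVec ρ = (|M| + 1)⁻¹ • v n := fun n => by
    refine H.state_of_inCone ((hv n).smul (by positivity)) ?_
    rw [Pi.smul_apply, smul_eq_mul, inv_mul_le_one₀ hpos]
    linarith [hM' n, le_abs_self M]
  choose ρ hρ using hst
  obtain ⟨σ, hσ⟩ := H.exists_state_of_tendsto ρ (v := (|M| + 1)⁻¹ • w) fun m => by
    simp only [hρ, Pi.smul_apply]
    exact (h m).const_smul _
  exact ⟨|M| + 1, σ, hpos.le, by rw [hσ, smul_inv_smul₀ hpos.ne']⟩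

/-! ### Preparation-tests -/

/-- By induction: decide first between outcome 0 and the rest, then draw from the conditional
distribution on the rest. -/
lemma isTest_scalars {n : ℕ} (s : Fin n → (𝟙_ C ⟶ 𝟙_ C)) (h : ∑ i, O.prob (s i) = 1) :
    O.IsTest s := by
  obtain _ | n := n
  · simp at h
  induction n with
  | zero =>
    simp at h
    have : s = (fun _ : Unit => 𝟙 _) ∘ (Equiv.ofUnique (Fin 1) Unit) := by
      funext i
      refine H.scalar_ext ?_
      rw [Fin.fin_one_eq_zero i, h]
      exact prob_id.symm
    rw [this]
    exact H.isTest_reindex (isTest_id _) _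
  | succ n ih =>
    obtain ⟨c, hc⟩ := H.exists_compl (s 0)
    have hcp := prob_compl hc
    rw [Fin.sum_univ_succ] at h
    have htail : ∑ i : Fin (n + 1), O.prob (s i.succ) = O.prob c := by linarith
    obtain ⟨t, ht, hts⟩ : ∃ t : Fin (n + 1) → (𝟙_ C ⟶ 𝟙_ C), O.IsTest t ∧
        ∀ i, O.prob (s i.succ) = O.prob c * O.prob (t i) := by
      -- When the rest has probability zero its conditional distribution is arbitrary, and a point
      -- mass serves.
      by_cases h0 : O.prob c = 0
      · choose t ht using fun i : Fin (n + 1) => H.exists_scalar (p := if i = 0 then 1 else 0)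
          (by split_ifs <;> norm_num) (by split_ifs <;> norm_num)
        refine ⟨t, ih t (by simp [ht]), fun i => ?_⟩
        rw [h0] at htail ⊢
        rw [Finset.sum_eq_zero_iff_of_nonneg (fun i _ => O.prob_nonneg _)] at htail
        simpa using htail i (Finset.mem_univ i)
      · have hpos : 0 < O.prob c := lt_of_le_of_ne (O.prob_nonneg c) (Ne.symm h0)
        choose t ht using fun i : Fin (n + 1) => H.exists_scalar
          (p := O.prob (s i.succ) / O.prob c) (div_nonneg (O.prob_nonneg _) hpos.le) (by
            rw [div_le_one hpos, ← htail]
            exact Finset.single_le_sum (f := fun i => O.prob (s (Fin.succ i)))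
              (fun i _ => O.prob_nonneg _) (Finset.mem_univ i))
        refine ⟨t, ih t ?_, fun i => ?_⟩
        · simp only [ht]
          rw [← Finset.sum_div, htail, div_self h0]
        · rw [ht]
          field_simp
    have h2 : O.IsTest (fun w : Σ _ : Fin 2, Fin (n + 1) => (![s 0, c] w.1) ≫ t w.2) :=
      H.caus.2 _ _ _ (Fin 2) (fun _ => Fin (n + 1)) _ (fun _ => t) hc fun i => ht
    refine H.isTest_of_coarse h2 (fun w => if w.1 = 0 then 0 else w.2.succ) _ fun x => ?_
    have key : O.prob (s x) = ∑ w : Σ _ : Fin 2, Fin (n + 1),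
        if (if w.1 = 0 then 0 else w.2.succ) = x then O.prob ((![s 0, c] w.1) ≫ t w.2) else 0 := by
      rw [Fintype.sum_sigma]
      simp only [Fin.sum_univ_two, Matrix.cons_val_zero, Matrix.cons_val_one, if_true, prob_comp,
        one_ne_zero, if_false]
      refine Fin.cases ?_ (fun i => ?_) x
      · simp only [if_true, Fin.succ_ne_zero, if_false, Finset.sum_const_zero, add_zero]
        rw [← Finset.mul_sum, O.sum_prob t ht, mul_one]
      · simp [(Fin.succ_ne_zero i).symm, hts i]
    rw [transfVec_scalar, key, Finset.sum_smul]
    refine Finset.sum_congr rfl fun w _ => ?_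
    by_cases hw : (if w.1 = 0 then 0 else w.2.succ) = x
    · rw [if_pos hw, if_pos hw, ← transfVec_scalar]
    · rw [if_neg hw, if_neg hw, zero_smul]

/-- Draw the index from the scalar test of the norms, then prepare the corresponding normalized
state. -/
lemma isTest_states {X : Type} [Fintype X] {A : C} (g : X → (𝟙_ C ⟶ A))
    (h : ∑ x, O.stVec (g x) (H.disc A) = 1) : O.IsTest g := by
  choose ρ hρ hρ2 using fun x => H.exists_det_smul (inCone_stVec (O := O) (g x))
  choose s hs using fun x => H.exists_scalar (stVec_nonneg (O := O) (g x) (H.disc A))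
    (stVec_le_one _ _)
  have hsT : O.IsTest s := by
    have := H.isTest_scalars (s ∘ (Fintype.equivFin X).symm) (by
      rw [← h, ← (Fintype.equivFin X).symm.sum_comp]
      simp [hs])
    convert H.isTest_reindex this (Fintype.equivFin X) using 1
    funext x
    simp
  have h2 : O.IsTest (fun w : Σ _ : X, Unit => s w.1 ≫ ρ w.1) :=
    H.caus.2 _ _ _ X (fun _ => Unit) s (fun x _ => ρ x) hsT fun x => hρ x
  have h3 := H.isTest_reindex h2 (Equiv.sigmaPUnit X).symm
  convert h3 using 1
  funext x
  refine H.state_ext ?_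
  rw [hρ2 x, ← hs]
  exact (stVec_scalar_comp _ _).symm

end Principles

/-! ### Bipartite states and effects -/

/-- The product of two states. -/
def prodState {A B : C} (ρ : 𝟙_ C ⟶ A) (σ : 𝟙_ C ⟶ B) : 𝟙_ C ⟶ A ⊗ B :=
  (λ_ (𝟙_ C)).inv ≫ (ρ ⊗ₘ σ)

/-- The product of two effects. -/
def prodEff {A B : C} (a : A ⟶ 𝟙_ C) (b : B ⟶ 𝟙_ C) : A ⊗ B ⟶ 𝟙_ C :=
  (a ⊗ₘ b) ≫ (λ_ (𝟙_ C)).hom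

/-- The state of `A` that is conditional on the effect `b` on `B`. -/
def cond {A B : C} (Ψ : 𝟙_ C ⟶ A ⊗ B) (b : B ⟶ 𝟙_ C) : 𝟙_ C ⟶ A :=
  Ψ ≫ (A ◁ b) ≫ (ρ_ A).hom

/-- A bipartite state, with the two systems exchanged. -/
def swap {A B : C} (Ψ : 𝟙_ C ⟶ A ⊗ B) : 𝟙_ C ⟶ B ⊗ A := Ψ ≫ (β_ A B).hom

section
omit [SymmetricCategory C]

lemma prodState_eq {A B : C} (ρ : 𝟙_ C ⟶ A) (σ : 𝟙_ C ⟶ B) :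
    prodState ρ σ = ρ ≫ (ρ_ A).inv ≫ A ◁ σ := by
  rw [prodState, MonoidalCategory.tensorHom_def, unitors_inv_equal, rightUnitor_inv_naturality_assoc]

lemma prodState_eq' {A B : C} (ρ : 𝟙_ C ⟶ A) (σ : 𝟙_ C ⟶ B) :
    prodState ρ σ = σ ≫ (λ_ B).inv ≫ ρ ▷ B := by
  rw [prodState, tensorHom_def', leftUnitor_inv_naturality_assoc]

lemma prodEff_eq {A B : C} (a : A ⟶ 𝟙_ C) (b : B ⟶ 𝟙_ C) :
    prodEff a b = A ◁ b ≫ (ρ_ A).hom ≫ a := by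
  rw [prodEff, tensorHom_def', Category.assoc, unitors_equal, rightUnitor_naturality]

lemma prodEff_eq' {A B : C} (a : A ⟶ 𝟙_ C) (b : B ⟶ 𝟙_ C) :
    prodEff a b = a ▷ B ≫ (λ_ B).hom ≫ b := by
  rw [prodEff, MonoidalCategory.tensorHom_def, Category.assoc, leftUnitor_naturality]

lemma cond_comp {A B : C} (Ψ : 𝟙_ C ⟶ A ⊗ B) (b : B ⟶ 𝟙_ C) (a : A ⟶ 𝟙_ C) :
    cond Ψ b ≫ a = Ψ ≫ prodEff a b := by
  simp [cond, prodEff_eq]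

lemma cond_whiskerLeft {A B B' : C} (Ψ : 𝟙_ C ⟶ A ⊗ B) (f : B ⟶ B') (b : B' ⟶ 𝟙_ C) :
    cond (Ψ ≫ A ◁ f) b = cond Ψ (f ≫ b) := by
  simp [cond]

lemma cond_whiskerRight {A A' B : C} (Ψ : 𝟙_ C ⟶ A ⊗ B) (f : A ⟶ A') (b : B ⟶ 𝟙_ C) :
    cond (Ψ ≫ f ▷ B) b = cond Ψ b ≫ f := by
  simp only [cond, Category.assoc]
  rw [← whisker_exchange_assoc, rightUnitor_naturality]

lemma prodState_whiskerRight {A A' B : C} (ρ : 𝟙_ C ⟶ A) (σ : 𝟙_ C ⟶ B) (f : A ⟶ A') :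
    prodState ρ σ ≫ f ▷ B = prodState (ρ ≫ f) σ := by
  simp [prodState_eq']

lemma prodState_whiskerLeft {A B B' : C} (ρ : 𝟙_ C ⟶ A) (σ : 𝟙_ C ⟶ B) (f : B ⟶ B') :
    prodState ρ σ ≫ A ◁ f = prodState ρ (σ ≫ f) := by
  simp [prodState_eq]

lemma whiskerLeft_prodEff {A B B' : C} (f : B ⟶ B') (a : A ⟶ 𝟙_ C) (b : B' ⟶ 𝟙_ C) :
    A ◁ f ≫ prodEff a b = prodEff a (f ≫ b) := by
  simp [prodEff_eq]

end

lemma braiding_prodEff {A B : C} (a : A ⟶ 𝟙_ C) (b : B ⟶ 𝟙_ C) :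
    (β_ A B).hom ≫ prodEff b a = prodEff a b := by
  rw [prodEff_eq, prodEff_eq', ← BraidedCategory.braiding_naturality_left_assoc]
  simp

lemma cond_swap_comp {A B : C} (Ψ : 𝟙_ C ⟶ A ⊗ B) (b : B ⟶ 𝟙_ C) (a : A ⟶ 𝟙_ C) :
    cond (swap Ψ) a ≫ b = cond Ψ b ≫ a := by
  simp [cond_comp, swap, braiding_prodEff]

lemma swap_swap {A B : C} (Ψ : 𝟙_ C ⟶ A ⊗ B) : swap (swap Ψ) = Ψ := by
  simp [swap]

lemma swap_whiskerLeft {A B B' : C} (Ψ : 𝟙_ C ⟶ A ⊗ B) (f : B ⟶ B') :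
    swap (Ψ ≫ A ◁ f) = swap Ψ ≫ f ▷ A := by
  simp [swap]

lemma cond_swap_whiskerLeft {A B B' : C} (Ψ : 𝟙_ C ⟶ A ⊗ B) (f : B ⟶ B') (a : A ⟶ 𝟙_ C) :
    cond (swap (Ψ ≫ A ◁ f)) a = cond (swap Ψ) a ≫ f := by
  rw [swap_whiskerLeft, cond_whiskerRight]

lemma stVec_cond_swap {A B : C} (Ψ : 𝟙_ C ⟶ A ⊗ B) (a : A ⟶ 𝟙_ C) (b : B ⟶ 𝟙_ C) :
    O.stVec (cond (swap Ψ) a) b = O.stVec (cond Ψ b) a := by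
  simp only [stVec, cond_swap_comp]

lemma stVec_cond {A B : C} (Ψ : 𝟙_ C ⟶ A ⊗ B) (a : A ⟶ 𝟙_ C) (b : B ⟶ 𝟙_ C) :
    O.stVec (cond Ψ b) a = O.stVec Ψ (prodEff a b) := by
  simp only [stVec, cond_comp]

lemma stVec_prodState {A B : C} (ρ : 𝟙_ C ⟶ A) (σ : 𝟙_ C ⟶ B) (a : A ⟶ 𝟙_ C) (b : B ⟶ 𝟙_ C) :
    O.stVec (prodState ρ σ) (prodEff a b) = O.stVec ρ a * O.stVec σ b := by
  rw [stVec, prodEff_eq, ← Category.assoc, prodState_whiskerLeft, prodState_eq]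
  have : (ρ_ A).inv ≫ A ◁ (σ ≫ b) ≫ (ρ_ A).hom ≫ a = a ≫ σ ≫ b := by
    rw [← rightUnitor_naturality, whisker_exchange_assoc, ← rightUnitor_inv_naturality_assoc,
      ← unitors_equal, leftUnitor_naturality, ← unitors_inv_equal]
    simp
  simp only [Category.assoc, this]
  rw [← Category.assoc, prob_comp]
  rfl

/-- Bilinear extension of `prodState` in the first argument. -/
def prodMap {A B : C} (τ : 𝟙_ C ⟶ B) :
    ((A ⟶ 𝟙_ C) → ℝ) →ₗ[ℝ] ((A ⊗ B ⟶ 𝟙_ C) → ℝ) :=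
  LinearMap.funLeft ℝ ℝ fun m => (ρ_ A).inv ≫ A ◁ τ ≫ m

lemma prodMap_stVec {A B : C} (ρ : 𝟙_ C ⟶ A) (τ : 𝟙_ C ⟶ B) :
    prodMap τ (O.stVec ρ) = O.stVec (prodState ρ τ) := by
  ext m
  simp [prodMap, LinearMap.funLeft, stVec, prodState_eq]

lemma prodMap_mem {A B : C} (τ : 𝟙_ C ⟶ B) {v : (A ⟶ 𝟙_ C) → ℝ} (hv : v ∈ O.StR A) :
    prodMap τ v ∈ Submodule.span ℝ
      (Set.range fun x : (𝟙_ C ⟶ A) × (𝟙_ C ⟶ B) => O.stVec (prodState x.1 x.2)) := by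
  have := Submodule.mem_map_of_mem (f := prodMap τ) hv
  rw [StR, Submodule.map_span] at this
  refine Submodule.span_mono ?_ this
  rintro _ ⟨_, ⟨ρ, rfl⟩, rfl⟩
  exact ⟨(ρ, τ), (prodMap_stVec ρ τ).symm⟩

lemma prodMap_prodEff {A B : C} (τ : 𝟙_ C ⟶ B) {v : (A ⟶ 𝟙_ C) → ℝ} (hv : v ∈ O.StR A)
    (a : A ⟶ 𝟙_ C) (b : B ⟶ 𝟙_ C) :
    prodMap τ v (prodEff a b) = v a * O.stVec τ b := by
  induction hv using Submodule.span_induction with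
  | mem x hx =>
    obtain ⟨ρ, rfl⟩ := hx
    simp only [prodMap_stVec, stVec_prodState]
  | zero => simp
  | add x y _ _ hx hy => simp [hx, hy, add_mul]
  | smul r x _ hx => simp [hx, mul_assoc]

lemma mat_apply {A B : C} (f : A ⟶ B) (ρ : 𝟙_ C ⟶ A) (m : B ⟶ 𝟙_ C) :
    O.mat f (ρ, m) = O.stVec (ρ ≫ f) m := by simp [mat, stVec]

lemma mat_of_transfVec {A B : C} {X : Type} [Fintype X] (c : X → ℝ) (f : X → (A ⟶ B))
    (h : ∑ x, c x • O.transfVec (f x) = 0) : ∑ x, c x • O.mat (f x) = 0 := by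
  ext ⟨ρ, m⟩
  have := congrFun h (simpleContext ρ m)
  simpa [transfVec_simpleContext, mat] using this

namespace Principles

variable (H : O.Principles)
include H

/-! ### Consequences of local tomography -/

lemma prodEff_disc (A B : C) : prodEff (H.disc A) (H.disc B) = H.disc (A ⊗ B) := by
  refine H.eq_disc ?_
  refine H.isDet_comp ?_ (isDet_iso (λ_ _))
  exact H.isTest_reindex (O.isTest_tensor _ _ (H.isDet_disc A) (H.isDet_disc B))
    (Equiv.punitProd Unit).symm

lemma norm_cond {A B : C} (Ψ : 𝟙_ C ⟶ A ⊗ B) :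
    O.stVec (cond Ψ (H.disc B)) (H.disc A) = O.stVec Ψ (H.disc (A ⊗ B)) := by
  rw [stVec_cond, H.prodEff_disc]

lemma exists_sub {A : C} {v : (A ⟶ 𝟙_ C) → ℝ} (hv : v ∈ O.StR A) :
    ∃ u w, O.InCone u ∧ O.InCone w ∧ v = u - w := by
  obtain ⟨τ, -⟩ := H.exists_isDet_state A
  induction hv using Submodule.span_induction with
  | mem x hx =>
    obtain ⟨ρ, rfl⟩ := hx
    exact ⟨_, 0, inCone_stVec ρ, inCone_zero A ρ, by simp⟩
  | zero => exact ⟨0, 0, inCone_zero A τ, inCone_zero A τ, by simp⟩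
  | add x y _ _ hx hy =>
    obtain ⟨u, w, hu, hw, rfl⟩ := hx
    obtain ⟨u', w', hu', hw', rfl⟩ := hy
    exact ⟨u + u', w + w', H.inCone_add hu hu', H.inCone_add hw hw', by abel⟩
  | smul r x _ hx =>
    obtain ⟨u, w, hu, hw, rfl⟩ := hx
    rcases le_total 0 r with hr | hr
    · exact ⟨r • u, r • w, hu.smul hr, hw.smul hr, smul_sub _ _ _⟩
    · refine ⟨(-r) • w, (-r) • u, hw.smul (by linarith), hu.smul (by linarith), ?_⟩
      simp only [neg_smul, smul_sub]
      abel

/-- Product effects separate the vectors of a composite system. -/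
lemma eq_zero_of_prodEff {A B : C} {v : (A ⊗ B ⟶ 𝟙_ C) → ℝ} (hv : v ∈ O.StR (A ⊗ B))
    (h : ∀ a b, v (prodEff a b) = 0) : v = 0 := by
  obtain ⟨u, w, hu, hw, rfl⟩ := H.exists_sub hv
  obtain ⟨ρ, hρ, hu'⟩ := H.exists_det_smul hu
  obtain ⟨σ, hσ, hw'⟩ := H.exists_det_smul hw
  -- The product of the deterministic effects is deterministic, so both cone vectors have the same
  -- norm. Dividing by it leaves two states, to which local tomography applies.
  have h0 := h (H.disc A) (H.disc B)
  rw [H.prodEff_disc, Pi.sub_apply] at h0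
  have hr : u (H.disc (A ⊗ B)) = w (H.disc (A ⊗ B)) := by linarith
  rw [hr] at hu'
  generalize w (H.disc (A ⊗ B)) = r at hu' hw'
  subst hu' hw'
  by_cases hr0 : r = 0
  · simp [hr0]
  have : ρ = σ := by
    refine H.loc A B ρ σ fun a b => ?_
    have := h a b
    simp only [Pi.sub_apply, Pi.smul_apply, smul_eq_mul, ← mul_sub] at this
    rw [mul_eq_zero] at this
    have := this.resolve_left hr0
    rw [sub_eq_zero] at this
    exact this
  rw [this, sub_self]

lemma bipartite_ext {A B : C} {v w : (A ⊗ B ⟶ 𝟙_ C) → ℝ} (hv : v ∈ O.StR (A ⊗ B))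
    (hw : w ∈ O.StR (A ⊗ B)) (h : ∀ a b, v (prodEff a b) = w (prodEff a b)) : v = w :=
  sub_eq_zero.1 <| H.eq_zero_of_prodEff (Submodule.sub_mem _ hv hw) fun a b => by simp [h]

/-- A separating family of effects spans the dual of the state space. -/
lemma exists_eq_sum_of_separating {A : C} {ι : Type*} (E : ι → (A ⟶ 𝟙_ C))
    (hE : ∀ v ∈ O.StR A, (∀ i, v (E i) = 0) → v = 0) (l : Module.Dual ℝ (O.StR A)) :
    ∃ (n : ℕ) (d : Fin n → ℝ) (f : Fin n → ι), ∀ v : O.StR A, l v = ∑ i, d i * v.1 (E (f i)) := by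
  have := H.fin A
  let W : Subspace ℝ (Module.Dual ℝ (O.StR A)) :=
    Submodule.span ℝ (Set.range fun i => O.effVec (E i))
  -- In finite dimension a subspace of the dual with zero coannihilator is the whole dual.
  have hW : W.dualCoannihilator = ⊥ := by
    rw [eq_bot_iff]
    intro v hv
    rw [Submodule.mem_dualCoannihilator] at hv
    have : v.1 = 0 := hE v.1 v.2 fun i => hv _ (Submodule.subset_span ⟨i, rfl⟩)
    simpa using this
  have hl : l ∈ W := by
    rw [← Subspace.dualCoannihilator_dualAnnihilator_eq (W := W), hW]
    simp
  obtain ⟨n, d, g, hg⟩ := Submodule.mem_span_set'.1 hl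
  choose f hf using fun i => (g i).2
  refine ⟨n, d, f, fun v => ?_⟩
  rw [← hg]
  simp [← hf, effVec]

lemma exists_eq_sum_effects {A : C} (l : Module.Dual ℝ (O.StR A)) :
    ∃ (n : ℕ) (d : Fin n → ℝ) (a : Fin n → (A ⟶ 𝟙_ C)),
      ∀ v : O.StR A, l v = ∑ i, d i * v.1 (a i) :=
  H.exists_eq_sum_of_separating id (fun _ _ h => funext h) l

/-- Product states span the state space of a composite system. -/
lemma stVec_mem_span_prodState {A B : C} (Ψ : 𝟙_ C ⟶ A ⊗ B) : O.stVec Ψ ∈ Submodule.span ℝ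
      (Set.range fun x : (𝟙_ C ⟶ A) × (𝟙_ C ⟶ B) => O.stVec (prodState x.1 x.2)) := by
  have := H.fin A
  let b := Module.finBasis ℝ (O.StR A)
  choose n d a ha using fun i => H.exists_eq_sum_effects (b.coord i)
  -- This is the expansion of `Ψ` along the basis of the first factor. Each coordinate functional is
  -- a combination of effects, whose conditional states give the second factor.
  let w := ∑ i, ∑ k, d i k • prodMap (cond (swap Ψ) (a i k)) (b i).1
  have hw : w ∈ Submodule.span ℝ
      (Set.range fun x : (𝟙_ C ⟶ A) × (𝟙_ C ⟶ B) => O.stVec (prodState x.1 x.2)) :=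
    Submodule.sum_mem _ fun i _ => Submodule.sum_mem _ fun k _ =>
      Submodule.smul_mem _ _ (prodMap_mem _ (b i).2)
  have hle : Submodule.span ℝ
      (Set.range fun x : (𝟙_ C ⟶ A) × (𝟙_ C ⟶ B) => O.stVec (prodState x.1 x.2)) ≤
      O.StR (A ⊗ B) := by
    refine Submodule.span_mono ?_
    rintro _ ⟨x, rfl⟩
    exact ⟨_, rfl⟩
  convert hw using 1
  refine H.bipartite_ext (stVec_mem Ψ) (hle hw) fun x y => ?_
  let v : O.StR A := ⟨O.stVec (cond Ψ y), stVec_mem _⟩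
  have hv := congrArg (fun u : O.StR A => u.1 x) (b.sum_repr v)
  rw [← stVec_cond]
  change v.1 x = _
  rw [← hv]
  simp only [w, Finset.sum_apply, Submodule.coe_sum, Pi.smul_apply, smul_eq_mul, Submodule.coe_smul]
  refine Finset.sum_congr rfl fun i _ => ?_
  have := ha i v
  rw [Module.Basis.coord_apply] at this
  rw [this, Finset.sum_mul]
  refine Finset.sum_congr rfl fun k _ => ?_
  rw [prodMap_prodEff _ (b i).2, stVec_cond_swap]
  ring

/-- Since product states span, the reference system of a context can be replaced by finitely many
contexts without one. The coefficients do not depend on the event. -/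
lemma exists_transfVec_eq_sum {A B : C} (c : Context A B) :
    ∃ (n : ℕ) (d : Fin n → ℝ) (x : Fin n → (𝟙_ C ⟶ A) × (B ⟶ 𝟙_ C)),
      ∀ f : A ⟶ B, O.transfVec f c = ∑ i, d i * O.mat f (x i) := by
  obtain ⟨R, Ψ, m⟩ := c
  obtain ⟨n, d, g, hg⟩ := Submodule.mem_span_set'.1 (H.stVec_mem_span_prodState Ψ)
  choose x hx using fun i => (g i).2
  refine ⟨n, d, fun i => ((x i).1, (ρ_ B).inv ≫ B ◁ (x i).2 ≫ m), fun f => ?_⟩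
  have h1 : O.transfVec f ⟨R, Ψ, m⟩ = O.stVec Ψ (f ▷ R ≫ m) := by simp [transfVec, stVec]
  rw [h1, ← hg, Finset.sum_apply]
  refine Finset.sum_congr rfl fun i _ => ?_
  rw [← hx i]
  simp only [Pi.smul_apply, smul_eq_mul, stVec, mat]
  rw [← Category.assoc, prodState_whiskerRight, prodState_eq]
  simp

/-- Linear relations between events can be checked on the matrix elements. -/
lemma transfVec_of_mat {A B : C} {X : Type} [Fintype X] (c : X → ℝ) (f : X → (A ⟶ B))
    (h : ∑ x, c x • O.mat (f x) = 0) : ∑ x, c x • O.transfVec (f x) = 0 := by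
  ext k
  obtain ⟨n, d, y, hy⟩ := H.exists_transfVec_eq_sum k
  simp only [Finset.sum_apply, Pi.smul_apply, hy, smul_eq_mul, Finset.mul_sum, Pi.zero_apply]
  rw [Finset.sum_comm]
  refine Finset.sum_eq_zero fun i _ => ?_
  have := congrFun h (y i)
  simp only [Finset.sum_apply, Pi.smul_apply, smul_eq_mul, Pi.zero_apply] at this
  calc _ = d i * ∑ x, c x * O.mat (f x) (y i) := by
        rw [Finset.mul_sum]; exact Finset.sum_congr rfl fun _ _ => by ring
    _ = 0 := by rw [this, mul_zero]

/-- Product states span the inputs and product effects separate the outputs, so linear relations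
between bipartite events need only be tested on products. -/
lemma mat_of_prod {A B A' B' : C} {X : Type} [Fintype X] (c : X → ℝ)
    (f : X → (A ⊗ B ⟶ A' ⊗ B'))
    (h : ∀ ρ σ a b, ∑ x, c x * O.stVec (prodState ρ σ ≫ f x) (prodEff a b) = 0) :
    ∑ x, c x • O.mat (f x) = 0 := by
  have h1 : ∀ ρ σ, ∑ x, c x • O.stVec (prodState ρ σ ≫ f x) = 0 := fun ρ σ =>
    H.eq_zero_of_prodEff (Submodule.sum_mem _ fun x _ => Submodule.smul_mem _ _ (stVec_mem _))
      fun a b => by simpa using h ρ σ a b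
  ext ⟨Ψ, m⟩
  simp only [Finset.sum_apply, Pi.smul_apply, mat_apply, stVec_comp, smul_eq_mul, Pi.zero_apply]
  obtain ⟨n, d, g, hg⟩ := Submodule.mem_span_set'.1 (H.stVec_mem_span_prodState Ψ)
  choose x hx using fun i => (g i).2
  simp only [← hg, Finset.sum_apply, Pi.smul_apply, smul_eq_mul, Finset.mul_sum]
  rw [Finset.sum_comm]
  refine Finset.sum_eq_zero fun i _ => ?_
  have := congrFun (h1 (x i).1 (x i).2) m
  simp only [Finset.sum_apply, Pi.smul_apply, smul_eq_mul, Pi.zero_apply, stVec_comp] at this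
  simp only [← hx i]
  calc _ = d i * ∑ y, c y * O.stVec (prodState (x i).1 (x i).2) (f y ≫ m) := by
        rw [Finset.mul_sum]; exact Finset.sum_congr rfl fun _ _ => by ring
    _ = 0 := by rw [this, mul_zero]

lemma transfVec_eq_add {A B : C} {f g h : A ⟶ B} (e : O.mat g + O.mat h = O.mat f) :
    O.transfVec g + O.transfVec h = O.transfVec f := by
  have := H.transfVec_of_mat ![1, 1, -1] ![g, h, f] (by
    simp [Fin.sum_univ_three, e])
  simp [Fin.sum_univ_three] at this
  linear_combination this

lemma transfVec_eq_smul {A B : C} {f g : A ⟶ B} {p : ℝ} (e : O.mat g = p • O.mat f) :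
    O.transfVec g = p • O.transfVec f := by
  have := H.transfVec_of_mat ![1, -p] ![g, f] (by simp [e])
  simp at this
  linear_combination this

lemma mat_ext {A B : C} {f g : A ⟶ B} (e : O.mat g = O.mat f) : g = f :=
  H.event_ext (by simpa using H.transfVec_eq_smul (p := 1) (by simpa using e))

/-! ### Purity -/

omit H in
lemma mat_eq_add {A B : C} {f g h : A ⟶ B}
    (e : O.transfVec g + O.transfVec h = O.transfVec f) : O.mat g + O.mat h = O.mat f := by
  have := mat_of_transfVec (O := O) ![1, 1, -1] ![g, h, f] (by simp [Fin.sum_univ_three, e])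
  simp [Fin.sum_univ_three] at this
  linear_combination this

/-- Purity reduces to splittings into two coexisting events, because the remaining refining outcomes
can be merged into one. -/
lemma isPure_intro {A B : C} {f : A ⟶ B}
    (hf : ∀ g h, O.Coexist g h → O.mat g + O.mat h = O.mat f → ∃ p : ℝ, O.mat g = p • O.mat f) :
    O.IsPure f := by
  classical
  intro X Z _ _ T T' q x₀ hT hT' hq hx
  have hsum : O.transfVec f = ∑ z with q z = x₀, O.transfVec (T' z) := by
    rw [← hx, hq x₀]
  have key : ∀ z, q z = x₀ → ∃ p : ℝ, O.transfVec (T' z) = p • O.transfVec f := by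
    intro z hz
    -- Three outcomes: the event at `z`, the other events refining `f`, and everything outside the
    -- fibre of `x₀`.
    obtain ⟨S, hS, hS'⟩ := H.exists_coarse hT'
      (fun z' => if z' = z then (0 : Fin 3) else if q z' = x₀ then 1 else 2)
    have h0 : S 0 = T' z := by
      apply H.event_ext
      rw [hS', Finset.sum_eq_single z]
      · simp
      · intro z' _ hz'
        rw [if_neg hz', if_neg]
        split_ifs <;> simp
      · simp
    have h1 : O.transfVec (S 0) + O.transfVec (S 1) = O.transfVec f := by
      rw [hS', hS', ← Finset.sum_add_distrib, hsum, Finset.sum_filter]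
      refine Finset.sum_congr rfl fun z' _ => ?_
      by_cases h1 : z' = z
      · simp [h1, hz]
      · by_cases h2 : q z' = x₀ <;> simp [h1, h2]
    obtain ⟨p, hp⟩ := hf (S 0) (S 1) ⟨_, _, S, 0, 1, hS, by simp, rfl, rfl⟩ (mat_eq_add h1)
    exact ⟨p, h0 ▸ H.transfVec_eq_smul hp⟩
  -- For a zero event the proportionality constants are not determined, so a point mass is chosen;
  -- otherwise evaluation at a context where `f` is nonzero makes them a probability distribution.
  by_cases hf0 : O.transfVec f = 0
  · have hz0 : ∀ z, q z = x₀ → O.transfVec (T' z) = 0 := fun z hz => by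
      obtain ⟨p, hp⟩ := key z hz
      rw [hp, hf0, smul_zero]
    by_cases hex : ∃ z, q z = x₀
    · obtain ⟨z₀, hz₀⟩ := hex
      refine ⟨fun z => if z = z₀ then 1 else 0, fun z => by positivity, fun _ => ?_,
        fun z hz => by rw [hz0 z hz, hf0, smul_zero]⟩
      rw [Finset.sum_ite_eq']
      simp [hz₀]
    · exact ⟨0, by simp, fun h => (hex h).elim, fun z hz => (hex ⟨z, hz⟩).elim⟩
  · obtain ⟨c, hc⟩ := Function.ne_iff.1 hf0
    have hc0 : 0 < O.transfVec f c := lt_of_le_of_ne (O.prob_nonneg _) (Ne.symm hc)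
    refine ⟨fun z => O.transfVec (T' z) c / O.transfVec f c,
      fun z => div_nonneg (O.prob_nonneg _) hc0.le, fun _ => ?_, fun z hz => ?_⟩
    · rw [← Finset.sum_div, div_eq_one_iff_eq hc0.ne', hsum, Finset.sum_apply]
    · obtain ⟨p, hp⟩ := key z hz
      simp only [hp, Pi.smul_apply, smul_eq_mul, mul_div_cancel_right₀ _ hc0.ne']

lemma isPure_elim {A B : C} {f : A ⟶ B} (hf : O.IsPure f) {g h : A ⟶ B} (hgh : O.Coexist g h)
    (e : O.mat g + O.mat h = O.mat f) : ∃ p : ℝ, 0 ≤ p ∧ O.mat g = p • O.mat f := by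
  classical
  obtain ⟨X, _, T, x, y, hT, hxy, rfl, rfl⟩ := hgh
  have := Fintype.ofFinite X
  obtain ⟨S, hS, hS'⟩ := H.exists_coarse hT (fun z => if z = x then (1 : Fin 2) else
    if z = y then 1 else 0)
  have h1 : S 1 = f := by
    apply H.event_ext
    rw [hS', ← H.transfVec_eq_add e]
    rw [← Finset.sum_subset (Finset.subset_univ {x, y}), Finset.sum_pair hxy]
    · simp
    · intro z _ hz
      simp only [Finset.mem_insert, Finset.mem_singleton, not_or] at hz
      simp [hz.1, hz.2]
  obtain ⟨p, hp, -, hp2⟩ := hf (Fin 2) X S T _ 1 hS hT (fun i => by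
    rw [hS' i, Finset.sum_filter]) h1
  refine ⟨p x, hp x, ?_⟩
  have := hp2 x (by simp)
  have := mat_of_transfVec (O := O) ![1, -p x] ![T x, f] (by simp [this])
  simp at this
  linear_combination this

omit H in
lemma coexist_binary {A B : C} {f g : A ⟶ B} (h : O.IsTest ![f, g]) : O.Coexist f g :=
  ⟨Fin 2, inferInstance, ![f, g], 0, 1, h, by simp, rfl, rfl⟩

omit H in
lemma coexist_comp {A B D : C} {f g : A ⟶ B} (h : O.Coexist f g) (k : B ⟶ D) :
    O.Coexist (f ≫ k) (g ≫ k) := by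
  obtain ⟨X, _, T, x, y, hT, hxy, rfl, rfl⟩ := h
  obtain ⟨Z, _, S, hS, z, rfl⟩ := O.exists_test_of_event k
  exact ⟨X × Z, inferInstance, _, (x, z), (y, z), O.isTest_comp T S hT hS, by simp [hxy], rfl, rfl⟩

omit H in
lemma comp_coexist {A B D : C} {f g : A ⟶ B} (h : O.Coexist f g) (k : D ⟶ A) :
    O.Coexist (k ≫ f) (k ≫ g) := by
  obtain ⟨X, _, T, x, y, hT, hxy, rfl, rfl⟩ := h
  obtain ⟨Z, _, S, hS, z, rfl⟩ := O.exists_test_of_event k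
  exact ⟨Z × X, inferInstance, _, (z, x), (z, y), O.isTest_comp S T hS hT, by simp [hxy], rfl, rfl⟩

lemma isPure_comp_iso {A B D : C} {f : A ⟶ B} (hf : O.IsPure f) (U : B ≅ D) :
    O.IsPure (f ≫ U.hom) := by
  refine H.isPure_intro fun g h hgh e => ?_
  obtain ⟨p, -, hp⟩ := H.isPure_elim hf (coexist_comp hgh U.inv) (by
    ext ⟨ρ, m⟩
    simpa [mat] using congrFun e (ρ, U.inv ≫ m))
  refine ⟨p, ?_⟩
  ext ⟨ρ, m⟩
  simpa [mat] using congrFun hp (ρ, U.hom ≫ m)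

lemma isPure_state_intro {A : C} {ρ : 𝟙_ C ⟶ A} (h : ∀ v w, O.InCone v → O.InCone w →
    v + w = O.stVec ρ → ∃ p : ℝ, v = p • O.stVec ρ) : O.IsPure ρ := by
  refine H.isPure_intro fun f g _ e => ?_
  obtain ⟨p, hp⟩ := h _ _ (inCone_stVec f) (inCone_stVec g) (by
    ext m
    simpa [mat, stVec] using congrFun e (𝟙 _, m))
  refine ⟨p, ?_⟩
  ext ⟨s, m⟩
  simp only [mat_apply, stVec_scalar_comp, hp, Pi.smul_apply, smul_eq_mul]
  ring

/-- For states coexistence is automatic: two cone vectors that sum to a state are states and,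
completed by a third one, form a preparation-test. -/
lemma isPure_state_elim {A : C} {ρ : 𝟙_ C ⟶ A} (hρ : O.IsPure ρ) {t : ℝ} (ht : 0 ≤ t)
    {v w : (A ⟶ 𝟙_ C) → ℝ} (hv : O.InCone v) (hw : O.InCone w) (e : v + w = t • O.stVec ρ) :
    ∃ p : ℝ, v = (p * t) • O.stVec ρ := by
  rcases ht.eq_or_lt with rfl | ht
  · refine ⟨0, ?_⟩
    ext m
    have h1 := hv.nonneg m
    have h2 := hw.nonneg m
    have h3 := congrFun e m
    simp at h3 ⊢
    linarith
  · have e' : t⁻¹ • v + t⁻¹ • w = O.stVec ρ := by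
      rw [← smul_add, e, inv_smul_smul₀ ht.ne']
    have e'' := congrFun e' (H.disc A)
    have hv' : O.InCone (t⁻¹ • v) := hv.smul (by positivity)
    have hw' : O.InCone (t⁻¹ • w) := hw.smul (by positivity)
    have h1 := stVec_le_one (O := O) ρ (H.disc A)
    rw [Pi.add_apply] at e''
    obtain ⟨f, hf⟩ := H.state_of_inCone hv' (by linarith [hw'.nonneg (H.disc A)])
    obtain ⟨g, hg⟩ := H.state_of_inCone hw' (by linarith [hv'.nonneg (H.disc A)])
    obtain ⟨k, hk⟩ := H.exists_isDet_state A
    obtain ⟨k', hk'⟩ := H.exists_scale_state (p := 1 - O.stVec ρ (H.disc A)) (by linarith)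
      (by linarith [stVec_nonneg (O := O) ρ (H.disc A)]) k
    -- The third state `k'` carries the missing norm `1 - ‖ρ‖`.
    have hco : O.Coexist f g := by
      refine ⟨Fin 3, inferInstance, ![f, g, k'], 0, 1, H.isTest_states _ ?_, by simp, rfl, rfl⟩
      simp only [Fin.sum_univ_three, Matrix.cons_val_zero, Matrix.cons_val_one, Matrix.cons_val,
        hf, hg, hk', Pi.smul_apply, H.norm_of_isDet hk, smul_eq_mul]
      simp only [Pi.smul_apply, smul_eq_mul] at e''
      linarith
    obtain ⟨p, -, hp⟩ := H.isPure_elim hρ hco (by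
      ext ⟨s, m⟩
      have := congrFun e' m
      simp only [Pi.add_apply, mat_apply, stVec_scalar_comp, hf, hg, Pi.smul_apply,
        smul_eq_mul] at this ⊢
      rw [← this]
      ring)
    refine ⟨p, ?_⟩
    have : O.stVec f = p • O.stVec ρ := by
      ext m
      simpa [mat, stVec] using congrFun hp (𝟙 _, m)
    rw [hf] at this
    rw [mul_comm, mul_smul, ← this, smul_inv_smul₀ ht.ne']

lemma isPure_of_smul {A : C} {ρ σ : 𝟙_ C ⟶ A} (hρ : O.IsPure ρ) {t : ℝ} (ht : 0 ≤ t)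
    (e : O.stVec σ = t • O.stVec ρ) : O.IsPure σ := by
  refine H.isPure_state_intro fun v w hv hw h => ?_
  obtain ⟨p, hp⟩ := H.isPure_state_elim hρ ht hv hw (h.trans e)
  exact ⟨p, by rw [hp, e, mul_smul]⟩

end Principles
end OPT

/-! ### Invariant points of bounded groups -/

/-- A group of linear maps with a uniform bound fixes a point of every nonempty compact convex
set that it preserves. -/
lemma exists_fixed_point_of_bounded {E ι : Type*} [NormedAddCommGroup E] [InnerProductSpace ℝ E]
    [Nonempty ι] (L : ι → E →ₗ[ℝ] E) {K : Set E} (hK : IsCompact K) (hKc : Convex ℝ K)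
    (hKn : K.Nonempty) (hLK : ∀ i, ∀ x ∈ K, L i x ∈ K)
    (hcomp : ∀ i j, ∃ k, ∀ x, L k x = L i (L j x)) (hinv : ∀ i, ∃ j, ∀ x, L j (L i x) = x)
    (M : ℝ) (hM : ∀ i x, ‖L i x‖ ≤ M * ‖x‖) : ∃ x ∈ K, ∀ i, L i x = x := by
  have hM' : ∀ i x, ‖L i x‖ ≤ (|M| + 1) * ‖x‖ := fun i x =>
    (hM i x).trans (by gcongr; linarith [le_abs_self M])
  have hMpos : 0 < |M| + 1 := by positivity
  set N := |M| + 1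
  -- An invariant norm replaces averaging over the group. It inherits enough strict convexity from
  -- the parallelogram law for its minimizer on `K` to be fixed.
  let F : E → ℝ := fun x => ⨆ i, ‖L i x‖
  have hbdd : ∀ x, BddAbove (Set.range fun i => ‖L i x‖) := fun x =>
    ⟨N * ‖x‖, by rintro _ ⟨i, rfl⟩; exact hM' i x⟩
  have hle : ∀ i x, ‖L i x‖ ≤ F x := fun i x => le_ciSup (hbdd x) i
  have hlip : LipschitzWith ⟨N, hMpos.le⟩ F := by
    refine LipschitzWith.of_le_add_mul _ fun x y => ciSup_le fun i => ?_
    have h1 : ‖L i x‖ ≤ ‖L i y‖ + ‖L i (x - y)‖ := by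
      rw [map_sub]
      exact norm_le_norm_add_norm_sub' _ _
    have h2 := hM' i (x - y)
    have h3 := hle i y
    rw [dist_eq_norm]
    change _ ≤ F y + N * ‖x - y‖
    linarith
  obtain ⟨x₀, hx₀, hmin⟩ := hK.exists_isMinOn hKn hlip.continuous.continuousOn
  refine ⟨x₀, hx₀, fun j => ?_⟩
  set y := L j x₀ with hy
  have hyK : y ∈ K := hLK j x₀ hx₀
  have hFy : F y ≤ F x₀ := ciSup_le fun i => by
    obtain ⟨k, hk⟩ := hcomp i j
    rw [hy, ← hk]
    exact hle k x₀
  have hF0 : 0 ≤ F x₀ := (norm_nonneg _).trans (hle (Classical.arbitrary ι) x₀)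
  have hzK : (2⁻¹ : ℝ) • x₀ + (2⁻¹ : ℝ) • y ∈ K := hKc hx₀ hyK (by norm_num) (by norm_num)
    (by norm_num)
  have hFz := hmin hzK
  simp only [Set.mem_ofPred_eq] at hFz
  by_contra hne
  have hpos : 0 < ‖x₀ - y‖ := norm_pos_iff.2 (sub_ne_zero.2 (Ne.symm hne))
  -- Invertibility bounds `‖L i (x₀ - y)‖` below by `‖x₀ - y‖ / N` for every `i`, so the
  -- parallelogram law lowers the squared norm at the midpoint by this amount uniformly. The
  -- supremum therefore drops strictly.
  set δ := (‖x₀ - y‖ / N) ^ 2 / 4 with hδ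
  have hδpos : 0 < δ := by positivity
  have hz : ∀ i, ‖L i ((2⁻¹ : ℝ) • x₀ + (2⁻¹ : ℝ) • y)‖ ^ 2 ≤ F x₀ ^ 2 - δ := fun i => by
    obtain ⟨k, hk⟩ := hinv i
    have h1 : ‖x₀ - y‖ / N ≤ ‖L i (x₀ - y)‖ := by
      rw [div_le_iff₀' hMpos]
      conv_lhs => rw [← hk (x₀ - y)]
      exact hM' k _
    have h2 : ‖L i x₀‖ ^ 2 ≤ F x₀ ^ 2 := pow_le_pow_left₀ (norm_nonneg _) (hle i x₀) 2
    have h3 : ‖L i y‖ ^ 2 ≤ F x₀ ^ 2 :=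
      pow_le_pow_left₀ (norm_nonneg _) ((hle i y).trans hFy) 2
    have h4 : (‖x₀ - y‖ / N) ^ 2 ≤ ‖L i (x₀ - y)‖ ^ 2 := pow_le_pow_left₀ (by positivity) h1 2
    have h5 := parallelogram_law_with_norm ℝ (L i x₀) (L i y)
    rw [← smul_add, map_smul, map_add, norm_smul, mul_pow]
    rw [map_sub] at h4
    norm_num
    rw [hδ]
    nlinarith
  have hm : F ((2⁻¹ : ℝ) • x₀ + (2⁻¹ : ℝ) • y) ≤ √(F x₀ ^ 2 - δ) :=
    ciSup_le fun i => Real.le_sqrt_of_sq_le (hz i)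
  have hlt : √(F x₀ ^ 2 - δ) < F x₀ := by
    have hi := hz (Classical.arbitrary ι)
    have h0 : 0 ≤ F x₀ ^ 2 - δ := (sq_nonneg _).trans hi
    refine (Real.sqrt_lt h0 hF0).2 (by linarith)
  linarith

namespace OPT

variable {C : Type u} [Category.{v} C] [MonoidalCategory C] [SymmetricCategory C] {O : OPT C}

/-! ### The compact convex set of deterministic states -/

/-- The vectors of the deterministic states. -/
def detSet (O : OPT C) (A : C) : Set (O.StR A) := {x | ∃ ρ : 𝟙_ C ⟶ A, O.IsDet ρ ∧ O.stVec ρ = x.1}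

/-- The action of an event on the state spaces. -/
def actOn (O : OPT C) {A B : C} (f : A ⟶ B) : O.StR A →ₗ[ℝ] O.StR B :=
  ((LinearMap.funLeft ℝ ℝ fun m : B ⟶ 𝟙_ C => f ≫ m) ∘ₗ (O.StR A).subtype).codRestrict (O.StR B)
    (by
      rintro ⟨v, hv⟩
      have := Submodule.mem_map_of_mem (f := LinearMap.funLeft ℝ ℝ fun m : B ⟶ 𝟙_ C => f ≫ m) hv
      rw [StR, Submodule.map_span] at this
      refine Submodule.span_mono ?_ this
      rintro _ ⟨_, ⟨ρ, rfl⟩, rfl⟩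
      exact ⟨ρ ≫ f, by ext m; simp [stVec, LinearMap.funLeft]⟩)

lemma actOn_apply {A B : C} (f : A ⟶ B) (v : O.StR A) (m : B ⟶ 𝟙_ C) :
    (O.actOn f v).1 m = v.1 (f ≫ m) := rfl

namespace Principles

variable (H : O.Principles)
include H

lemma isCompact_detSet (A : C) : IsCompact (O.detSet A) := by
  have := H.fin A
  have hsub : O.detSet A ⊆ (Subtype.val : O.StR A → _) ⁻¹'
      (Set.univ.pi fun _ : A ⟶ 𝟙_ C => Set.Icc (0 : ℝ) 1) := by
    rintro x ⟨ρ, -, h⟩ m -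
    rw [← h]
    exact ⟨stVec_nonneg _ _, stVec_le_one _ _⟩
  have hcl : IsClosed (O.detSet A) := by
    have : FirstCountableTopology (O.StR A) :=
      (toEuclidean (E := O.StR A)).toHomeomorph.isInducing.firstCountableTopology
    rw [← isSeqClosed_iff_isClosed]
    intro x y hx hxy
    choose ρ hρ hρx using hx
    have hm : ∀ m, Tendsto (fun n => O.stVec (ρ n) m) atTop (𝓝 (y.1 m)) := fun m => by
      simp only [hρx]
      exact ((continuous_apply m).comp continuous_subtype_val).continuousAt.tendsto.comp hxy
    obtain ⟨σ, hσ⟩ := H.exists_state_of_tendsto ρ hm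
    refine ⟨σ, H.isDet_of_norm ?_, hσ⟩
    rw [hσ]
    refine tendsto_nhds_unique (hm (H.disc A)) ?_
    simp only [fun n => H.norm_of_isDet (hρ n)]
    exact tendsto_const_nhds
  exact ((H.isClosed_StR A).isClosedEmbedding_subtypeVal.isCompact_preimage
    (isCompact_univ_pi fun _ => isCompact_Icc)).of_isClosed_subset hcl hsub

lemma convex_detSet (A : C) : Convex ℝ (O.detSet A) := by
  rintro x ⟨ρ, hρ, hx⟩ y ⟨σ, hσ, hy⟩ a b ha hb hab
  obtain ⟨τ, hτ⟩ := H.exists_mix_state ha (by linarith) ρ σ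
  refine ⟨τ, H.isDet_of_norm ?_, ?_⟩
  · simp [hτ, H.norm_of_isDet hρ, H.norm_of_isDet hσ]
  · rw [hτ, hx, hy, ← hab]
    simp

lemma isPure_of_mem_extremePoints {A : C} {ρ : 𝟙_ C ⟶ A} (hρ : O.IsDet ρ)
    (h : (⟨O.stVec ρ, stVec_mem ρ⟩ : O.StR A) ∈ (O.detSet A).extremePoints ℝ) : O.IsPure ρ := by
  refine H.isPure_state_intro fun v w hv hw e => ?_
  obtain ⟨σ, hσ, hv'⟩ := H.exists_det_smul hv
  obtain ⟨τ, hτ, hw'⟩ := H.exists_det_smul hw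
  have he := congrFun e (H.disc A)
  rw [Pi.add_apply, H.norm_of_isDet hρ] at he
  have h0 := hv.nonneg (H.disc A)
  have h1 := hw.nonneg (H.disc A)
  set r := v (H.disc A)
  set t := w (H.disc A)
  rcases h0.eq_or_lt with h0 | h0
  · exact ⟨0, by rw [hv', ← h0, zero_smul, zero_smul]⟩
  rcases h1.eq_or_lt with h1 | h1
  · rw [← h1, zero_smul] at hw'
    exact ⟨1, by rw [one_smul, ← e, hw', add_zero]⟩
  have := (mem_extremePoints.1 h).2 ⟨O.stVec σ, stVec_mem σ⟩ ⟨σ, hσ, rfl⟩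
    ⟨O.stVec τ, stVec_mem τ⟩ ⟨τ, hτ, rfl⟩ ⟨r, t, h0, h1, he, by
      apply Subtype.ext
      change r • O.stVec σ + t • O.stVec τ = O.stVec ρ
      rw [← e, ← hv', ← hw']⟩
  have h2 := congrArg Subtype.val this.1
  simp only at h2
  exact ⟨r, by rw [hv', h2]⟩

/-- The maximum of an effect over the deterministic states is attained at a pure state. -/
lemma exists_pure_max {A : C} (a : A ⟶ 𝟙_ C) : ∃ α : 𝟙_ C ⟶ A, O.IsDet α ∧ O.IsPure α ∧
    ∀ ρ : 𝟙_ C ⟶ A, O.IsDet ρ → O.stVec ρ a ≤ O.stVec α a := by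
  have := H.fin A
  let l : O.StR A →L[ℝ] ℝ := (ContinuousLinearMap.proj a).comp (O.StR A).subtypeL
  have hK := H.isCompact_detSet A
  obtain ⟨ρ₀, hρ₀⟩ := H.exists_isDet_state A
  have hKn : (O.detSet A).Nonempty := ⟨⟨O.stVec ρ₀, stVec_mem ρ₀⟩, ρ₀, hρ₀, rfl⟩
  have hexp : IsExposed ℝ (O.detSet A) (l.toExposed (O.detSet A)) :=
    ContinuousLinearMap.toExposed.isExposed
  have hne : (l.toExposed (O.detSet A)).Nonempty := by
    obtain ⟨x, hx, hmax⟩ := hK.exists_isMaxOn hKn l.continuous.continuousOn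
    exact ⟨x, hx, fun y hy => hmax hy⟩
  -- The maximizers form an exposed face, and an extreme point of that face is extreme in the whole
  -- set.
  obtain ⟨x, hx⟩ := (hexp.isCompact hK).extremePoints_nonempty hne
  have hx1 : x ∈ l.toExposed (O.detSet A) := hx.1
  obtain ⟨⟨α, hα, hαx⟩, hmax⟩ := hx1
  have hx2 := hexp.isExtreme.extremePoints_subset_extremePoints hx
  have hxe : x = ⟨O.stVec α, stVec_mem α⟩ := Subtype.ext hαx.symm
  rw [hxe] at hx2
  refine ⟨α, hα, H.isPure_of_mem_extremePoints hα hx2, fun ρ hρ => ?_⟩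
  have := hmax ⟨O.stVec ρ, stVec_mem ρ⟩ ⟨ρ, hρ, rfl⟩
  rw [hxe] at this
  exact this

lemma exists_pure_det (A : C) : ∃ α : 𝟙_ C ⟶ A, O.IsDet α ∧ O.IsPure α := by
  obtain ⟨α, h1, h2, -⟩ := H.exists_pure_max (H.disc A)
  exact ⟨α, h1, h2⟩

/-- There is a deterministic state that is invariant under all reversible transformations. -/
lemma exists_invariant (A : C) :
    ∃ χ : 𝟙_ C ⟶ A, O.IsDet χ ∧ ∀ U : A ≅ A, χ ≫ U.hom = χ := by
  have := H.fin A
  -- The fixed-point argument needs an inner product, so the action is transported to a Euclidean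
  -- space.
  let φ := toEuclidean (E := O.StR A)
  let L : (A ≅ A) → EuclideanSpace ℝ (Fin (Module.finrank ℝ (O.StR A))) →ₗ[ℝ] _ := fun U =>
    φ.toLinearMap ∘ₗ O.actOn U.hom ∘ₗ φ.symm.toLinearMap
  have hL : ∀ U x, L U x = φ (O.actOn U.hom (φ.symm x)) := fun U x => rfl
  have hcompact : IsCompact (φ '' O.detSet A) := (H.isCompact_detSet A).image φ.continuous
  have hact : ∀ U : A ≅ A, ∀ x ∈ O.detSet A, O.actOn U.hom x ∈ O.detSet A := by
    rintro U x ⟨ρ, hρ, hx⟩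
    refine ⟨ρ ≫ U.hom, H.isDet_comp hρ (isDet_iso U), ?_⟩
    ext m
    rw [actOn_apply, ← hx, stVec_comp]
  obtain ⟨R, hR⟩ := hcompact.isBounded.exists_norm_le
  have hR0 : ∀ x ∈ O.detSet A, ‖φ x‖ ≤ R := fun x hx => hR _ ⟨x, hx, rfl⟩
  -- Orbits are bounded: reversible transformations preserve the compact set of deterministic
  -- states, and every vector is a combination of two of these.
  have hbd : ∀ v : O.StR A, ∃ M : ℝ, ∀ U : A ≅ A, ‖φ (O.actOn U.hom v)‖ ≤ M := by
    rintro ⟨v, hv⟩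
    obtain ⟨u, w, hu, hw, rfl⟩ := H.exists_sub hv
    obtain ⟨ρ, hρ, hu'⟩ := H.exists_det_smul hu
    obtain ⟨σ, hσ, hw'⟩ := H.exists_det_smul hw
    set r := u (H.disc A)
    set t := w (H.disc A)
    refine ⟨|r| * R + |t| * R, fun U => ?_⟩
    have : (⟨u - w, hv⟩ : O.StR A) =
        r • ⟨O.stVec ρ, stVec_mem ρ⟩ - t • ⟨O.stVec σ, stVec_mem σ⟩ := by
      apply Subtype.ext
      simp only [Submodule.coe_sub, Submodule.coe_smul]
      rw [← hu', ← hw']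
    rw [this, map_sub, map_sub, map_smul, map_smul, map_smul, map_smul]
    refine (norm_sub_le _ _).trans ?_
    rw [norm_smul, norm_smul, Real.norm_eq_abs, Real.norm_eq_abs]
    gcongr
    · exact hR0 _ (hact U _ ⟨ρ, hρ, rfl⟩)
    · exact hR0 _ (hact U _ ⟨σ, hσ, rfl⟩)
  choose M hM using fun i => hbd (φ.symm (EuclideanSpace.single i (1 : ℝ)))
  obtain ⟨ρ₀, hρ₀⟩ := H.exists_isDet_state A
  have : Nonempty (A ≅ A) := ⟨Iso.refl A⟩
  obtain ⟨_, ⟨x, ⟨χ, hχ, hx⟩, rfl⟩, hfix⟩ := exists_fixed_point_of_bounded L hcompact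
    ((H.convex_detSet A).is_linear_image (φ.toLinearMap.isLinear))
    ⟨_, ⟨⟨O.stVec ρ₀, stVec_mem ρ₀⟩, ⟨ρ₀, hρ₀, rfl⟩, rfl⟩⟩
    (by
      rintro U _ ⟨x, hx, rfl⟩
      rw [hL]
      exact ⟨_, hact U x hx, by simp⟩)
    (fun U V => ⟨V ≪≫ U, fun x => by
      simp only [hL, ContinuousLinearEquiv.symm_apply_apply]
      congr 1
      ext m
      simp [actOn_apply]⟩)
    (fun U => ⟨U.symm, fun x => by
      simp only [hL, ContinuousLinearEquiv.symm_apply_apply]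
      rw [← φ.apply_symm_apply x]
      congr 1
      ext m
      simp [actOn_apply]⟩)
    (∑ i, M i) (fun U x => by
      have hx : x = ∑ i, x i • EuclideanSpace.single i (1 : ℝ) := by
        ext j
        simp [Finset.sum_apply, Pi.single_apply]
      conv_lhs => rw [hx, map_sum]
      refine (norm_sum_le _ _).trans ?_
      rw [Finset.sum_mul]
      refine Finset.sum_le_sum fun i _ => ?_
      rw [map_smul, norm_smul, mul_comm]
      gcongr
      · exact (norm_nonneg _).trans (hM i U)
      · exact hM i U
      · exact PiLp.norm_apply_le x i)
  refine ⟨χ, hχ, fun U => H.state_ext ?_⟩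
  have := hfix U
  rw [hL, φ.symm_apply_apply] at this
  have := congrArg Subtype.val (φ.injective this)
  rw [← hx] at this
  ext m
  rw [← this, actOn_apply, ← hx, stVec_comp]

end Principles

/-! ### Bits, faithful states and products of pure states -/

/-- A system with two perfectly distinguishable states exists. -/
def HasBit (O : OPT C) : Prop :=
  ∃ (Q : C) (ξ : Fin 2 → (𝟙_ C ⟶ Q)) (x : Fin 2 → (Q ⟶ 𝟙_ C)), O.IsTest x ∧
    ∀ i j, O.stVec (ξ j) (x i) = if i = j then 1 else 0

/-- Every state is, up to a positive factor, in a decomposition of `ω`. -/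
def Faithful (O : OPT C) {A : C} (ω : 𝟙_ C ⟶ A) : Prop :=
  ∀ σ : 𝟙_ C ⟶ A, ∃ r : ℝ, 0 < r ∧ O.InCone (O.stVec ω - r • O.stVec σ)

/-- The state `σ` is, up to a positive factor, in a decomposition of `ω`. -/
def Refines (O : OPT C) {A : C} (ω σ : 𝟙_ C ⟶ A) : Prop :=
  ∃ r : ℝ, 0 < r ∧ O.InCone (O.stVec ω - r • O.stVec σ)

lemma stVec_whiskerLeft_prodEff {A B B' : C} (Ψ : 𝟙_ C ⟶ A ⊗ B) (f : B ⟶ B') (a : A ⟶ 𝟙_ C)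
    (b : B' ⟶ 𝟙_ C) : O.stVec (Ψ ≫ A ◁ f) (prodEff a b) = O.stVec (cond (swap Ψ) a ≫ f) b := by
  rw [← stVec_cond, ← stVec_cond_swap, cond_swap_whiskerLeft]

namespace Principles

variable (H : O.Principles)
include H

lemma isPure_state_intro' {A : C} {ρ : 𝟙_ C ⟶ A} (h : ∀ g h : 𝟙_ C ⟶ A,
    O.stVec g + O.stVec h = O.stVec ρ → ∃ p : ℝ, O.stVec g = p • O.stVec ρ) : O.IsPure ρ := by
  refine H.isPure_state_intro fun v w hv hw e => ?_
  have he := congrFun e (H.disc A)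
  have h1 := stVec_le_one (O := O) ρ (H.disc A)
  rw [Pi.add_apply] at he
  obtain ⟨f, hf⟩ := H.state_of_inCone hv (by linarith [hw.nonneg (H.disc A)])
  obtain ⟨g, hg⟩ := H.state_of_inCone hw (by linarith [hv.nonneg (H.disc A)])
  rw [← hf]
  exact h f g (by rw [hf, hg, e])

/-- If `g` is part of a splitting of the product, conditioning either side on an effect splits a
multiple of a pure state. Hence `g (a ⊗ b)` is proportional to `ρ a` for fixed `b` and to `σ b` for
fixed `a`, and normalization of `σ` fixes the constant. -/
lemma isPure_prodState {A B : C} {ρ : 𝟙_ C ⟶ A} {σ : 𝟙_ C ⟶ B} (hρ : O.IsPure ρ)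
    (hσ : O.IsPure σ) (hσd : O.IsDet σ) : O.IsPure (prodState ρ σ) := by
  refine H.isPure_state_intro' fun g h e => ?_
  have e' : ∀ a b, O.stVec g (prodEff a b) + O.stVec h (prodEff a b) = O.stVec ρ a * O.stVec σ b :=
    fun a b => by rw [← stVec_prodState, ← e, Pi.add_apply]
  have h1 : ∀ b, ∃ c : ℝ, ∀ a, O.stVec g (prodEff a b) = c * O.stVec ρ a := fun b => by
    obtain ⟨p, hp⟩ := H.isPure_state_elim hρ (stVec_nonneg (O := O) σ b) (inCone_stVec (cond g b))
      (inCone_stVec (cond h b)) (by ext a; simp [stVec_cond, e', mul_comm])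
    exact ⟨_, fun a => by rw [← stVec_cond, hp]; rfl⟩
  have h2 : ∀ a, ∃ c : ℝ, ∀ b, O.stVec g (prodEff a b) = c * O.stVec σ b := fun a => by
    obtain ⟨p, hp⟩ := H.isPure_state_elim hσ (stVec_nonneg (O := O) ρ a) (inCone_stVec (cond (swap g) a))
      (inCone_stVec (cond (swap h) a)) (by
        ext b
        simp only [Pi.add_apply, stVec_cond_swap]
        simp [stVec_cond, e'])
    exact ⟨_, fun b => by rw [← stVec_cond, ← stVec_cond_swap, hp]; rfl⟩
  choose c hc using h1
  choose c' hc' using h2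
  refine ⟨c (H.disc B), H.bipartite_ext (stVec_mem _) (Submodule.smul_mem _ _ (stVec_mem _))
    fun a b => ?_⟩
  have h3 := hc' a (H.disc B)
  rw [hc, H.norm_of_isDet hσd, mul_one] at h3
  rw [Pi.smul_apply, stVec_prodState, smul_eq_mul, hc' a b, ← h3, mul_assoc]

lemma isPure_swap {A B : C} {Ψ : 𝟙_ C ⟶ A ⊗ B} (h : O.IsPure Ψ) : O.IsPure (swap Ψ) :=
  H.isPure_comp_iso h _

lemma det_state_disc {A : C} {ρ : 𝟙_ C ⟶ A} (hρ : O.IsDet ρ) : ρ ≫ H.disc A = 𝟙 _ := by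
  rw [H.det_comp_disc hρ, H.disc_unit]

lemma isDet_whiskerLeft {A B : C} {f : A ⟶ B} (hf : O.IsDet f) (R : C) : O.IsDet (R ◁ f) :=
  H.isTest_whiskerLeft hf R

lemma isDet_whiskerRight {A B : C} {f : A ⟶ B} (hf : O.IsDet f) (R : C) : O.IsDet (f ▷ R) :=
  H.isTest_whiskerRight hf R

/-! ### Extensions and steering -/

lemma exists_purification {A : C} (ρ : 𝟙_ C ⟶ A) :
    ∃ (E : C) (Ψ : 𝟙_ C ⟶ A ⊗ E), O.IsPure Ψ ∧ cond Ψ (H.disc E) = ρ := by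
  obtain ⟨E, Ψ, e, h1, h2, h3⟩ := (H.purif A ρ).1
  exact ⟨E, Ψ, h1, by rw [← H.eq_disc h2]; exact h3⟩

lemma exists_iso_of_purifications {A E : C} {Ψ Ψ' : 𝟙_ C ⟶ A ⊗ E} (h : O.IsPure Ψ)
    (h' : O.IsPure Ψ') (e : cond Ψ (H.disc E) = cond Ψ' (H.disc E)) :
    ∃ U : E ≅ E, Ψ' = Ψ ≫ A ◁ U.hom := by
  obtain ⟨U, hU, -⟩ := (H.purif A (cond Ψ (H.disc E))).2 E Ψ Ψ' (H.disc E) (H.disc E)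
    ⟨h, H.isDet_disc E, rfl⟩ ⟨h', H.isDet_disc E, e.symm⟩
  exact ⟨U, hU⟩

/-- Uniqueness of purification compares only purifications with the same purifying system; appending
a pure ancilla makes the systems agree. -/
lemma isPure_pad {A B K : C} {Ψ : 𝟙_ C ⟶ A ⊗ B} (h : O.IsPure Ψ) {η : 𝟙_ C ⟶ K}
    (hη : O.IsPure η) (hηd : O.IsDet η) :
    O.IsPure (Ψ ≫ A ◁ ((ρ_ B).inv ≫ B ◁ η)) := by
  convert H.isPure_comp_iso (H.isPure_prodState h hη hηd) (α_ A B K) using 1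
  simp [prodState_eq]

lemma isPure_pad_left {A B K : C} {Ψ : 𝟙_ C ⟶ A ⊗ B} (h : O.IsPure Ψ) {η : 𝟙_ C ⟶ K}
    (hη : O.IsPure η) (hηd : O.IsDet η) :
    O.IsPure (Ψ ≫ A ◁ ((λ_ B).inv ≫ η ▷ B)) := by
  convert H.isPure_comp_iso (H.isPure_pad h hη hηd) (whiskerLeftIso A (β_ B K)) using 1
  simp only [whiskerLeftIso_hom, Category.assoc, ← MonoidalCategory.whiskerLeft_comp,
    BraidedCategory.braiding_naturality_right]
  simp

lemma isDet_pad (B : C) {K : C} {η : 𝟙_ C ⟶ K} (hη : O.IsDet η) :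
    O.IsDet ((ρ_ B).inv ≫ B ◁ η) :=
  H.isDet_comp (isDet_iso (ρ_ B).symm) (H.isDet_whiskerLeft hη B)

lemma isDet_pad_left (B : C) {K : C} {η : 𝟙_ C ⟶ K} (hη : O.IsDet η) :
    O.IsDet ((λ_ B).inv ≫ η ▷ B) :=
  H.isDet_comp (isDet_iso (λ_ B).symm) (H.isDet_whiskerRight hη B)

lemma cond_whiskerLeft_det {A B K : C} (Ψ : 𝟙_ C ⟶ A ⊗ B) {f : B ⟶ K} (hf : O.IsDet f) :
    cond (Ψ ≫ A ◁ f) (H.disc K) = cond Ψ (H.disc B) := by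
  rw [cond_whiskerLeft, H.det_comp_disc hf]

/-- Every extension of the marginal of a pure state is obtained by a deterministic transformation
of the purifying system. -/
lemma exists_extension {A B K : C} {Ψ : 𝟙_ C ⟶ A ⊗ B} (hΨ : O.IsPure Ψ) {Ω : 𝟙_ C ⟶ A ⊗ K}
    (h : cond Ψ (H.disc B) = cond Ω (H.disc K)) :
    ∃ f : B ⟶ K, O.IsDet f ∧ Ψ ≫ A ◁ f = Ω := by
  obtain ⟨Y, W, hW, hWΩ⟩ := H.exists_purification Ω
  obtain ⟨η, hηd, hη⟩ := H.exists_pure_det (K ⊗ Y)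
  obtain ⟨β, hβd, hβ⟩ := H.exists_pure_det B
  have hW' := H.isPure_comp_iso hW (α_ A K Y)
  set W' := W ≫ (α_ A K Y).hom with hW'def
  have hdY : O.IsDet (K ◁ H.disc Y ≫ (ρ_ K).hom) :=
    H.isDet_comp (H.isDet_whiskerLeft (H.isDet_disc Y) K) (isDet_iso (ρ_ K))
  have hΩ : W' ≫ A ◁ (K ◁ H.disc Y ≫ (ρ_ K).hom) = Ω := by
    rw [← hWΩ, hW'def, cond]
    simp
  have hmarg : cond W' (H.disc (K ⊗ Y)) = cond Ω (H.disc K) := by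
    rw [← hΩ, H.cond_whiskerLeft_det _ hdY]
  have hp := H.isDet_pad B hηd
  have hq := H.isDet_pad_left (K ⊗ Y) hβd
  -- `Ψ` padded by `K ⊗ Y`, and the purification `W'` of `Ω` padded by `B`, purify the same state
  -- with the same system. The required channel appends the ancilla, applies `U`, and discards `B`
  -- and `Y`.
  obtain ⟨U, hU⟩ := H.exists_iso_of_purifications (H.isPure_pad hΨ hη hηd)
    (H.isPure_pad_left hW' hβ hβd) (by
      rw [H.cond_whiskerLeft_det _ hp, H.cond_whiskerLeft_det _ hq, h, hmarg])
  have hdB : O.IsDet (H.disc B ▷ (K ⊗ Y) ≫ (λ_ _).hom) :=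
    H.isDet_comp (H.isDet_whiskerRight (H.isDet_disc B) _) (isDet_iso (λ_ _))
  refine ⟨((ρ_ B).inv ≫ B ◁ η) ≫ U.hom ≫ (H.disc B ▷ (K ⊗ Y) ≫ (λ_ _).hom) ≫
    (K ◁ H.disc Y ≫ (ρ_ K).hom), H.isDet_comp hp (H.isDet_comp (isDet_iso U)
    (H.isDet_comp hdB hdY)), ?_⟩
  have h1 : ((λ_ (K ⊗ Y)).inv ≫ β ▷ (K ⊗ Y)) ≫ (H.disc B ▷ (K ⊗ Y) ≫ (λ_ _).hom) = 𝟙 _ := by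
    have : β ▷ (K ⊗ Y) ≫ H.disc B ▷ (K ⊗ Y) = 𝟙 _ := by
      rw [← comp_whiskerRight, H.det_state_disc hβd, id_whiskerRight]
    rw [Category.assoc, reassoc_of% this]
    simp
  calc _ = ((Ψ ≫ A ◁ ((ρ_ B).inv ≫ B ◁ η)) ≫ A ◁ U.hom) ≫
        A ◁ ((H.disc B ▷ (K ⊗ Y) ≫ (λ_ _).hom) ≫ (K ◁ H.disc Y ≫ (ρ_ K).hom)) := by
        simp only [MonoidalCategory.whiskerLeft_comp, Category.assoc]
    _ = W' ≫ A ◁ ((((λ_ (K ⊗ Y)).inv ≫ β ▷ (K ⊗ Y)) ≫ (H.disc B ▷ (K ⊗ Y) ≫ (λ_ _).hom)) ≫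
        (K ◁ H.disc Y ≫ (ρ_ K).hom)) := by
        rw [← hU]
        simp only [MonoidalCategory.whiskerLeft_comp, Category.assoc]
    _ = Ω := by rw [h1, Category.id_comp, hΩ]

lemma bit_isDet {Q : C} {ξ : Fin 2 → (𝟙_ C ⟶ Q)} {x : Fin 2 → (Q ⟶ 𝟙_ C)}
    (hξ : ∀ i j, O.stVec (ξ j) (x i) = if i = j then 1 else 0) (i : Fin 2) : O.IsDet (ξ i) := by
  have := H.stVec_le_disc (x i) (ξ i)
  rw [hξ, if_pos rfl] at this
  exact H.isDet_of_norm (le_antisymm (stVec_le_one _ _) this)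

/-- Record the two terms of the decomposition in a bit. The flagged state extends the marginal,
hence is obtained from `Ψ` by a channel on `B`, and reading the flag after that channel is the
required effect. -/
lemma exists_steering (hb : O.HasBit) {A B : C} {Ψ : 𝟙_ C ⟶ A ⊗ B} (hΨ : O.IsPure Ψ)
    {v w : (A ⟶ 𝟙_ C) → ℝ} (hv : O.InCone v) (hw : O.InCone w)
    (h : v + w = O.stVec (cond Ψ (H.disc B))) :
    ∃ b : B ⟶ 𝟙_ C, O.stVec (cond Ψ b) = v := by
  obtain ⟨Q, ξ, x, hx, hξ⟩ := hb
  have hd := H.bit_isDet hξ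
  have he := congrFun h (H.disc A)
  rw [Pi.add_apply] at he
  have h1 := stVec_le_one (O := O) (cond Ψ (H.disc B)) (H.disc A)
  obtain ⟨f, rfl⟩ := H.state_of_inCone hv (by linarith [hw.nonneg (H.disc A)])
  obtain ⟨g, rfl⟩ := H.state_of_inCone hw (by linarith [hv.nonneg (H.disc A)])
  obtain ⟨Ω, hΩ⟩ := H.state_of_inCone (H.inCone_add (inCone_stVec (prodState f (ξ 0)))
    (inCone_stVec (prodState g (ξ 1)))) (by
      rw [Pi.add_apply, ← H.prodEff_disc, stVec_prodState, stVec_prodState,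
        H.norm_of_isDet (hd 0), H.norm_of_isDet (hd 1)]
      linarith)
  obtain ⟨k, hk, hkΩ⟩ := H.exists_extension hΨ (Ω := Ω) (by
    refine H.state_ext ?_
    ext a
    rw [stVec_cond Ω, hΩ, Pi.add_apply, stVec_prodState, stVec_prodState, ← h,
      H.norm_of_isDet (hd 0), H.norm_of_isDet (hd 1)]
    simp)
  refine ⟨k ≫ x 0, ?_⟩
  rw [← cond_whiskerLeft, hkΩ]
  ext a
  rw [stVec_cond, hΩ, Pi.add_apply, stVec_prodState, stVec_prodState, hξ, hξ]
  simp

lemma exists_steering_smul (hb : O.HasBit) {A B : C} {Ψ : 𝟙_ C ⟶ A ⊗ B} (hΨ : O.IsPure Ψ)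
    {t : ℝ} (ht : 0 ≤ t) {σ : 𝟙_ C ⟶ A}
    (h : O.InCone (O.stVec (cond Ψ (H.disc B)) - t • O.stVec σ)) :
    ∃ b : B ⟶ 𝟙_ C, O.stVec (cond Ψ b) = t • O.stVec σ :=
  H.exists_steering hb hΨ ((inCone_stVec σ).smul ht) h (by abel)

/-! ### Faithful states -/

/-- Write each vector of a basis as a difference of cone vectors; the normalized sum of all of these
dominates a small multiple of every state. -/
lemma exists_faithful (A : C) : ∃ ω : 𝟙_ C ⟶ A, O.IsDet ω ∧ O.Faithful ω := by
  have := H.fin A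
  let b := Module.finBasis ℝ (O.StR A)
  choose u w hu hw huw using fun i => H.exists_sub (b i).2
  obtain ⟨ρ₀, hρ₀⟩ := H.exists_isDet_state A
  have hcone : O.InCone (O.stVec ρ₀ + ∑ i, (u i + w i)) :=
    H.inCone_add (inCone_stVec _) (H.inCone_sum _ fun i _ => H.inCone_add (hu i) (hw i))
  obtain ⟨ω, hω, hωv⟩ := H.exists_det_smul hcone
  set s := (O.stVec ρ₀ + ∑ i, (u i + w i)) (H.disc A) with hs
  have hs1 : 0 < s := by
    rw [hs, Pi.add_apply, H.norm_of_isDet hρ₀, Finset.sum_apply]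
    have := Finset.sum_nonneg (s := Finset.univ) (fun i _ =>
      (H.inCone_add (hu i) (hw i)).nonneg (H.disc A))
    linarith
  refine ⟨ω, hω, fun σ => ?_⟩
  let v : O.StR A := ⟨O.stVec σ, stVec_mem σ⟩
  have hv : O.stVec σ = ∑ i, b.repr v i • (u i - w i) := by
    have := congrArg Subtype.val (b.sum_repr v)
    simp only [Submodule.coe_sum, Submodule.coe_smul, huw] at this
    exact this.symm
  set x := fun i => b.repr v i with hx
  -- Small enough for all the coefficients `1 - r * x i` and `1 + r * x i` to be nonnegative.
  let r := (1 + ∑ i, |x i|)⁻¹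
  have hr : 0 < r := inv_pos.2 (by positivity)
  have hrx : ∀ i, |r * x i| ≤ 1 := fun i => by
    rw [abs_mul, abs_of_pos hr, inv_mul_le_one₀ (by positivity)]
    have := Finset.single_le_sum (f := fun i => |x i|) (fun i _ => abs_nonneg _) (Finset.mem_univ i)
    linarith
  refine ⟨r / s, by positivity, ?_⟩
  have key : O.stVec ω - (r / s) • O.stVec σ =
      s⁻¹ • (O.stVec ρ₀ + ∑ i, ((1 - r * x i) • u i + (1 + r * x i) • w i)) := by
    have e1 : O.stVec ω = s⁻¹ • (O.stVec ρ₀ + ∑ i, (u i + w i)) := by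
      rw [hωv, inv_smul_smul₀ hs1.ne']
    rw [e1, div_eq_inv_mul, mul_smul, ← smul_sub, hv, Finset.smul_sum, add_sub_assoc,
      ← Finset.sum_sub_distrib]
    congr 2
    refine Finset.sum_congr rfl fun i _ => ?_
    ext m
    simp only [Pi.sub_apply, Pi.add_apply, Pi.smul_apply, smul_eq_mul, hx]
    ring
  rw [key]
  refine InCone.smul (H.inCone_add (inCone_stVec _) (H.inCone_sum _ fun i _ =>
    H.inCone_add ((hu i).smul ?_) ((hw i).smul ?_))) (by positivity)
  · linarith [(abs_le.1 (hrx i)).2]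
  · linarith [(abs_le.1 (hrx i)).1]

lemma exists_steering_faithful (hb : O.HasBit) {A B : C} {Ψ : 𝟙_ C ⟶ A ⊗ B} (hΨ : O.IsPure Ψ)
    (hf : O.Faithful (cond Ψ (H.disc B))) (σ : 𝟙_ C ⟶ A) :
    ∃ (r : ℝ) (b : B ⟶ 𝟙_ C), 0 < r ∧ O.stVec (cond Ψ b) = r • O.stVec σ := by
  obtain ⟨r, hr, h⟩ := hf σ
  obtain ⟨b, hb⟩ := H.exists_steering_smul hb hΨ hr.le h
  exact ⟨r, b, hr, hb⟩

/-- Events are determined by their action on one side of a pure state with faithful marginal. -/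
lemma mat_eq_smul_of_faithful (hb : O.HasBit) {A B D : C} {Φ : 𝟙_ C ⟶ B ⊗ A} (hΦ : O.IsPure Φ)
    (hf : O.Faithful (cond (swap Φ) (H.disc B))) {f g : A ⟶ D} {p : ℝ}
    (h : O.stVec (Φ ≫ B ◁ g) = p • O.stVec (Φ ≫ B ◁ f)) : O.mat g = p • O.mat f := by
  ext ⟨σ, m⟩
  obtain ⟨r, b, hr, hb⟩ := H.exists_steering_faithful hb (H.isPure_swap hΦ) hf σ
  have h1 := congrFun h (prodEff b m)
  rw [Pi.smul_apply, stVec_whiskerLeft_prodEff, stVec_whiskerLeft_prodEff, stVec_comp, stVec_comp,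
    hb] at h1
  simp only [Pi.smul_apply, smul_eq_mul, mat_apply, stVec_comp] at h1 ⊢
  have : r * O.stVec σ (g ≫ m) = r * (p * O.stVec σ (f ≫ m)) := by rw [h1]; ring
  exact mul_left_cancel₀ hr.ne' this

/-! ### Purity of the identity and of local events -/

/-- Apply the splitting to one half of a pure state with faithful marginal. It splits a multiple of
that pure state, so each term is proportional to it, and faithfulness transfers this to the events.
-/
lemma mat_eq_smul_id (hb : O.HasBit) {R : C} {g h : R ⟶ R} {t : ℝ} (ht : 0 ≤ t)
    (e : O.mat g + O.mat h = t • O.mat (𝟙 R)) : ∃ p : ℝ, O.mat g = p • O.mat (𝟙 R) := by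
  obtain ⟨ω, -, hω⟩ := H.exists_faithful R
  obtain ⟨E, Ψ, hΨ, rfl⟩ := H.exists_purification ω
  have hΨ' := H.isPure_swap hΨ
  obtain ⟨p, hp⟩ := H.isPure_state_elim hΨ' ht (inCone_stVec (swap Ψ ≫ E ◁ g))
    (inCone_stVec (swap Ψ ≫ E ◁ h)) (by
      refine H.bipartite_ext (Submodule.add_mem _ (stVec_mem _) (stVec_mem _))
        (Submodule.smul_mem _ _ (stVec_mem _)) fun a b => ?_
      have := congrFun e (cond Ψ a, b)
      simp only [Pi.add_apply, Pi.smul_apply, mat_apply, Category.comp_id] at this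
      rw [Pi.add_apply, Pi.smul_apply, stVec_whiskerLeft_prodEff, stVec_whiskerLeft_prodEff,
        ← stVec_cond, stVec_cond_swap, swap_swap, this, ← stVec_cond_swap, ← stVec_cond_swap,
        swap_swap])
  refine ⟨p * t, H.mat_eq_smul_of_faithful hb hΨ' (by rwa [swap_swap]) ?_⟩
  simpa using hp

/-- Filling one slot of a bipartite event. -/
def slot {R A A' : C} (σ : 𝟙_ C ⟶ A) (k : R ⊗ A ⟶ R ⊗ A') (c : A' ⟶ 𝟙_ C) : R ⟶ R :=
  ((ρ_ R).inv ≫ R ◁ σ) ≫ k ≫ R ◁ c ≫ (ρ_ R).hom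

omit H in
lemma mat_slot {R A A' : C} (σ : 𝟙_ C ⟶ A) (k : R ⊗ A ⟶ R ⊗ A') (c : A' ⟶ 𝟙_ C) (ψ : 𝟙_ C ⟶ R)
    (r : R ⟶ 𝟙_ C) : O.mat (slot σ k c) (ψ, r) = O.stVec (prodState ψ σ ≫ k) (prodEff r c) := by
  simp [mat, stVec, slot, prodState_eq, prodEff_eq]

/-- Filling the other slot of a bipartite event. -/
def slot' {R A A' : C} (ψ : 𝟙_ C ⟶ R) (k : R ⊗ A ⟶ R ⊗ A') (r : R ⟶ 𝟙_ C) : A ⟶ A' :=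
  ((λ_ A).inv ≫ ψ ▷ A) ≫ k ≫ r ▷ A' ≫ (λ_ A').hom

omit H in
lemma mat_slot' {R A A' : C} (σ : 𝟙_ C ⟶ A) (k : R ⊗ A ⟶ R ⊗ A') (c : A' ⟶ 𝟙_ C) (ψ : 𝟙_ C ⟶ R)
    (r : R ⟶ 𝟙_ C) : O.mat (slot' ψ k r) (σ, c) = O.stVec (prodState ψ σ ≫ k) (prodEff r c) := by
  simp [mat, stVec, slot', prodState_eq', prodEff_eq']

/-- Filling the `A` slot of a splitting gives a splitting of a multiple of the identity of `R`;
filling the `R` slot gives a splitting of `f`. Both are trivial, so on products `g` is a constant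
times `R ◁ f`, and products suffice. -/
lemma isPure_whiskerLeft (hb : O.HasBit) {A A' : C} {f : A ⟶ A'} (hf : O.IsPure f) (R : C) :
    O.IsPure (R ◁ f) := by
  refine H.isPure_intro fun g h hgh e => ?_
  obtain ⟨ψ, hψ⟩ := H.exists_isDet_state R
  have e' : ∀ ψ σ r c, O.stVec (prodState ψ σ ≫ g) (prodEff r c) +
      O.stVec (prodState ψ σ ≫ h) (prodEff r c) = O.stVec ψ r * O.stVec (σ ≫ f) c := by
    intro ψ σ r c
    have := congrFun e (prodState ψ σ, prodEff r c)
    rw [Pi.add_apply, mat_apply, mat_apply, mat_apply, prodState_whiskerLeft,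
      stVec_prodState] at this
    exact this
  have h1 : ∀ σ c, ∃ q : ℝ, ∀ ψ r, O.stVec (prodState ψ σ ≫ g) (prodEff r c) =
      q * O.stVec ψ r := fun σ c => by
    obtain ⟨q, hq⟩ := H.mat_eq_smul_id hb (g := slot σ g c) (h := slot σ h c)
      (stVec_nonneg (O := O) (σ ≫ f) c) (by
        ext ⟨ψ, r⟩
        rw [Pi.add_apply, mat_slot, mat_slot, e', Pi.smul_apply, mat_apply, Category.comp_id,
          smul_eq_mul, mul_comm])
    refine ⟨q, fun ψ r => ?_⟩
    rw [← mat_slot, hq, Pi.smul_apply, mat_apply, Category.comp_id, smul_eq_mul]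
  obtain ⟨p, -, hp⟩ := H.isPure_elim hf (g := slot' ψ g (H.disc R)) (h := slot' ψ h (H.disc R))
    (comp_coexist (coexist_comp hgh _) _) (by
      ext ⟨σ, c⟩
      rw [Pi.add_apply, mat_slot', mat_slot', e', H.norm_of_isDet hψ, one_mul, mat_apply])
  have h2 : ∀ ψ' σ r c, O.stVec (prodState ψ' σ ≫ g) (prodEff r c) =
      p * O.stVec (prodState ψ' σ ≫ R ◁ f) (prodEff r c) := by
    intro ψ' σ r c
    obtain ⟨q, hq⟩ := h1 σ c
    have h3 := congrFun hp (σ, c)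
    rw [mat_slot', hq, H.norm_of_isDet hψ, Pi.smul_apply, mat_apply, mul_one, smul_eq_mul] at h3
    rw [hq, h3, prodState_whiskerLeft, stVec_prodState]
    ring
  refine ⟨p, ?_⟩
  have := H.mat_of_prod ![1, -p] ![g, R ◁ f] (fun ψ' σ r c => by simp [h2])
  simp at this
  linear_combination this

lemma isPure_cond (hb : O.HasBit) {A B : C} {Ψ : 𝟙_ C ⟶ A ⊗ B} (hΨ : O.IsPure Ψ)
    {b : B ⟶ 𝟙_ C} (hbp : O.IsPure b) : O.IsPure (cond Ψ b) := by
  have := H.isPure_comp_iso (H.pur _ _ _ _ _ hΨ (H.isPure_whiskerLeft hb hbp A)) (ρ_ A)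
  simpa [cond] using this

lemma isPure_comp_whiskerLeft (hb : O.HasBit) {A B D : C} {Ψ : 𝟙_ C ⟶ A ⊗ B} (hΨ : O.IsPure Ψ)
    {f : B ⟶ D} (hf : O.IsPure f) : O.IsPure (Ψ ≫ A ◁ f) :=
  H.pur _ _ _ _ _ hΨ (H.isPure_whiskerLeft hb hf A)

end Principles

namespace Principles

variable (H : O.Principles)
include H

omit H in
lemma refines_of_add {A : C} {ω σ τ : 𝟙_ C ⟶ A} (h : O.stVec σ + O.stVec τ = O.stVec ω) :
    O.Refines ω σ :=
  ⟨1, one_pos, by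
    rw [← h, one_smul, add_sub_cancel_left]
    exact inCone_stVec τ⟩

lemma refines_of_ensemble {X : Type} [Fintype X] {A : C} {ρs : X → (𝟙_ C ⟶ A)} {ω : 𝟙_ C ⟶ A}
    (h : O.IsEnsembleOf ρs ω) (x : X) : O.InCone (O.stVec ω - O.stVec (ρs x)) := by
  classical
  have := stVec_of_transfVec (fun _ => 1) ρs (σ := ω) (by simpa using h.2.symm)
  simp only [one_smul] at this
  rw [this, ← Finset.add_sum_erase _ _ (Finset.mem_univ x), add_sub_cancel_left]
  exact H.inCone_sum _ fun y _ => inCone_stVec _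

/-! ### Ideal compression -/

/-- An ideal compression has a decoding that works for all decompositions simultaneously, and the
encoding of the compressed state is faithful. -/
lemma exists_compression {A : C} {ω : 𝟙_ C ⟶ A} (hω : O.IsDet ω) :
    ∃ (B : C) (E : A ⟶ B) (D : B ⟶ A), O.IsDet E ∧ O.IsDet D ∧
      (∀ σ : 𝟙_ C ⟶ B, σ ≫ D ≫ E = σ) ∧ (∀ σ, O.Refines ω σ → σ ≫ E ≫ D = σ) ∧
      O.Faithful (ω ≫ E) := by
  obtain ⟨B, E, hE, hless, heff⟩ := H.compr A ω hω
  have := H.fin A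
  let W : Submodule ℝ ((A ⟶ 𝟙_ C) → ℝ) :=
    Submodule.span ℝ {v | ∃ σ, O.Refines ω σ ∧ O.stVec σ = v}
  have hWle : W ≤ O.StR A := by
    refine Submodule.span_mono ?_
    rintro _ ⟨σ, -, rfl⟩
    exact ⟨σ, rfl⟩
  have : FiniteDimensional ℝ W := Submodule.finiteDimensional_of_le hWle
  have hωref : O.Refines ω ω := ⟨1, one_pos, by simpa using inCone_zero A ω⟩
  let b := Module.finBasis ℝ W
  choose k c g hg using fun i => Submodule.mem_span_set'.1 (b i).2
  -- Losslessness gives a decoder for one ensemble at a time. A single ensemble is built that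
  -- contains multiples of finitely many states spanning all refinements of `ω`; its decoder then
  -- works for every refinement by linearity.
  choose σ hσ hσv using fun i j => (g i j).2
  let ι := Σ i, Fin (k i)
  let s : Option ι → (𝟙_ C ⟶ A) := fun o => o.elim ω fun z => σ z.1 z.2
  have hs : ∀ o, O.Refines ω (s o) := fun o => by
    cases o with
    | none => exact hωref
    | some z => exact hσ z.1 z.2
  choose r hr hcone using hs
  let N : ℝ := Fintype.card (Option ι)
  have hN : 0 < N := by simp only [N]; positivity
  have hnorm1 : ∀ o, r o * O.stVec (s o) (H.disc A) ≤ 1 := fun o => by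
    have := (hcone o).nonneg (H.disc A)
    rw [Pi.sub_apply, H.norm_of_isDet hω, Pi.smul_apply, smul_eq_mul] at this
    linarith
  have hN1 : 1 ≤ N := by
    simp only [N]
    exact_mod_cast Fintype.card_pos
  choose f hf using fun o => H.state_of_inCone
    ((inCone_stVec (O := O) (s o)).smul (r := N⁻¹ * r o) (by have := hr o; positivity)) (by
      rw [Pi.smul_apply, smul_eq_mul, mul_assoc, inv_mul_le_one₀ hN]
      exact (hnorm1 o).trans hN1)
  choose f' hf' using fun o => H.state_of_inCone ((hcone o).smul (r := N⁻¹) (by positivity)) (by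
      rw [Pi.smul_apply, smul_eq_mul, inv_mul_le_one₀ hN, Pi.sub_apply, H.norm_of_isDet hω,
        Pi.smul_apply, smul_eq_mul]
      have := mul_nonneg (hr o).le (stVec_nonneg (O := O) (s o) (H.disc A))
      linarith)
  -- With probability `1 / N` choose `o`, and split `ω` into `r o • s o` and the rest. The index
  -- `none`, which stands for `ω` itself, keeps the family nonempty.
  let ens : Option ι × Fin 2 → (𝟙_ C ⟶ A) := fun z => ![f z.1, f' z.1] z.2
  have hsum : O.stVec ω = ∑ z, O.stVec (ens z) := by
    rw [Fintype.sum_prod_type]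
    simp only [Fin.sum_univ_two, ens, Matrix.cons_val_zero, Matrix.cons_val_one, hf, hf']
    have : ∀ o, (N⁻¹ * r o) • O.stVec (s o) + N⁻¹ • (O.stVec ω - r o • O.stVec (s o)) =
        N⁻¹ • O.stVec ω := fun o => by
      rw [smul_sub, smul_smul, add_sub_cancel]
    simp only [this, Finset.sum_const, Finset.card_univ]
    rw [← Nat.cast_smul_eq_nsmul ℝ]
    exact (smul_inv_smul₀ hN.ne' _).symm
  have hens : O.IsEnsembleOf ens ω := by
    refine ⟨H.isTest_states _ ?_, ?_⟩
    · rw [← H.norm_of_isDet hω, hsum, Finset.sum_apply]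
    · have := transfVec_of_stVec (fun _ => 1) ens (σ := ω) (by simpa using hsum)
      simpa using this.symm
  obtain ⟨D, hD, hDens⟩ := hless _ ens hens
  have hDs : ∀ o a, O.stVec (s o) (E ≫ D ≫ a) = O.stVec (s o) a := fun o a => by
    have h1 := congrArg (fun x => O.stVec x a) (hDens (o, 0))
    simp only [ens, Matrix.cons_val_zero, stVec_comp, hf, Category.assoc,
      Pi.smul_apply, smul_eq_mul] at h1
    exact mul_left_cancel₀ (mul_pos (inv_pos.2 hN) (hr o)).ne' h1
  have hDW : ∀ v : W, ∀ a, v.1 (E ≫ D ≫ a) = v.1 a := by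
    intro v a
    have hb : ∀ i, (b i).1 (E ≫ D ≫ a) = (b i).1 a := fun i => by
      rw [← hg i]
      simp only [Finset.sum_apply, Pi.smul_apply, ← hσv]
      exact Finset.sum_congr rfl fun j _ => congrArg (c i j • ·) (hDs (some ⟨i, j⟩) a)
    rw [← b.sum_repr v]
    simp only [Submodule.coe_sum, Submodule.coe_smul, Finset.sum_apply, Pi.smul_apply, hb]
  have hDref : ∀ σ, O.Refines ω σ → ∀ a, O.stVec σ (E ≫ D ≫ a) = O.stVec σ a := fun σ hσ a =>
    hDW ⟨O.stVec σ, Submodule.subset_span ⟨σ, hσ, rfl⟩⟩ a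
  have hens_ref : ∀ (X : Type) (_ : Fintype X) (ρs : X → (𝟙_ C ⟶ A)) (x : X),
      O.IsEnsembleOf ρs ω → O.Refines ω (ρs x) := fun X _ ρs x h =>
    ⟨1, one_pos, by rw [one_smul]; exact H.refines_of_ensemble h x⟩
  refine ⟨B, E, D, hE, hD, fun σ => H.state_ext ?_, fun σ hσ => H.state_ext ?_, fun σ => ?_⟩
  · obtain ⟨t, X, _, ρs, x, ht, hρs, hσ⟩ := heff σ
    ext a
    rw [stVec_comp, hσ, Pi.smul_apply, Pi.smul_apply, stVec_comp, stVec_comp, Category.assoc,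
      hDref _ (hens_ref X _ ρs x hρs)]
  · ext a
    rw [stVec_comp, Category.assoc, hDref σ hσ]
  · obtain ⟨t, X, _, ρs, x, ht, hρs, hσ⟩ := heff σ
    rcases ht.eq_or_lt with rfl | ht
    · refine ⟨1, one_pos, ?_⟩
      rw [hσ, zero_smul, smul_zero, sub_zero]
      exact inCone_stVec _
    · refine ⟨t⁻¹, inv_pos.2 ht, ?_⟩
      rw [hσ, inv_smul_smul₀ ht.ne']
      obtain ⟨q, τ, hq, hτ⟩ := H.refines_of_ensemble hρs x
      refine ⟨q, τ ≫ E, hq, ?_⟩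
      ext a
      have := congrFun hτ (E ≫ a)
      simpa [stVec_comp] using this

/-- Every deterministic state has a purification whose purifying system is in a faithful state. -/
lemma exists_faithful_purification {A : C} {ω : 𝟙_ C ⟶ A} (hω : O.IsDet ω) :
    ∃ (B : C) (Ψ : 𝟙_ C ⟶ A ⊗ B), O.IsPure Ψ ∧ cond Ψ (H.disc B) = ω ∧
      O.Faithful (cond (swap Ψ) (H.disc A)) := by
  obtain ⟨E₀, Ψ, hΨ, rfl⟩ := H.exists_purification ω
  have hdet : O.IsDet (cond (swap Ψ) (H.disc A)) := by
    refine H.isDet_of_norm ?_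
    rw [stVec_cond_swap, H.norm_of_isDet hω]
  obtain ⟨B, E, D, hE, hD, hDE, hED, hfaith⟩ := H.exists_compression hdet
  refine ⟨B, Ψ ≫ A ◁ E, H.isPure_state_intro' fun g h e => ?_, ?_, ?_⟩
  · have h1 : (Ψ ≫ A ◁ E) ≫ A ◁ D = Ψ := by
      refine H.state_ext (H.bipartite_ext (stVec_mem _) (stVec_mem _) fun a b => ?_)
      obtain ⟨a', ha'⟩ := H.exists_compl a
      have href : O.Refines (cond (swap Ψ) (H.disc A)) (cond (swap Ψ) a) := by
        refine refines_of_add (τ := cond (swap Ψ) a') ?_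
        ext b
        simp only [Pi.add_apply, stVec_cond_swap]
        exact H.stVec_compl ha' _
      rw [stVec_whiskerLeft_prodEff, cond_swap_whiskerLeft, Category.assoc, hED _ href,
        stVec_cond_swap, stVec_cond]
    obtain ⟨p, hp⟩ := H.isPure_state_elim hΨ zero_le_one (inCone_stVec (g ≫ A ◁ D))
      (inCone_stVec (h ≫ A ◁ D)) (by
        conv_rhs => rw [one_smul, ← h1]
        ext a
        rw [Pi.add_apply, stVec_comp, stVec_comp, stVec_comp (Ψ ≫ A ◁ E)]
        exact congrFun e (A ◁ D ≫ a))
    refine ⟨p, H.bipartite_ext (stVec_mem _) (Submodule.smul_mem _ _ (stVec_mem _)) fun a b => ?_⟩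
    have h2 := congrFun hp (prodEff a (E ≫ b))
    rw [Pi.smul_apply, stVec_whiskerLeft_prodEff, ← stVec_comp, Category.assoc, hDE,
      stVec_cond_swap, stVec_cond, mul_one] at h2
    rw [h2, Pi.smul_apply, stVec_comp, whiskerLeft_prodEff]
  · rw [H.cond_whiskerLeft_det _ hE]
  · rwa [cond_swap_whiskerLeft]

/-! ### Pure instruments -/

omit H in
lemma stVec_effect_comp {A : C} (ρ : 𝟙_ C ⟶ A) (a : A ⟶ 𝟙_ C) (s : 𝟙_ C ⟶ 𝟙_ C) :
    O.stVec (ρ ≫ a) s = O.stVec ρ a * O.prob s := by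
  simp [stVec, ← prob_comp]

omit H in
omit [SymmetricCategory C] in
lemma unitor_whiskerLeft_scalar {B K : C} (Θ : 𝟙_ C ⟶ B ⊗ K) (s : 𝟙_ C ⟶ 𝟙_ C) :
    Θ ≫ B ◁ ((ρ_ K).inv ≫ K ◁ s ≫ (ρ_ K).hom) = s ≫ Θ := by
  have : B ◁ ((ρ_ K).inv ≫ K ◁ s ≫ (ρ_ K).hom) =
      (ρ_ (B ⊗ K)).inv ≫ (B ⊗ K) ◁ s ≫ (ρ_ (B ⊗ K)).hom := by
    simp
  rw [this, rightUnitor_inv_naturality_assoc, ← whisker_exchange_assoc, rightUnitor_naturality,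
    ← unitors_equal, ← unitors_inv_equal, ← leftUnitor_inv_naturality_assoc]
  simp

/-- Any two deterministic states have purifications with the same purifying system. -/
lemma exists_common_purification {B : C} (ρ : Fin 2 → (𝟙_ C ⟶ B)) :
    ∃ (K : C) (Θ : Fin 2 → (𝟙_ C ⟶ B ⊗ K)), ∀ i, O.IsPure (Θ i) ∧ cond (Θ i) (H.disc K) = ρ i := by
  obtain ⟨E₀, Θ₀, h₀, e₀⟩ := H.exists_purification (ρ 0)
  obtain ⟨E₁, Θ₁, h₁, e₁⟩ := H.exists_purification (ρ 1)
  obtain ⟨η₀, hd₀, hp₀⟩ := H.exists_pure_det E₀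
  obtain ⟨η₁, hd₁, hp₁⟩ := H.exists_pure_det E₁
  refine ⟨E₀ ⊗ E₁, ![_, _], Fin.forall_fin_two.2 ⟨⟨H.isPure_pad h₀ hp₁ hd₁, ?_⟩,
    ⟨H.isPure_pad_left h₁ hp₀ hd₀, ?_⟩⟩⟩
  · exact (H.cond_whiskerLeft_det _ (H.isDet_pad E₀ hd₁)).trans e₀
  · exact (H.cond_whiskerLeft_det _ (H.isDet_pad_left E₁ hd₀)).trans e₁

/-- Every binary measurement is realized by a test of pure transformations. -/
lemma exists_pure_instrument (hb : O.HasBit) {A : C} {m : Fin 2 → (A ⟶ 𝟙_ C)} (hm : O.IsTest m) :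
    ∃ (K : C) (T : Fin 2 → (A ⟶ K)), O.IsTest T ∧ ∀ i, O.IsPure (T i) ∧ T i ≫ H.disc K = m i := by
  have hb' := hb
  obtain ⟨Q, ξ, x, hx, hξ⟩ := hb'
  obtain ⟨ω, -, hω⟩ := H.exists_faithful A
  obtain ⟨B, Ψ, hΨ, hΨω⟩ := H.exists_purification ω
  have hΦ := H.isPure_swap hΨ
  have hΦω : O.Faithful (cond (swap (swap Ψ)) (H.disc B)) := by rwa [swap_swap, hΨω]
  set Φ := swap Ψ
  choose ρ hρ hρ' using fun i => H.exists_det_smul (inCone_stVec (O := O) (cond Φ (m i)))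
  obtain ⟨K, Θ, hΘ⟩ := H.exists_common_purification ρ
  set t := fun i => O.stVec (cond Φ (m i)) (H.disc B) with htdef
  have ht0 : ∀ i, 0 ≤ t i := fun i => stVec_nonneg _ _
  have hsumm : ∀ b, ∑ i, O.stVec (cond Φ (m i)) b = O.stVec (cond Φ (H.disc A)) b := fun b => by
    simp only [← stVec_cond_swap Φ]
    exact H.sum_stVec hm _
  -- The outcomes of `m` prepare `t i • ρ i` on `B`. Purify each `ρ i`, flag it with the bit, and
  -- mix: this extends the marginal of `Φ`, so a channel on `A` produces it. Reading the flag gives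
  -- `T i`, which sends `Φ` to a multiple of a pure state and is therefore pure.
  let Ξ : Fin 2 → (𝟙_ C ⟶ B ⊗ (K ⊗ Q)) := fun i => Θ i ≫ B ◁ ((ρ_ K).inv ≫ K ◁ ξ i)
  have hΞm : ∀ i, cond (Ξ i) (H.disc _) = ρ i := fun i => by
    rw [← (hΘ i).2]
    exact H.cond_whiskerLeft_det _ (H.isDet_pad K (H.bit_isDet hξ i))
  have hΞn : ∀ i, O.stVec (Ξ i) (H.disc _) = 1 := fun i => by
    rw [← H.norm_cond, hΞm, H.norm_of_isDet (hρ i)]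
  obtain ⟨Ω, hΩ⟩ := H.state_of_inCone (H.inCone_sum Finset.univ fun i _ =>
    (inCone_stVec (O := O) (Ξ i)).smul (ht0 i)) (by
      simp only [Finset.sum_apply, Pi.smul_apply, hΞn, smul_eq_mul, mul_one, htdef, hsumm]
      exact stVec_le_one _ _)
  obtain ⟨k, hk, hkΩ⟩ := H.exists_extension hΦ (Ω := Ω) (by
    refine H.state_ext ?_
    ext b
    rw [← hsumm, stVec_cond, hΩ, Finset.sum_apply]
    refine Finset.sum_congr rfl fun i _ => ?_
    rw [Pi.smul_apply, ← stVec_cond, hΞm]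
    exact congrFun (hρ' i) b)
  let T : Fin 2 → (A ⟶ K) := fun i => k ≫ K ◁ x i ≫ (ρ_ K).hom
  have hT : O.IsTest T :=
    H.isTest_det_comp (H.isTest_comp_det (H.isTest_whiskerLeft hx K) (isDet_iso (ρ_ K))) hk
  have hTΦ : ∀ i, O.stVec (Φ ≫ B ◁ T i) = t i • O.stVec (Θ i) := fun i => by
    have h1 : Φ ≫ B ◁ T i = Ω ≫ B ◁ (K ◁ x i ≫ (ρ_ K).hom) := by
      rw [← hkΩ]
      simp [T]
    have h2 : ∀ j, O.stVec (Ξ j ≫ B ◁ (K ◁ x i ≫ (ρ_ K).hom)) =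
        (if i = j then (1 : ℝ) else 0) • O.stVec (Θ j) := fun j => by
      have : Ξ j ≫ B ◁ (K ◁ x i ≫ (ρ_ K).hom) =
          Θ j ≫ B ◁ ((ρ_ K).inv ≫ K ◁ (ξ j ≫ x i) ≫ (ρ_ K).hom) := by
        simp [Ξ]
      rw [this, unitor_whiskerLeft_scalar, stVec_scalar_comp, ← stVec_apply, hξ]
    rw [h1]
    ext a
    rw [stVec_comp, hΩ, Finset.sum_apply]
    simp only [Pi.smul_apply, ← stVec_comp, h2]
    fin_cases i <;> simp
  refine ⟨K, T, hT, fun i => ⟨H.isPure_intro fun g h _ e => ?_, ?_⟩⟩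
  · obtain ⟨p, hp⟩ := H.isPure_state_elim (hΘ i).1 (ht0 i) (inCone_stVec (Φ ≫ B ◁ g))
      (inCone_stVec (Φ ≫ B ◁ h)) (by
        rw [← hTΦ]
        refine H.bipartite_ext (Submodule.add_mem _ (stVec_mem _) (stVec_mem _)) (stVec_mem _)
          fun a b => ?_
        have := congrFun e (cond (swap Φ) a, b)
        simp only [Pi.add_apply, mat_apply] at this
        rw [Pi.add_apply, stVec_whiskerLeft_prodEff, stVec_whiskerLeft_prodEff, this,
          stVec_whiskerLeft_prodEff])
    exact ⟨p, H.mat_eq_smul_of_faithful hb hΦ hΦω (by rw [hp, hTΦ, mul_smul])⟩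
  · refine H.mat_ext ?_
    have := H.mat_eq_smul_of_faithful hb hΦ hΦω (f := m i) (g := T i ≫ H.disc K) (p := 1) (by
      refine H.bipartite_ext (stVec_mem _) (Submodule.smul_mem _ _ (stVec_mem _)) fun b s => ?_
      have h2 := congrFun (hTΦ i) (prodEff b (H.disc K))
      rw [stVec_whiskerLeft_prodEff, Pi.smul_apply, ← stVec_cond, (hΘ i).2, stVec_comp] at h2
      rw [Pi.smul_apply, one_smul, stVec_whiskerLeft_prodEff, stVec_whiskerLeft_prodEff,
        stVec_effect_comp, stVec_effect_comp, h2, stVec_cond_swap]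
      exact congrArg (· * _) (congrFun (hρ' i) b).symm)
    rw [this, one_smul]

/-- A binary measurement whose first outcome is certain on `ω` can be realized without disturbing
the decompositions of `ω`. -/
lemma exists_nondisturbing (hb : O.HasBit) {A : C} {m : Fin 2 → (A ⟶ 𝟙_ C)} (hm : O.IsTest m)
    {ω : 𝟙_ C ⟶ A} (hω : O.IsDet ω) (h1 : O.stVec ω (m 0) = 1) :
    ∃ T : Fin 2 → (A ⟶ A), O.IsTest T ∧ (∀ i, T i ≫ H.disc A = m i) ∧
      ∀ σ, O.Refines ω σ → σ ≫ T 0 = σ := by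
  obtain ⟨K, T, hT, hTm⟩ := H.exists_pure_instrument hb hm
  obtain ⟨B, Ψ, hΨ, hΨω⟩ := H.exists_purification ω
  have hΦ := H.isPure_swap hΨ
  -- Outcome 0 is certain on `ω`, so the pure `T 0` leaves the marginal of the purifying system
  -- unchanged, and a channel `k` restores the purification. By steering, `T 0 ≫ k` then fixes every
  -- refinement of `ω`.
  obtain ⟨k, hk, hkΦ⟩ := H.exists_extension (H.isPure_comp_whiskerLeft hb hΦ (hTm 0).1)
    (Ω := swap Ψ) (by
      rw [cond_whiskerLeft, (hTm 0).2]
      refine H.state_ext ?_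
      have hz : O.stVec (cond (swap Ψ) (m 1)) = 0 := by
        refine H.stVec_eq_zero ?_
        rw [stVec_cond_swap, hΨω]
        have := H.sum_stVec hm ω
        rw [Fin.sum_univ_two, h1, H.norm_of_isDet hω] at this
        linarith
      ext b
      have := H.sum_stVec hm (cond Ψ b)
      rw [Fin.sum_univ_two, ← stVec_cond_swap Ψ, ← stVec_cond_swap Ψ, ← stVec_cond_swap Ψ, hz] at this
      simpa using this)
  refine ⟨fun i => T i ≫ k, H.isTest_comp_det hT hk, fun i => ?_, fun σ hσ => ?_⟩
  · rw [Category.assoc, H.det_comp_disc hk, (hTm i).2]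
  · obtain ⟨r, hr, hcone⟩ := hσ
    rw [← hΨω] at hcone
    obtain ⟨b, hbσ⟩ := H.exists_steering_smul hb hΨ hr.le hcone
    refine H.state_ext ?_
    ext a
    have h2 := congrArg (fun Φ => O.stVec Φ (prodEff b a)) hkΦ
    simp only [Category.assoc, ← MonoidalCategory.whiskerLeft_comp] at h2
    rw [stVec_whiskerLeft_prodEff, swap_swap, stVec_comp, hbσ, ← stVec_cond, stVec_cond_swap, hbσ,
      Pi.smul_apply, Pi.smul_apply, ← stVec_comp] at h2
    exact mul_left_cancel₀ hr.ne' h2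

end Principles

/-! ### Pure effects and the states on which they are certain -/

lemma mat_effect {A : C} (a : A ⟶ 𝟙_ C) (ρ : 𝟙_ C ⟶ A) (s : 𝟙_ C ⟶ 𝟙_ C) :
    O.mat a (ρ, s) = O.stVec ρ a * O.prob s := by
  rw [mat_apply, Principles.stVec_effect_comp]

lemma mat_effect_eq_smul {A : C} {a b : A ⟶ 𝟙_ C} {p : ℝ}
    (h : ∀ ρ, O.stVec ρ a = p * O.stVec ρ b) : O.mat a = p • O.mat b := by
  ext ⟨ρ, s⟩
  rw [Pi.smul_apply, mat_effect, mat_effect, h, smul_eq_mul, mul_assoc]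

lemma stVec_of_mat_effect {A : C} {a b : A ⟶ 𝟙_ C} {p : ℝ} (h : O.mat a = p • O.mat b)
    (ρ : 𝟙_ C ⟶ A) : O.stVec ρ a = p * O.stVec ρ b := by
  have := congrFun h (ρ, 𝟙 _)
  rwa [Pi.smul_apply, mat_effect, mat_effect, prob_id, mul_one, mul_one] at this

lemma discriminates_iff {X : Type} [Finite X] [DecidableEq X] {A : C} {m : X → (A ⟶ 𝟙_ C)}
    {ρ : X → (𝟙_ C ⟶ A)} : O.Discriminates m ρ ↔
      O.IsTest m ∧ ∀ x y, O.stVec (ρ y) (m x) = if x = y then 1 else 0 := by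
  unfold Discriminates stVec
  refine and_congr_right fun _ => forall₂_congr fun x y => ?_
  split_ifs <;> rfl

namespace Principles

variable (H : O.Principles)
include H

lemma isPure_effect_elim {A : C} {b : A ⟶ 𝟙_ C} (hb : O.IsPure b) {a a' : A ⟶ 𝟙_ C}
    (ha : O.Coexist a a') (h : ∀ ρ, O.stVec ρ a + O.stVec ρ a' = O.stVec ρ b) :
    ∃ p : ℝ, ∀ ρ, O.stVec ρ a = p * O.stVec ρ b := by
  obtain ⟨p, -, hp⟩ := H.isPure_elim hb ha (by
    ext ⟨ρ, s⟩
    rw [Pi.add_apply, mat_effect, mat_effect, mat_effect, ← h, add_mul])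
  exact ⟨p, stVec_of_mat_effect hp⟩

lemma isPure_effect_intro {A : C} {b : A ⟶ 𝟙_ C} (h : ∀ a a', O.Coexist a a' →
    (∀ ρ, O.stVec ρ a + O.stVec ρ a' = O.stVec ρ b) →
    ∃ p : ℝ, ∀ ρ, O.stVec ρ a = p * O.stVec ρ b) : O.IsPure b := by
  refine H.isPure_intro fun a a' ha e => ?_
  obtain ⟨p, hp⟩ := h a a' ha fun ρ => by
    have := congrFun e (ρ, 𝟙 _)
    rwa [Pi.add_apply, mat_effect, mat_effect, mat_effect, prob_id, mul_one, mul_one,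
      mul_one] at this
  exact ⟨p, mat_effect_eq_smul hp⟩

lemma test_binary {A : C} {a b : A ⟶ 𝟙_ C} (h : O.IsTest ![a, b]) :
    ∀ ρ, O.stVec ρ b = O.stVec ρ (H.disc A) - O.stVec ρ a := fun ρ => by
  have := H.stVec_compl h ρ
  linarith

/-- A pure effect has probability one on at most one deterministic state. -/
lemma eq_of_pure_effect (hb : O.HasBit) {A : C} {b : A ⟶ 𝟙_ C} (hbp : O.IsPure b)
    {β γ : 𝟙_ C ⟶ A} (hβ : O.IsDet β) (hγ : O.IsDet γ) (h1 : O.stVec β b = 1)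
    (h2 : O.stVec γ b = 1) : β = γ := by
  obtain ⟨ω, hω⟩ := H.exists_mix_state (p := 1 / 2) (by norm_num) (by norm_num) β γ
  have hωd : O.IsDet ω := H.isDet_of_norm (by
    rw [hω, Pi.add_apply, Pi.smul_apply, Pi.smul_apply, H.norm_of_isDet hβ, H.norm_of_isDet hγ]
    norm_num)
  obtain ⟨b', hb'⟩ := H.exists_compl b
  obtain ⟨T, hT, hTm, hTid⟩ := H.exists_nondisturbing hb hb' hωd (by
    rw [Matrix.cons_val_zero, hω, Pi.add_apply, Pi.smul_apply, Pi.smul_apply, h1, h2]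
    norm_num)
  have hb0 : T 0 ≫ H.disc A = b := hTm 0
  have hrβ : O.Refines ω β := ⟨1 / 2, by norm_num, by
    rw [hω, add_sub_cancel_left]
    exact (inCone_stVec γ).smul (by norm_num)⟩
  have hrγ : O.Refines ω γ := ⟨1 / 2, by norm_num, by
    have : (1 / 2 : ℝ) • O.stVec β + (1 - 1 / 2 : ℝ) • O.stVec γ - (1 / 2 : ℝ) • O.stVec γ =
      (1 / 2 : ℝ) • O.stVec β := by norm_num
    rw [hω, this]
    exact (inCone_stVec β).smul (by norm_num)⟩
  refine H.state_ext ?_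
  ext m
  obtain ⟨m', hm'⟩ := H.exists_compl m
  -- Measuring `m` after the non-disturbing `T 0` refines `b`, hence is a multiple `p` of `b`. Since
  -- `T 0` fixes `β` and `γ`, both give `m` the probability `p`.
  obtain ⟨p, hp⟩ := H.isPure_effect_elim hbp
    (comp_coexist (coexist_binary hm') (T 0)) fun ρ => by
      rw [← stVec_comp, ← stVec_comp, H.stVec_compl hm', stVec_comp, hb0]
  have e1 := hp β
  have e2 := hp γ
  rw [← stVec_comp, hTid _ hrβ, h1] at e1
  rw [← stVec_comp, hTid _ hrγ, h2] at e2
  rw [e1, e2]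

/-- Every component of `β` must also give `b` probability one, and there is only one such state. -/
lemma isPure_of_pure_effect (hb : O.HasBit) {A : C} {b : A ⟶ 𝟙_ C} (hbp : O.IsPure b)
    {β : 𝟙_ C ⟶ A} (hβ : O.IsDet β) (h1 : O.stVec β b = 1) : O.IsPure β := by
  refine H.isPure_state_intro fun v w hv hw e => ?_
  obtain ⟨γ, hγ, hv'⟩ := H.exists_det_smul hv
  obtain ⟨δ, hδ, hw'⟩ := H.exists_det_smul hw
  have he := congrFun e (H.disc A)
  have he' := congrFun e b
  rw [Pi.add_apply, H.norm_of_isDet hβ] at he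
  rw [Pi.add_apply, h1] at he'
  have h0 := hv.nonneg (H.disc A)
  have h0' := hw.nonneg (H.disc A)
  generalize v (H.disc A) = r at hv' he h0
  generalize w (H.disc A) = t at hw' he h0'
  subst hv' hw'
  rcases h0.eq_or_lt with rfl | hr
  · exact ⟨0, by simp⟩
  · refine ⟨r, ?_⟩
    have h2 := stVec_le_one (O := O) γ b
    have h3 := stVec_le_one (O := O) δ b
    simp only [Pi.smul_apply, smul_eq_mul] at he'
    have h4 : O.stVec γ b = 1 := by
      by_contra hne
      have : O.stVec γ b < 1 := lt_of_le_of_ne h2 hne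
      nlinarith
    rw [H.eq_of_pure_effect hb hbp hγ hβ h4 h1]

/-! ### Perfectly distinguishable states -/

open Classical in
lemma exists_coarse_effect {X Z : Type} [Fintype X] [Fintype Z] {A : C} {T' : Z → (A ⟶ 𝟙_ C)}
    (hT' : O.IsTest T') (p : Z → X) : ∃ T : X → (A ⟶ 𝟙_ C), O.IsTest T ∧
      ∀ x ρ, O.stVec ρ (T x) = ∑ z, if p z = x then O.stVec ρ (T' z) else 0 := by
  obtain ⟨T, hT, hT2⟩ := H.exists_coarse hT' p
  refine ⟨T, hT, fun x ρ => ?_⟩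
  have := congrFun (hT2 x) (simpleContext ρ (𝟙 _))
  simp only [transfVec_simpleContext, Category.comp_id, Finset.sum_apply] at this
  rw [stVec_apply, this]
  refine Finset.sum_congr rfl fun z _ => ?_
  split_ifs
  · simp [transfVec_simpleContext, stVec]
  · rfl

lemma isDet_of_discriminates {X : Type} [Finite X] {A : C} {m : X → (A ⟶ 𝟙_ C)}
    {ρ : X → (𝟙_ C ⟶ A)} (h : O.Discriminates m ρ) (x : X) : O.IsDet (ρ x) := by
  have h1 := h.2 x x
  rw [if_pos rfl] at h1
  have := H.stVec_le_disc (m x) (ρ x)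
  rw [stVec_apply, h1] at this
  exact H.isDet_of_norm (le_antisymm (stVec_le_one _ _) this)

lemma pd_reindex {X Y : Type} [Finite X] [Finite Y] {A : C} {α : X → (𝟙_ C ⟶ A)}
    (h : O.PerfectlyDistinguishable α) (e : Y ≃ X) : O.PerfectlyDistinguishable (α ∘ e) := by
  classical
  obtain ⟨m, hm⟩ := h
  rw [discriminates_iff] at hm
  refine ⟨m ∘ e, discriminates_iff.2 ⟨H.isTest_reindex hm.1 e, fun x y => ?_⟩⟩
  simp [hm.2]

lemma pd_single {X : Type} [Finite X] [Unique X] {A : C} {α : X → (𝟙_ C ⟶ A)}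
    (h : ∀ x, O.IsDet (α x)) : O.PerfectlyDistinguishable α := by
  classical
  refine ⟨_, discriminates_iff.2 ⟨H.isTest_reindex (H.isDet_disc A) (Equiv.ofUnique X Unit),
    fun x y => ?_⟩⟩
  rw [if_pos (Subsingleton.elim x y)]
  exact H.norm_of_isDet (h y)

omit H in
-- Discriminating effects are dual to the states, so the states are linearly independent. This bound
-- makes the greedy extensions terminate.
lemma card_le_finrank (hfin : O.FiniteDimensionality) {X : Type} [Finite X] {A : C}
    {α : X → (𝟙_ C ⟶ A)} (h : O.PerfectlyDistinguishable α) :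
    Nat.card X ≤ Module.finrank ℝ (O.StR A) := by
  classical
  have := hfin A
  have := Fintype.ofFinite X
  obtain ⟨m, hm⟩ := h
  rw [discriminates_iff] at hm
  have hli : LinearIndependent ℝ (fun x => (⟨O.stVec (α x), stVec_mem _⟩ : O.StR A)) := by
    rw [Fintype.linearIndependent_iff]
    intro c hc x
    have := congrFun (congrArg Subtype.val hc) (m x)
    simpa [hm.2] using this
  rw [Nat.card_eq_fintype_card]
  exact hli.fintype_card_le_finrank

omit H in
lemma nonempty_of_pd {X : Type} [Finite X] {A : C} {α : X → (𝟙_ C ⟶ A)}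
    (H : O.Principles) (h : O.PerfectlyDistinguishable α) : Nonempty X := by
  by_contra hX
  rw [not_nonempty_iff] at hX
  have := Fintype.ofFinite X
  obtain ⟨m, hm⟩ := h
  obtain ⟨ρ, hρ⟩ := H.exists_isDet_state A
  have := H.sum_stVec hm.1 ρ
  rw [H.norm_of_isDet hρ] at this
  simp at this

/-- The barycenter of finitely many deterministic states. -/
lemma exists_barycenter {X : Type} [Fintype X] [Nonempty X] {A : C} {α : X → (𝟙_ C ⟶ A)}
    (h : ∀ x, O.IsDet (α x)) : ∃ ω : 𝟙_ C ⟶ A, O.IsDet ω ∧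
      (Fintype.card X : ℝ) • O.stVec ω = ∑ x, O.stVec (α x) := by
  obtain ⟨ω, hω, h2⟩ := H.exists_det_smul
    (H.inCone_sum Finset.univ fun x _ => inCone_stVec (O := O) (α x))
  refine ⟨ω, hω, ?_⟩
  rw [h2]
  congr 1
  simp [fun x => H.norm_of_isDet (h x)]

/-- A family of perfectly distinguishable states can be enlarged by a state that is perfectly
distinguishable from all of them. -/
lemma pd_adjoin (hb : O.HasBit) {X : Type} [Finite X] {A : C} {α : X → (𝟙_ C ⟶ A)}
    (hα : IsEmpty X ∨ O.PerfectlyDistinguishable α) {σ : 𝟙_ C ⟶ A} {m : Fin 2 → (A ⟶ 𝟙_ C)}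
    (hm : O.IsTest m) (h0 : ∀ x, O.stVec (α x) (m 0) = 1) (h1 : O.stVec σ (m 1) = 1) :
    O.PerfectlyDistinguishable (fun o : Option X => o.elim σ α) := by
  classical
  have := Fintype.ofFinite X
  have hσ : O.IsDet σ := H.isDet_of_norm
    (le_antisymm (stVec_le_one _ _) (h1.symm.trans_le (H.stVec_le_disc _ _)))
  rcases hα with hX | hα
  · refine H.pd_single fun x => ?_
    cases x with
    | none => exact hσ
    | some x => exact hX.elim x
  have hne := nonempty_of_pd H hα
  obtain ⟨a, ha⟩ := hα
  have hd := H.isDet_of_discriminates ha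
  rw [discriminates_iff] at ha
  obtain ⟨ω, hω, hωs⟩ := H.exists_barycenter hd
  have hcard : (0 : ℝ) < Fintype.card X := by exact_mod_cast Fintype.card_pos
  have hω0 : O.stVec ω (m 0) = 1 := by
    have := congrFun hωs (m 0)
    simp only [Pi.smul_apply, Finset.sum_apply, h0, smul_eq_mul, Finset.sum_const,
      Finset.card_univ, nsmul_eq_mul, mul_one] at this
    exact mul_left_cancel₀ hcard.ne' (this.trans (mul_one _).symm)
  obtain ⟨T, hT, hTm, hTid⟩ := H.exists_nondisturbing hb hm hω hω0
  have hTα : ∀ x, α x ≫ T 0 = α x := fun x => hTid _ ⟨(Fintype.card X : ℝ)⁻¹, by positivity, by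
    have : O.stVec ω - (Fintype.card X : ℝ)⁻¹ • O.stVec (α x) =
        (Fintype.card X : ℝ)⁻¹ • ∑ y ∈ Finset.univ.erase x, O.stVec (α y) := by
      have e : O.stVec ω = (Fintype.card X : ℝ)⁻¹ • ∑ x, O.stVec (α x) := by
        rw [← hωs, inv_smul_smul₀ hcard.ne']
      rw [e, ← Finset.add_sum_erase _ _ (Finset.mem_univ x), smul_add, add_sub_cancel_left]
    rw [this]
    exact (H.inCone_sum _ fun y _ => inCone_stVec _).smul (by positivity)⟩
  -- On outcome 0 of the non-disturbing measurement the states `α x` are intact and can still be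
  -- discriminated by `a`; outcome 1 announces `σ`.
  obtain ⟨c, hc, hcs⟩ := H.exists_coarse_effect (O.isTest_comp T a hT ha.1)
    (fun z => if z.1 = 0 then some z.2 else none)
  have hsome : ∀ x ρ, O.stVec ρ (c (some x)) = O.stVec (ρ ≫ T 0) (a x) := fun x ρ => by
    rw [hcs, Fintype.sum_prod_type]
    simp [stVec_comp]
  have hnone : ∀ ρ, O.stVec ρ (c none) = O.stVec ρ (m 1) := fun ρ => by
    rw [hcs, Fintype.sum_prod_type]
    simp only [Fin.sum_univ_two, if_true, reduceCtorEq, if_false, Finset.sum_const_zero, zero_add,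
      one_ne_zero, ← stVec_comp]
    rw [H.sum_stVec ha.1, stVec_comp, hTm]
  have hm01 : ∀ ρ, O.stVec ρ (m 0) + O.stVec ρ (m 1) = O.stVec ρ (H.disc A) := fun ρ => by
    rw [← H.sum_stVec hm ρ, Fin.sum_univ_two]
  have hσ0 : O.stVec σ (m 0) = 0 := by
    have := hm01 σ
    rw [h1, H.norm_of_isDet hσ] at this
    linarith
  refine ⟨c, discriminates_iff.2 ⟨hc, fun x y => ?_⟩⟩
  cases x with
  | none =>
    rw [hnone]
    cases y with
    | none => simpa using h1
    | some y =>
      have := hm01 (α y)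
      rw [h0, H.norm_of_isDet (hd y)] at this
      simp only [Option.elim_some, reduceCtorEq, if_false]
      linarith
  | some x =>
    rw [hsome]
    cases y with
    | none =>
      have h3 := H.stVec_le_disc (a x) (σ ≫ T 0)
      rw [stVec_comp σ (T 0) (H.disc A), hTm, hσ0] at h3
      simpa using le_antisymm h3 (stVec_nonneg _ _)
    | some y => simp [hTα, ha.2]

lemma isDet_of_pd {X : Type} [Finite X] {A : C} {α : X → (𝟙_ C ⟶ A)}
    (h : O.PerfectlyDistinguishable α) (x : X) : O.IsDet (α x) := by
  obtain ⟨m, hm⟩ := h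
  exact H.isDet_of_discriminates hm x

/-- A perfectly distinguishable family of pure states that is not maximal can be enlarged by a
pure state. -/
lemma exists_pure_adjoin (hb : O.HasBit) {X : Type} [Finite X] {A : C} {α : X → (𝟙_ C ⟶ A)}
    (hα : IsEmpty X ∨ O.PerfectlyDistinguishable α) (hp : ∀ x, O.IsPure (α x)) :
    O.IsPureMaximal α ∨ ∃ σ : 𝟙_ C ⟶ A, O.IsPure σ ∧
      O.PerfectlyDistinguishable (fun o : Option X => o.elim σ α) := by
  classical
  rcases hα with hX | hα
  · obtain ⟨σ, hσ, hσp⟩ := H.exists_pure_det A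
    refine Or.inr ⟨σ, hσp, H.pd_single fun o => ?_⟩
    cases o with
    | none => exact hσ
    | some x => exact hX.elim x
  refine or_iff_not_imp_left.2 fun hmax => ?_
  have : ∃ (Y : Type) (_ : Finite Y) (σ : Y → (𝟙_ C ⟶ A)), O.PerfectlyDistinguishable σ ∧
      Set.range α ⊆ Set.range σ ∧ Set.range σ ≠ Set.range α := by
    by_contra hcon
    push Not at hcon
    exact hmax ⟨hp, hα, fun Y hY σ h1 h2 => hcon Y hY σ h1 h2⟩
  obtain ⟨Y, _, σ, hσ, hsub, hne⟩ := this
  obtain ⟨y₀, hy₀⟩ : ∃ y, σ y ∉ Set.range α := by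
    by_contra hcon
    push Not at hcon
    exact hne (Set.Subset.antisymm (by rintro _ ⟨y, rfl⟩; exact hcon y) hsub)
  have hd := H.isDet_of_pd hσ
  obtain ⟨m, hm⟩ := hσ
  rw [discriminates_iff] at hm
  -- The additional state `σ y₀` need not be pure, but since `m y₀` attains probability one on it,
  -- it also does so on some pure state.
  obtain ⟨γ, hγ, hγp, hmaxγ⟩ := H.exists_pure_max (m y₀)
  obtain ⟨g, hg⟩ := H.exists_binary hm.1 y₀
  refine ⟨γ, hγp, H.pd_adjoin hb (Or.inr hα) (H.isTest_swap hg) (fun x => ?_) ?_⟩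
  · obtain ⟨y, hy⟩ := hsub ⟨x, rfl⟩
    have hne' : y₀ ≠ y := by
      rintro rfl
      exact hy₀ ⟨x, hy.symm⟩
    rw [Matrix.cons_val_zero, H.test_binary hg, ← hy, hm.2, if_neg hne', H.norm_of_isDet (hd y),
      sub_zero]
  · refine le_antisymm (stVec_le_one _ _) ?_
    have := hmaxγ _ (hd y₀)
    rw [hm.2, if_pos rfl] at this
    exact this

/-- Perfectly distinguishable pure states belong to a pure maximal set. -/
lemma exists_isPureMaximal_extension (hb : O.HasBit) {X : Type} [Finite X] {A : C}
    {α : X → (𝟙_ C ⟶ A)} (hα : IsEmpty X ∨ O.PerfectlyDistinguishable α)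
    (hp : ∀ x, O.IsPure (α x)) : ∃ (n : ℕ) (α' : Fin n → (𝟙_ C ⟶ A)), O.IsPureMaximal α' ∧
      ∃ ι : X → Fin n, ∀ x, α' (ι x) = α x := by
  classical
  have hcard : ∀ (Y : Type) [Finite Y] (β : Y → (𝟙_ C ⟶ A)),
      O.PerfectlyDistinguishable β → Nat.card Y ≤ Module.finrank ℝ (O.StR A) :=
    fun Y _ β h => card_le_finrank H.fin h
  obtain ⟨k, hk⟩ : ∃ k, Module.finrank ℝ (O.StR A) - Nat.card X = k := ⟨_, rfl⟩
  induction k using Nat.strong_induction_on generalizing X with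
  | _ k ih =>
  rcases H.exists_pure_adjoin hb hα hp with hmax | ⟨σ, hσ, hpd⟩
  · let e := Finite.equivFin X
    refine ⟨Nat.card X, α ∘ e.symm, ⟨fun x => hp _, H.pd_reindex hmax.2.1 e.symm, ?_⟩, e,
      fun x => by simp⟩
    intro Y _ τ h1 h2
    rw [EquivLike.range_comp] at h2 ⊢
    exact hmax.2.2 Y τ h1 h2
  · have h1 := hcard _ _ hpd
    rw [Finite.card_option] at h1
    obtain ⟨n, α', hα', ι, hι⟩ := ih _ (by rw [Finite.card_option]; omega)
      (X := Option X) (Or.inr hpd) (fun o => by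
        cases o with
        | none => exact hσ
        | some x => exact hp x) rfl
    exact ⟨n, α', hα', fun x => ι (some x), fun x => hι (some x)⟩

omit H in
-- The effect detecting an additional state would vanish on all `α x`, hence on `χ`; but no effect
-- that is positive on some state vanishes on a faithful state.
lemma isPureMaximal_of_faithful {X : Type} [Fintype X] {A : C} {α : X → (𝟙_ C ⟶ A)}
    (hp : ∀ x, O.IsPure (α x)) (hpd : O.PerfectlyDistinguishable α) {χ : 𝟙_ C ⟶ A}
    (hχ : O.Faithful χ) (c : X → ℝ) (h : O.stVec χ = ∑ x, c x • O.stVec (α x)) :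
    O.IsPureMaximal α := by
  classical
  refine ⟨hp, hpd, fun Y _ σ hσ hsub => Set.Subset.antisymm ?_ hsub⟩
  rintro _ ⟨y₀, rfl⟩
  by_contra hy₀
  obtain ⟨m, hm⟩ := hσ
  rw [discriminates_iff] at hm
  have h0 : ∀ x, O.stVec (α x) (m y₀) = 0 := fun x => by
    obtain ⟨y, hy⟩ := hsub ⟨x, rfl⟩
    rw [← hy, hm.2, if_neg]
    rintro rfl
    exact hy₀ ⟨x, hy.symm⟩
  have hχ0 : O.stVec χ (m y₀) = 0 := by
    rw [h]
    simp [h0]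
  obtain ⟨r, hr, hcone⟩ := hχ (σ y₀)
  have := hcone.nonneg (m y₀)
  rw [Pi.sub_apply, hχ0, Pi.smul_apply, hm.2, if_pos rfl, smul_eq_mul] at this
  linarith

omit H in
lemma faithful_of_isInternal {A : C} {ω : 𝟙_ C ⟶ A} (h : O.IsInternal ω) : O.Faithful ω := by
  intro σ
  obtain ⟨r, g, k, hr, hg, hω, -⟩ := h σ
  refine ⟨r, hr, ?_⟩
  have h1 : O.stVec g = r • O.stVec σ := by
    simpa using stVec_of_transfVec ![r] ![σ] (σ := g) (by simpa using hg)
  have h2 : O.stVec ω = O.stVec g + O.stVec k := by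
    simpa using stVec_of_transfVec ![1, 1] ![g, k] (σ := ω) (by simpa using hω)
  rw [h2, h1, add_sub_cancel_left]
  exact inCone_stVec k

lemma isNormalized_of_isDet {A : C} {ω : 𝟙_ C ⟶ A} (h : O.IsDet ω) : O.IsNormalized ω := by
  refine le_antisymm (csSup_le ⟨_, H.disc A, rfl⟩ ?_) (le_csSup ⟨1, ?_⟩ ⟨H.disc A, H.norm_of_isDet h⟩)
  · rintro _ ⟨a, rfl⟩
    exact O.prob_le_one _
  · rintro _ ⟨a, rfl⟩
    exact O.prob_le_one _

/-- The barycenter of a pure maximal set is faithful. -/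
lemma faithful_barycenter (hb : O.HasBit) {X : Type} [Fintype X] {A : C} {α : X → (𝟙_ C ⟶ A)}
    (hα : O.IsPureMaximal α) {ω : 𝟙_ C ⟶ A} (hω : O.IsDet ω)
    (h : (Fintype.card X : ℝ) • O.stVec ω = ∑ x, O.stVec (α x)) : O.Faithful ω := by
  by_contra hf
  -- A state distinguishable from the barycenter is distinguishable from each of its components, so
  -- it could be adjoined to the maximal set.
  obtain ⟨σ, m, hm, hmd⟩ := H.pdisc A ω (H.isNormalized_of_isDet hω)
    (fun hint => hf (faithful_of_isInternal hint))
  have h10 : O.stVec ω (m 1) = 0 := by simpa [stVec] using hmd 1 0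
  have h11 : O.stVec σ (m 1) = 1 := by simpa [stVec] using hmd 1 1
  have hα1 : ∀ x, O.stVec (α x) (m 1) = 0 := fun x => by
    have h2 := congrFun h (m 1)
    rw [Pi.smul_apply, h10, smul_zero, Finset.sum_apply] at h2
    exact (Finset.sum_eq_zero_iff_of_nonneg fun x _ => stVec_nonneg _ _).1 h2.symm x
      (Finset.mem_univ x)
  have hpd := H.pd_adjoin hb (Or.inr hα.2.1) hm (fun x => by
    have h3 := H.sum_stVec hm (α x)
    rw [Fin.sum_univ_two, hα1, add_zero, H.norm_of_isDet (H.isDet_of_pd hα.2.1 x)] at h3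
    exact h3) h11
  have := hα.2.2 _ _ hpd (by
    rintro _ ⟨x, rfl⟩
    exact ⟨some x, rfl⟩)
  obtain ⟨x, hx⟩ : σ ∈ Set.range α := this ▸ ⟨none, rfl⟩
  rw [← hx, hα1] at h11
  exact zero_ne_one h11

/-! ### Pure effects -/

/-- An effect is pure if it prepares remotely a multiple of a pure state. -/
lemma isPure_effect_of_cond (hb : O.HasBit) {A B : C} {Φ : 𝟙_ C ⟶ A ⊗ B} (hΦ : O.IsPure Φ)
    (hf : O.Faithful (cond (swap Φ) (H.disc A))) {b : B ⟶ 𝟙_ C} (h : O.IsPure (cond Φ b)) :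
    O.IsPure b := by
  refine H.isPure_effect_intro fun a a' _ e => ?_
  obtain ⟨p, hp⟩ := H.isPure_state_elim h zero_le_one (inCone_stVec (cond Φ a))
    (inCone_stVec (cond Φ a')) (by
      ext x
      rw [Pi.add_apply, one_smul, ← stVec_cond_swap Φ, ← stVec_cond_swap Φ, ← stVec_cond_swap Φ, e])
  refine ⟨p, fun σ => ?_⟩
  obtain ⟨r, c, hr, hc⟩ := H.exists_steering_faithful hb (H.isPure_swap hΦ) (Ψ := swap Φ)
    (by exact hf) σ
  have h1 := congrFun hp c
  rw [Pi.smul_apply, ← stVec_cond_swap Φ, ← stVec_cond_swap Φ, hc] at h1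
  simp only [Pi.smul_apply, smul_eq_mul, mul_one] at h1
  refine mul_left_cancel₀ hr.ne' (h1.trans (by ring))

lemma isPure_stVec_smul {A : C} {α σ : 𝟙_ C ⟶ A} (h : O.IsPure σ) {t : ℝ} (ht : 0 < t)
    (e : O.stVec σ = t • O.stVec α) : O.IsPure α :=
  H.isPure_of_smul h (t := t⁻¹) (by positivity) (by rw [e, inv_smul_smul₀ ht.ne'])

/-- The effects that discriminate the states of a pure maximal set are pure. -/
lemma isPure_of_discriminates (hb : O.HasBit) {X : Type} [Finite X] {A : C}
    {α : X → (𝟙_ C ⟶ A)} (hα : O.IsPureMaximal α) {a : X → (A ⟶ 𝟙_ C)}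
    (ha : O.Discriminates a α) (x : X) : O.IsPure (a x) := by
  classical
  have := Fintype.ofFinite X
  have hne := nonempty_of_pd H hα.2.1
  have hd := H.isDet_of_pd hα.2.1
  rw [discriminates_iff] at ha
  obtain ⟨ω, hω, hωs⟩ := H.exists_barycenter hd
  have hfω := H.faithful_barycenter hb hα hω hωs
  have hcard : (0 : ℝ) < Fintype.card X := by exact_mod_cast Fintype.card_pos
  set d : ℝ := (Fintype.card X : ℝ)
  obtain ⟨B, Ψ, hΨ, hΨω, hfB⟩ := H.exists_faithful_purification hω
  have hωe : O.stVec ω = d⁻¹ • ∑ x, O.stVec (α x) := by rw [← hωs, inv_smul_smul₀ hcard.ne']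
  -- The weight of `α x` in the barycenter is `1 / d`. The effect `b` preparing it is pure because
  -- `α x` is; below, the state prepared by `a x` is certain for `b`, hence pure, and so `a x` is
  -- pure.
  obtain ⟨b, hbx⟩ := H.exists_steering_smul hb hΨ (t := d⁻¹) (by positivity) (σ := α x) (by
    rw [hΨω, hωe, ← Finset.add_sum_erase _ _ (Finset.mem_univ x), smul_add, add_sub_cancel_left]
    exact (H.inCone_sum _ fun y _ => inCone_stVec _).smul (by positivity))
  have hbp : O.IsPure b := H.isPure_effect_of_cond hb hΨ hfB
    (H.isPure_of_smul (hα.1 x) (by positivity) hbx)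
  have hax : O.stVec ω (a x) = d⁻¹ := by
    rw [hωe]
    simp [ha.2]
  obtain ⟨β, hβ, hβs⟩ := H.exists_det_smul (inCone_stVec (O := O) (cond (swap Ψ) (a x)))
  rw [stVec_cond_swap, hΨω, hax] at hβs
  have hβb : O.stVec β b = 1 := by
    have := congrFun hβs b
    rw [stVec_cond_swap, hbx, Pi.smul_apply, Pi.smul_apply, ha.2, if_pos rfl] at this
    exact (smul_right_injective ℝ (inv_ne_zero hcard.ne') this).symm
  have hβp := H.isPure_of_pure_effect hb hbp hβ hβb
  refine H.isPure_effect_of_cond hb (H.isPure_swap hΨ) ?_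
    (H.isPure_of_smul hβp (by positivity) hβs)
  rwa [swap_swap, hΨω]

/-- For every pure state there is a pure effect that has probability one on it. -/
lemma exists_pure_effect (hb : O.HasBit) {A : C} {α : 𝟙_ C ⟶ A} (hα : O.IsPure α)
    (hd : O.IsDet α) : ∃ a : A ⟶ 𝟙_ C, O.IsPure a ∧ O.stVec α a = 1 := by
  obtain ⟨n, α', hmax, ι, hι⟩ := H.exists_isPureMaximal_extension hb (X := Unit)
    (α := fun _ => α) (Or.inr (H.pd_single fun _ => hd)) (fun _ => hα)
  obtain ⟨m, hm⟩ := hmax.2.1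
  refine ⟨m (ι ()), H.isPure_of_discriminates hb hmax hm _, ?_⟩
  rw [← hι (), stVec_apply, hm.2, if_pos rfl]

end Principles

/-! ### Balanced states and the cardinality of pure maximal sets -/

lemma InCone.comp {A B : C} {v : (A ⟶ 𝟙_ C) → ℝ} (hv : O.InCone v) (f : A ⟶ B) :
    O.InCone (fun m => v (f ≫ m)) := by
  obtain ⟨r, ρ, hr, rfl⟩ := hv
  refine ⟨r, ρ ≫ f, hr, ?_⟩
  ext m
  simp [stVec_comp]

/-- The deterministic state `χ` is faithful, it contains every pure state with the same weight `p`,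
and every pure effect that has probability one on some deterministic state has probability `p`
on `χ`. -/
structure Balanced (O : OPT C) {A : C} (χ : 𝟙_ C ⟶ A) (p : ℝ) : Prop where
  det : O.IsDet χ
  faithful : O.Faithful χ
  pos : 0 < p
  below : ∀ α : 𝟙_ C ⟶ A, O.IsDet α → O.IsPure α → O.InCone (O.stVec χ - p • O.stVec α)
  le : ∀ α : 𝟙_ C ⟶ A, O.IsDet α → O.IsPure α → ∀ t : ℝ,
    O.InCone (O.stVec χ - t • O.stVec α) → t ≤ p
  effect : ∀ a : A ⟶ 𝟙_ C, O.IsPure a → ∀ α : 𝟙_ C ⟶ A, O.IsDet α → O.stVec α a = 1 →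
    O.stVec χ a = p

namespace Principles

variable (H : O.Principles)
include H

/-- The reversible transformations act transitively on the pure states. -/
lemma exists_iso_of_isPure {A : C} {α β : 𝟙_ C ⟶ A} (hα : O.IsDet α) (hαp : O.IsPure α)
    (hβ : O.IsDet β) (hβp : O.IsPure β) : ∃ U : A ≅ A, β = α ≫ U.hom := by
  have h : ∀ γ : 𝟙_ C ⟶ A, O.IsDet γ → cond (γ ≫ (λ_ A).inv) (H.disc A) = 𝟙 _ := fun γ hγ => by
    have h1 := H.det_state_disc hγ
    simp only [cond, id_whiskerLeft, Category.assoc, Iso.inv_hom_id_assoc, ← unitors_equal,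
      Iso.inv_hom_id, Category.comp_id, h1]
  -- Normalized pure states of `A` are purifications, with purifying system `A`, of the
  -- deterministic state of the unit.
  obtain ⟨U, hU⟩ := H.exists_iso_of_purifications (H.isPure_comp_iso hαp (λ_ A).symm)
    (H.isPure_comp_iso hβp (λ_ A).symm) ((h α hα).trans (h β hβ).symm)
  refine ⟨U, (cancel_mono (λ_ A).inv).1 ?_⟩
  simpa using hU

lemma stVec_cond_compl {A B : C} (Ψ : 𝟙_ C ⟶ A ⊗ B) {b b' : B ⟶ 𝟙_ C} (h : O.IsTest ![b, b']) :
    O.stVec (cond Ψ b) + O.stVec (cond Ψ b') = O.stVec (cond Ψ (H.disc B)) := by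
  ext a
  rw [Pi.add_apply, ← stVec_cond_swap Ψ, ← stVec_cond_swap Ψ, ← stVec_cond_swap Ψ,
    H.stVec_compl h]

/-- A deterministic state contains a pure state with a weight that is at least the probability
of a given pure effect. -/
lemma exists_pure_below (hb : O.HasBit) {A : C} {a : A ⟶ 𝟙_ C} (ha : O.IsPure a)
    (ρ : 𝟙_ C ⟶ A) : ∃ (α : 𝟙_ C ⟶ A) (q : ℝ), O.IsDet α ∧ O.IsPure α ∧
      O.stVec ρ a ≤ q ∧ O.InCone (O.stVec ρ - q • O.stVec α) := by
  rcases (stVec_nonneg (O := O) ρ a).eq_or_lt with h0 | h0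
  · obtain ⟨α, hα, hαp⟩ := H.exists_pure_det A
    exact ⟨α, 0, hα, hαp, h0.ge, by simpa using inCone_stVec ρ⟩
  obtain ⟨E, Ψ, hΨ, rfl⟩ := H.exists_purification ρ
  obtain ⟨β, hβ, hβs⟩ := H.exists_det_smul (inCone_stVec (O := O) (cond (swap Ψ) a))
  rw [stVec_cond_swap] at hβs
  have hβp : O.IsPure β :=
    H.isPure_stVec_smul (H.isPure_cond hb (H.isPure_swap hΨ) ha) h0 hβs
  obtain ⟨b, hbp, hbβ⟩ := H.exists_pure_effect hb hβp hβ
  obtain ⟨α, hα, hαs⟩ := H.exists_det_smul (inCone_stVec (O := O) (cond Ψ b))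
  -- `b` is certain on the state prepared by `a`, so the joint probability of `a` and `b` is that of
  -- `a` alone. It is at most the probability of `b`, which is the weight of `α`.
  have h1 : O.stVec (cond Ψ b) a = O.stVec (cond Ψ (H.disc E)) a := by
    rw [← stVec_cond_swap, hβs, Pi.smul_apply, hbβ, smul_eq_mul, mul_one]
  have h2 := H.stVec_le_disc a (cond Ψ b)
  rw [h1] at h2
  refine ⟨α, _, hα, H.isPure_stVec_smul (H.isPure_cond hb hΨ hbp) (h0.trans_le h2) hαs, h2, ?_⟩
  obtain ⟨b', hb'⟩ := H.exists_compl b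
  rw [← hαs, ← H.stVec_cond_compl Ψ hb', add_sub_cancel_left]
  exact inCone_stVec _

/-- In an invariant state all pure states have the same largest weight, because reversible
transformations fix the state and permute the pure states transitively. -/
lemma exists_weight (A : C) : ∃ (χ : 𝟙_ C ⟶ A) (p : ℝ), O.IsDet χ ∧
    (∀ α : 𝟙_ C ⟶ A, O.IsDet α → O.IsPure α → O.InCone (O.stVec χ - p • O.stVec α)) ∧
    ∀ α : 𝟙_ C ⟶ A, O.IsDet α → O.IsPure α → ∀ t : ℝ,
      O.InCone (O.stVec χ - t • O.stVec α) → t ≤ p := by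
  obtain ⟨χ, hχ, hinv⟩ := H.exists_invariant A
  obtain ⟨α₀, hα₀, hα₀p⟩ := H.exists_pure_det A
  let S : Set ℝ := {t | O.InCone (O.stVec χ - t • O.stVec α₀)}
  have hS1 : ∀ t ∈ S, t ≤ 1 := fun t ht => by
    have := InCone.nonneg ht (H.disc A)
    rw [Pi.sub_apply, Pi.smul_apply, H.norm_of_isDet hχ, H.norm_of_isDet hα₀, smul_eq_mul] at this
    linarith
  have hbdd : BddAbove S := ⟨1, hS1⟩
  have hclosed : IsClosed S := by
    rw [← isSeqClosed_iff_isClosed]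
    intro t s ht hts
    refine H.inCone_of_tendsto ht fun m => ?_
    exact tendsto_const_nhds.sub (hts.mul_const _)
  have hne : S.Nonempty := ⟨0, by simpa [S] using inCone_stVec χ⟩
  have hp : sSup S ∈ S := hclosed.csSup_mem hne hbdd
  have hmove : ∀ {α β : 𝟙_ C ⟶ A} (U : A ≅ A), β = α ≫ U.hom → ∀ t : ℝ,
      O.InCone (O.stVec χ - t • O.stVec α) → O.InCone (O.stVec χ - t • O.stVec β) := by
    intro α β U hU t ht
    convert ht.comp U.hom using 1
    ext m
    rw [Pi.sub_apply, Pi.sub_apply, Pi.smul_apply, Pi.smul_apply, hU, stVec_comp,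
      ← stVec_comp χ, hinv]
  refine ⟨χ, sSup S, hχ, fun α hα hαp => ?_, fun α hα hαp t ht => ?_⟩
  · obtain ⟨U, hU⟩ := H.exists_iso_of_isPure hα₀ hα₀p hα hαp
    exact hmove U hU _ hp
  · obtain ⟨U, hU⟩ := H.exists_iso_of_isPure hα hαp hα₀ hα₀p
    exact le_csSup hbdd (hmove U hU _ ht)

lemma exists_pureMaximal (hb : O.HasBit) (A : C) :
    ∃ (n : ℕ) (α : Fin n → (𝟙_ C ⟶ A)), O.IsPureMaximal α := by
  obtain ⟨n, α, h, -⟩ := H.exists_isPureMaximal_extension hb (X := Empty) (A := A)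
    (α := fun x => x.elim) (Or.inl inferInstance) (fun x => x.elim)
  exact ⟨n, α, h⟩

/-- Every system has a balanced state. -/
lemma exists_balanced (hb : O.HasBit) (A : C) : ∃ (χ : 𝟙_ C ⟶ A) (p : ℝ), O.Balanced χ p := by
  obtain ⟨χ, p, hχ, hbelow, hle⟩ := H.exists_weight A
  have hub : ∀ a : A ⟶ 𝟙_ C, O.IsPure a → O.stVec χ a ≤ p := fun a ha => by
    obtain ⟨α, q, hα, hαp, hq, hcone⟩ := H.exists_pure_below hb ha χ
    exact hq.trans (hle α hα hαp q hcone)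
  obtain ⟨n, α, hα⟩ := H.exists_pureMaximal hb A
  have hne := nonempty_of_pd H hα.2.1
  have hd := H.isDet_of_pd hα.2.1
  have hp : 0 < p := by
    obtain ⟨a, ha⟩ := hα.2.1
    by_contra hp
    have := H.sum_stVec ha.1 χ
    rw [H.norm_of_isDet hχ] at this
    have h2 : ∑ x, O.stVec χ (a x) ≤ 0 := Finset.sum_nonpos fun x _ =>
      (hub _ (H.isPure_of_discriminates hb hα ha x)).trans (not_lt.1 hp)
    linarith
  refine ⟨χ, p, hχ, fun σ => ?_, hp, hbelow, hle, fun a ha γ hγ h1 => ?_⟩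
  · obtain ⟨ω, hω, hωs⟩ := H.exists_barycenter hd
    obtain ⟨r, hr, hcone⟩ := H.faithful_barycenter hb hα hω hωs σ
    have hn : (0 : ℝ) < Fintype.card (Fin n) := by exact_mod_cast Fintype.card_pos
    -- Averaging the bounds for the `α x`: `χ` dominates `p` times the faithful barycenter, hence is
    -- itself faithful.
    have h1 : O.InCone (O.stVec χ - p • O.stVec ω) := by
      have h2 := (H.inCone_sum Finset.univ fun x _ =>
        hbelow (α x) (hd x) (hα.1 x)).smul (inv_nonneg.2 hn.le)
      rw [Finset.sum_sub_distrib, ← Finset.smul_sum, ← hωs, Finset.sum_const, Finset.card_univ,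
        ← Nat.cast_smul_eq_nsmul ℝ, smul_comm p, ← smul_sub, inv_smul_smul₀ hn.ne'] at h2
      exact h2
    refine ⟨p * r, by positivity, ?_⟩
    convert H.inCone_add h1 (hcone.smul hp.le) using 1
    rw [smul_sub, mul_smul]
    abel
  · refine le_antisymm (hub a ha) ?_
    have := (hbelow γ hγ (H.isPure_of_pure_effect hb ha hγ h1)).nonneg a
    rw [Pi.sub_apply, Pi.smul_apply, h1, smul_eq_mul, mul_one] at this
    linarith

/-- The weight of the pure states in a balanced state determines the cardinality of the pure
maximal sets. -/
lemma card_mul_of_balanced (hb : O.HasBit) {A : C} {χ : 𝟙_ C ⟶ A} {p : ℝ} (hχ : O.Balanced χ p)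
    {X : Type} [Finite X] {α : X → (𝟙_ C ⟶ A)} (hα : O.IsPureMaximal α) :
    (Nat.card X : ℝ) * p = 1 := by
  have := Fintype.ofFinite X
  have hd := H.isDet_of_pd hα.2.1
  obtain ⟨a, ha⟩ := hα.2.1
  have h1 := H.sum_stVec ha.1 χ
  rw [H.norm_of_isDet hχ.det, Finset.sum_congr rfl fun x _ => hχ.effect (a x)
    (H.isPure_of_discriminates hb hα ha x) (α x) (hd x) (by
      rw [stVec_apply, ha.2, if_pos rfl])] at h1
  simpa [Nat.card_eq_fintype_card] using h1

lemma card_eq_card (hb : O.HasBit) {A : C} {X Y : Type} [Finite X] [Finite Y]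
    {α : X → (𝟙_ C ⟶ A)} (hα : O.IsPureMaximal α) {β : Y → (𝟙_ C ⟶ A)} (hβ : O.IsPureMaximal β) :
    Nat.card X = Nat.card Y := by
  obtain ⟨χ, p, hχ⟩ := H.exists_balanced hb A
  have h1 := H.card_mul_of_balanced hb hχ hα
  rw [← H.card_mul_of_balanced hb hχ hβ] at h1
  exact_mod_cast mul_right_cancel₀ hχ.pos.ne' h1

/-! ### Uniqueness of the effect that identifies a pure state -/

/-- Effects are determined by the states that they prepare remotely. -/
lemma stVec_of_cond_swap (hb : O.HasBit) {A B : C} {Φ : 𝟙_ C ⟶ A ⊗ B} (hΦ : O.IsPure Φ)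
    (hf : O.Faithful (cond Φ (H.disc B))) {a c : A ⟶ 𝟙_ C} {t : ℝ}
    (h : O.stVec (cond (swap Φ) c) = t • O.stVec (cond (swap Φ) a)) (ρ : 𝟙_ C ⟶ A) :
    O.stVec ρ c = t * O.stVec ρ a := by
  obtain ⟨r, b, hr, hbρ⟩ := H.exists_steering_faithful hb hΦ hf ρ
  have h1 := congrFun h b
  rw [Pi.smul_apply, stVec_cond_swap, stVec_cond_swap, hbρ] at h1
  simp only [Pi.smul_apply, smul_eq_mul] at h1
  refine mul_left_cancel₀ hr.ne' (h1.trans (by ring))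

/-- The state and the effect of the purifying system that correspond to a pure state and the
effect that identifies it. -/
lemma exists_mirror (hb : O.HasBit) {A B : C} {p : ℝ} {Φ : 𝟙_ C ⟶ A ⊗ B} (hΦ : O.IsPure Φ)
    (hχ : O.Balanced (cond Φ (H.disc B)) p) (hf : O.Faithful (cond (swap Φ) (H.disc A)))
    {α : 𝟙_ C ⟶ A} (hα : O.IsDet α) (hαp : O.IsPure α) :
    ∃ b : B ⟶ 𝟙_ C, O.IsPure b ∧ O.stVec (cond Φ b) = p • O.stVec α ∧
      ∀ a : A ⟶ 𝟙_ C, O.IsPure a → O.stVec α a = 1 → ∃ β : 𝟙_ C ⟶ B, O.IsDet β ∧ O.IsPure β ∧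
        O.stVec (cond (swap Φ) a) = p • O.stVec β ∧ O.stVec β b = 1 := by
  obtain ⟨b, hbα⟩ := H.exists_steering_smul hb hΦ hχ.pos.le (hχ.below α hα hαp)
  have hbp := H.isPure_effect_of_cond hb hΦ hf (H.isPure_of_smul hαp hχ.pos.le hbα)
  refine ⟨b, hbp, hbα, fun a ha h1 => ?_⟩
  obtain ⟨β, hβ, hβs⟩ := H.exists_det_smul (inCone_stVec (O := O) (cond (swap Φ) a))
  rw [stVec_cond_swap, hχ.effect a ha α hα h1] at hβs
  have hβb : O.stVec β b = 1 := by
    have := congrFun hβs b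
    rw [stVec_cond_swap, hbα, Pi.smul_apply, Pi.smul_apply, h1] at this
    exact (smul_right_injective ℝ hχ.pos.ne' this).symm
  exact ⟨β, hβ, H.isPure_of_pure_effect hb hbp hβ hβb, hβs, hβb⟩

/-- A pure effect is determined by a state on which it has probability one. -/
lemma pure_effect_unique (hb : O.HasBit) {A : C} {a a' : A ⟶ 𝟙_ C} (ha : O.IsPure a)
    (ha' : O.IsPure a') {α : 𝟙_ C ⟶ A} (hα : O.IsDet α) (h : O.stVec α a = 1)
    (h' : O.stVec α a' = 1) : a = a' := by
  obtain ⟨χ, p, hχ⟩ := H.exists_balanced hb A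
  obtain ⟨B, Φ, hΦ, rfl, hf⟩ := H.exists_faithful_purification hχ.det
  obtain ⟨b, hbp, hbα, hmir⟩ := H.exists_mirror hb hΦ hχ hf hα
    (H.isPure_of_pure_effect hb ha hα h)
  obtain ⟨β, hβ, -, hβs, hβ1⟩ := hmir a ha h
  obtain ⟨β', hβ', -, hβs', hβ1'⟩ := hmir a' ha' h'
  -- The two effects remotely prepare states on which the same pure effect `b` is certain. These
  -- states coincide, and they determine the effects.
  have := H.eq_of_pure_effect hb hbp hβ hβ' hβ1 hβ1'
  refine H.effect_ext fun ρ => ?_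
  rw [H.stVec_of_cond_swap hb hΦ hχ.faithful (t := 1) (c := a) (a := a')
    (by rw [hβs, hβs', this, one_smul]), one_mul]

/-! ### The purifying system -/

/-- The effects need not form a test: each binary test separates its state from the previous ones,
and the states are adjoined one at a time. -/
lemma pd_of_biorthogonal (hb : O.HasBit) {n : ℕ} {A : C} {α : Fin n → (𝟙_ C ⟶ A)}
    (hα : ∀ x, O.IsDet (α x)) {a : Fin n → (A ⟶ 𝟙_ C)}
    (h : ∀ x y, O.stVec (α y) (a x) = if x = y then 1 else 0) :
    IsEmpty (Fin n) ∨ O.PerfectlyDistinguishable α := by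
  induction n with
  | zero => exact Or.inl inferInstance
  | succ n ih =>
    right
    obtain ⟨a', ha'⟩ := H.exists_compl (a (Fin.last n))
    have h1 := H.pd_adjoin hb (α := fun x : Fin n => α x.castSucc) (σ := α (Fin.last n))
      (ih (fun x => hα _) (a := fun x => a x.castSucc) fun x y => by simp [h])
      (H.isTest_swap ha') (fun x => by
        rw [Matrix.cons_val_zero, H.test_binary ha', H.norm_of_isDet (hα _), h,
          if_neg (Fin.castSucc_ne_last x).symm, sub_zero]) (by simp [h])
    convert H.pd_reindex h1 finSuccEquivLast using 1
    funext x
    refine Fin.lastCases ?_ (fun x => ?_) x <;> simp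

/-- Two systems that purify each other have pure maximal sets of the same cardinality, and the
marginal on the purifying system gives the same probability to all the normalized pure effects. -/
lemma stVec_marginal (hb : O.HasBit) {A B : C} {p : ℝ} {Φ : 𝟙_ C ⟶ A ⊗ B} (hΦ : O.IsPure Φ)
    (hχ : O.Balanced (cond Φ (H.disc B)) p) (hf : O.Faithful (cond (swap Φ) (H.disc A)))
    {b : B ⟶ 𝟙_ C} (hbp : O.IsPure b) {β : 𝟙_ C ⟶ B} (hβ : O.IsDet β) (h1 : O.stVec β b = 1) :
    O.stVec (cond Φ b) (H.disc A) = p := by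
  classical
  obtain ⟨n, α, hα⟩ := H.exists_pureMaximal hb A
  have hcard := H.card_mul_of_balanced hb hχ hα
  have hd := H.isDet_of_pd hα.2.1
  have hne := nonempty_of_pd H hα.2.1
  obtain ⟨a, ha⟩ := hα.2.1
  have hap := H.isPure_of_discriminates hb hα ha
  rw [discriminates_iff] at ha
  choose c hcp hcα hmir using fun x => H.exists_mirror hb hΦ hχ hf (hd x) (hα.1 x)
  choose γ hγ hγp hγs hγ1 using fun x => hmir x (a x) (hap x) (by simp [ha.2])
  -- The mirror states of a pure maximal set of `A` form a pure maximal set of `B`, since `p` times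
  -- their sum is the faithful marginal. Hence pure maximal sets of `B` have `n` elements too.
  have hpd := (H.pd_of_biorthogonal hb hγ (a := c) fun x y => by
    have := congrFun (hγs y) (c x)
    rw [stVec_cond_swap, hcα, Pi.smul_apply, Pi.smul_apply, ha.2] at this
    rw [← smul_right_injective ℝ hχ.pos.ne' this]
    simp only [eq_comm]).resolve_left (not_isEmpty_iff.2 hne)
  have hsum : O.stVec (cond (swap Φ) (H.disc A)) = ∑ x, p • O.stVec (γ x) := by
    ext m
    simp only [← hγs, Finset.sum_apply, stVec_cond_swap]
    rw [H.sum_stVec ha.1]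
  have hγmax := isPureMaximal_of_faithful hγp hpd hf (fun _ => p) hsum
  have hβp := H.isPure_of_pure_effect hb hbp hβ h1
  obtain ⟨k, β', hβ', ι, hι⟩ := H.exists_isPureMaximal_extension hb (X := Unit)
    (α := fun _ => β) (Or.inr (H.pd_single fun _ => hβ)) (fun _ => hβp)
  have hkn := H.card_eq_card hb hβ' hγmax
  rw [hkn.symm.trans (by rfl)] at hcard
  obtain ⟨b', hb'⟩ := hβ'.2.1
  have hbp' := H.isPure_of_discriminates hb hβ' hb'
  rw [discriminates_iff] at hb'
  have hbb : b' (ι ()) = b := H.pure_effect_unique hb (hbp' _) hbp hβ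
    (by rw [← hι (), hb'.2, if_pos rfl]) h1
  -- Each effect prepares a pure state, whose weight in the balanced state is at most `p`. The
  -- weights sum to one, as do `n` copies of `p`, so every weight equals `p`.
  have hle : ∀ y, O.stVec (cond Φ (b' y)) (H.disc A) ≤ p := fun y => by
    rcases (stVec_nonneg (O := O) (cond Φ (b' y)) (H.disc A)).eq_or_lt with h0 | h0
    · exact h0 ▸ hχ.pos.le
    obtain ⟨δ, hδ, hδs⟩ := H.exists_det_smul (inCone_stVec (O := O) (cond Φ (b' y)))
    refine hχ.le δ hδ (H.isPure_stVec_smul (H.isPure_cond hb hΦ (hbp' y)) h0 hδs) _ ?_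
    obtain ⟨b₂, hb₂⟩ := H.exists_compl (b' y)
    rw [← hδs, ← H.stVec_cond_compl Φ hb₂, add_sub_cancel_left]
    exact inCone_stVec _
  have htot : ∑ y, O.stVec (cond Φ (b' y)) (H.disc A) = ∑ _y : Fin k, p := by
    simp only [← stVec_cond_swap Φ]
    rw [H.sum_stVec hb'.1, stVec_cond_swap, H.norm_of_isDet hχ.det]
    simpa using hcard.symm
  rw [← hbb]
  exact (Finset.sum_eq_sum_iff_of_le fun y _ => hle y).1 htot _ (Finset.mem_univ _)

end Principles

/-! ### Diagonalization of effects and states -/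

lemma eval_eq_sum {A : C} {X : Type} [Fintype X] {b : A ⟶ 𝟙_ C} {c : X → ℝ} {a : X → (A ⟶ 𝟙_ C)}
    (h : ∀ ρ, O.stVec ρ b = ∑ x, c x * O.stVec ρ (a x)) {v : (A ⟶ 𝟙_ C) → ℝ}
    (hv : v ∈ O.StR A) : v b = ∑ x, c x * v (a x) := by
  induction hv using Submodule.span_induction with
  | mem v hv =>
    obtain ⟨ρ, rfl⟩ := hv
    exact h ρ
  | zero => simp
  | add v w _ _ hv hw => simp [hv, hw, mul_add, Finset.sum_add_distrib]
  | smul r v _ hv =>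
    simp only [Pi.smul_apply, smul_eq_mul, hv, Finset.mul_sum]
    exact Finset.sum_congr rfl fun x _ => by ring

lemma effVec_eq_sum {A : C} {X : Type} [Fintype X] {b : A ⟶ 𝟙_ C} {c : X → ℝ}
    {a : X → (A ⟶ 𝟙_ C)} (h : ∀ ρ, O.stVec ρ b = ∑ x, c x * O.stVec ρ (a x)) :
    O.effVec b = ∑ x, c x • O.effVec (a x) := by
  refine LinearMap.ext fun v => ?_
  simpa [effVec] using eval_eq_sum h v.2

namespace Principles

variable (H : O.Principles)
include H

/-- Every pure effect is a multiple of a pure effect with probability one on some state. -/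
lemma exists_normalized_effect (hb : O.HasBit) {A : C} {c : A ⟶ 𝟙_ C} (hc : O.IsPure c) :
    ∃ (a : A ⟶ 𝟙_ C) (α : 𝟙_ C ⟶ A) (s : ℝ), O.IsPure a ∧ O.IsDet α ∧ O.stVec α a = 1 ∧
      0 ≤ s ∧ ∀ ρ, O.stVec ρ c = s * O.stVec ρ a := by
  obtain ⟨χ, p, hχ⟩ := H.exists_balanced hb A
  obtain ⟨B, Φ, hΦ, rfl, hf⟩ := H.exists_faithful_purification hχ.det
  obtain ⟨β, hβ, hβs⟩ := H.exists_det_smul (inCone_stVec (O := O) (cond (swap Φ) c))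
  rw [stVec_cond_swap] at hβs
  rcases (stVec_nonneg (O := O) (cond Φ (H.disc B)) c).eq_or_lt with h0 | h0
  · obtain ⟨α, hα, hαp⟩ := H.exists_pure_det A
    obtain ⟨a, ha, haα⟩ := H.exists_pure_effect hb hαp hα
    refine ⟨a, α, 0, ha, hα, haα, le_rfl, H.stVec_of_cond_swap hb hΦ hχ.faithful ?_⟩
    rw [hβs, ← h0, zero_smul, zero_smul]
  have hβp : O.IsPure β :=
    H.isPure_stVec_smul (H.isPure_cond hb (H.isPure_swap hΦ) hc) h0 hβs
  obtain ⟨b, hbp, hbβ⟩ := H.exists_pure_effect hb hβp hβ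
  obtain ⟨α, hα, hαs⟩ := H.exists_det_smul (inCone_stVec (O := O) (cond Φ b))
  rw [H.stVec_marginal hb hΦ hχ hf hbp hβ hbβ] at hαs
  have hαp : O.IsPure α := H.isPure_stVec_smul (H.isPure_cond hb hΦ hbp) hχ.pos hαs
  obtain ⟨a, ha, haα⟩ := H.exists_pure_effect hb hαp hα
  obtain ⟨γ, hγ, hγs⟩ := H.exists_det_smul (inCone_stVec (O := O) (cond (swap Φ) a))
  rw [stVec_cond_swap, hχ.effect a ha α hα haα] at hγs
  have hγb : O.stVec γ b = 1 := by
    have := congrFun hγs b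
    rw [stVec_cond_swap, hαs, Pi.smul_apply, Pi.smul_apply, haα] at this
    exact (smul_right_injective ℝ hχ.pos.ne' this).symm
  -- `c` and the normalized effect `a` prepare the same state, the latter with weight `p`, so they
  -- are proportional with ratio the weight of `c` over `p`.
  have hβγ := H.eq_of_pure_effect hb hbp hβ hγ hbβ hγb
  refine ⟨a, α, O.stVec (cond Φ (H.disc B)) c / p, ha, hα, haα, div_nonneg h0.le hχ.pos.le,
    H.stVec_of_cond_swap hb hΦ hχ.faithful ?_⟩
  rw [hβs, hγs, hβγ, smul_smul, div_mul_cancel₀ _ hχ.pos.ne']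

/-- A pure effect can be split off from an effect, with the largest probability as weight. -/
lemma exists_split_effect (hb : O.HasBit) {A : C} {b : A ⟶ 𝟙_ C} {β : 𝟙_ C ⟶ A}
    (hβp : O.IsPure β) (hmax : ∀ ρ, O.IsDet ρ → O.stVec ρ b ≤ O.stVec β b)
    (hpos : 0 < O.stVec β b) : ∃ a b₂ : A ⟶ 𝟙_ C, O.IsPure a ∧ O.stVec β a = 1 ∧
      ∀ ρ, O.stVec ρ b = O.stVec β b * O.stVec ρ a + O.stVec ρ b₂ := by
  obtain ⟨b', hb'⟩ := H.exists_compl b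
  obtain ⟨K, T, -, hTp⟩ := H.exists_pure_instrument hb hb'
  obtain ⟨hT0, hT1⟩ := hTp 0
  rw [Matrix.cons_val_zero] at hT1
  obtain ⟨τ, hτ, hτs⟩ := H.exists_det_smul (inCone_stVec (O := O) (β ≫ T 0))
  rw [stVec_comp, hT1] at hτs
  have hτp : O.IsPure τ := H.isPure_stVec_smul (H.pur _ _ _ _ _ hβp hT0) hpos hτs
  obtain ⟨t, ht, htτ⟩ := H.exists_pure_effect hb hτp hτ
  obtain ⟨t', ht'⟩ := H.exists_compl t
  obtain ⟨a, α, s, ha, hα, haα, hs, hsa⟩ := H.exists_normalized_effect hb (H.pur _ _ _ _ _ hT0 ht)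
  have hsum : ∀ ρ, O.stVec ρ b = O.stVec ρ (T 0 ≫ t) + O.stVec ρ (T 0 ≫ t') := fun ρ => by
    rw [← stVec_comp, ← stVec_comp, H.stVec_compl ht', stVec_comp, hT1]
  have h1 : O.stVec β b = s * O.stVec β a := by
    rw [← hsa, ← stVec_comp, hτs, Pi.smul_apply, htτ, smul_eq_mul, mul_one]
  -- Evaluating at the state where `a` is certain gives `s ≤ b(α) ≤ b(β)`. Since also `b(β) = s *
  -- a(β)`, the effect `a` is certain on `β` and `s = b(β)`.
  have h2 : s ≤ O.stVec β b := by
    have h3 := hsum α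
    rw [hsa, haα] at h3
    linarith [stVec_nonneg (O := O) α (T 0 ≫ t'), hmax α hα]
  have h3 := stVec_le_one (O := O) β a
  have hs0 : 0 < s := lt_of_le_of_ne hs fun h => by
    rw [h1, ← h, zero_mul] at hpos
    exact lt_irrefl _ hpos
  have hβa : O.stVec β a = 1 := le_antisymm h3 (by
    rw [h1] at h2
    exact le_of_mul_le_mul_left (by linarith) hs0)
  rw [hβa, mul_one] at h1
  exact ⟨a, T 0 ≫ t', ha, hβa, fun ρ => by rw [hsum, hsa, h1]⟩

/-- Every effect that vanishes on some perfectly distinguishable pure states is diagonal in a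
measurement that discriminates a pure maximal set containing these states. -/
lemma exists_diagonal_effect_extension (hb : O.HasBit) {X : Type} [Finite X] {A : C}
    {α : X → (𝟙_ C ⟶ A)} (hα : IsEmpty X ∨ O.PerfectlyDistinguishable α)
    (hp : ∀ x, O.IsPure (α x)) (b : A ⟶ 𝟙_ C) (hαb : ∀ x, O.stVec (α x) b = 0) :
    ∃ (n : ℕ) (α' : Fin n → (𝟙_ C ⟶ A)) (a : Fin n → (A ⟶ 𝟙_ C)) (c : Fin n → ℝ),
      O.IsPureMaximal α' ∧ O.Discriminates a α' ∧ (∃ ι : X → Fin n, ∀ x, α' (ι x) = α x) ∧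
      ∀ ρ, O.stVec ρ b = ∑ y, c y * O.stVec ρ (a y) := by
  classical
  obtain ⟨k, hk⟩ : ∃ k, Module.finrank ℝ (O.StR A) - Nat.card X = k := ⟨_, rfl⟩
  induction k using Nat.strong_induction_on generalizing X b with
  | _ k ih =>
  obtain ⟨β, hβ, hβp, hmax⟩ := H.exists_pure_max b
  -- If the maximum is zero, `b` vanishes and any maximal extension diagonalizes it. Otherwise split
  -- at `β` and recurse with `β` adjoined: the remainder vanishes on the enlarged family.
  rcases (stVec_nonneg (O := O) β b).eq_or_lt with h0 | h0
  · obtain ⟨n, α', hα', hι⟩ := H.exists_isPureMaximal_extension hb hα hp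
    obtain ⟨a, ha⟩ := hα'.2.1
    refine ⟨n, α', a, 0, hα', ha, hι, fun ρ => ?_⟩
    obtain ⟨σ, hσ, hσs⟩ := H.exists_det_smul (inCone_stVec (O := O) ρ)
    have h1 : O.stVec σ b = 0 := le_antisymm (h0 ▸ hmax σ hσ) (stVec_nonneg _ _)
    rw [hσs, Pi.smul_apply, h1]
    simp
  obtain ⟨a, b₂, ha, haβ, hsum⟩ := H.exists_split_effect hb hβp hmax h0
  have hd : ∀ x, O.IsDet (α x) := fun x =>
    H.isDet_of_pd (hα.resolve_left (not_isEmpty_iff.2 ⟨x⟩)) x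
  have hαa : ∀ x, O.stVec (α x) a = 0 ∧ O.stVec (α x) b₂ = 0 := fun x => by
    have h1 := hsum (α x)
    rw [hαb] at h1
    have h2 := mul_nonneg h0.le (stVec_nonneg (O := O) (α x) a)
    have h3 := stVec_nonneg (O := O) (α x) b₂
    refine ⟨?_, by linarith⟩
    exact (mul_eq_zero.1 (by linarith : O.stVec β b * O.stVec (α x) a = 0)).resolve_left h0.ne'
  obtain ⟨a', ha'⟩ := H.exists_compl a
  have hpd := H.pd_adjoin hb hα (σ := β) (H.isTest_swap ha') (fun x => by
    rw [Matrix.cons_val_zero, H.test_binary ha', H.norm_of_isDet (hd _), (hαa x).1, sub_zero]) haβ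
  have hcard := card_le_finrank H.fin hpd
  have hoc : Nat.card (Option X) = Nat.card X + 1 := Finite.card_option
  obtain ⟨n, α', m, c, hα', hm, ⟨ι, hι⟩, hc⟩ := ih _ (by omega) (X := Option X) (Or.inr hpd)
    (fun o => by
      cases o with
      | none => exact hβp
      | some x => exact hp x) b₂ (fun o => by
      cases o with
      | none =>
        have := hsum β
        rw [haβ] at this
        simp only [Option.elim_none]
        linarith
      | some x => exact (hαa x).2) rfl
  -- The measurement found by the recursion contains `a` itself, because a pure effect certain on
  -- `β` is unique.
  have hma : m (ι none) = a := H.pure_effect_unique hb (H.isPure_of_discriminates hb hα' hm _) ha hβ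
    (by
      have h1 := (discriminates_iff.1 hm).2 (ι none) (ι none)
      rwa [if_pos rfl, hι] at h1) haβ
  refine ⟨n, α', m, fun y => c y + if y = ι none then O.stVec β b else 0, hα', hm,
    ⟨fun x => ι (some x), fun x => hι (some x)⟩, fun ρ => ?_⟩
  rw [hsum, hc]
  simp only [add_mul, Finset.sum_add_distrib, ite_mul, zero_mul, Finset.sum_ite_eq',
    Finset.mem_univ, if_true, hma]
  ring

/-- Every effect is diagonal in a measurement that discriminates a pure maximal set. -/
lemma exists_diagonal_effect (hb : O.HasBit) {A : C} (b : A ⟶ 𝟙_ C) :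
    ∃ (n : ℕ) (α : Fin n → (𝟙_ C ⟶ A)) (a : Fin n → (A ⟶ 𝟙_ C)) (c : Fin n → ℝ),
      O.IsPureMaximal α ∧ O.Discriminates a α ∧ ∀ ρ, O.stVec ρ b = ∑ y, c y * O.stVec ρ (a y) := by
  obtain ⟨n, α, a, c, h1, h2, -, h3⟩ := H.exists_diagonal_effect_extension hb (X := Empty)
    (α := fun x => x.elim) (Or.inl inferInstance) (fun x => x.elim) b (fun x => x.elim)
  exact ⟨n, α, a, c, h1, h2, h3⟩

lemma effVec_compl {A : C} {a b : A ⟶ 𝟙_ C} (h : O.IsTest ![a, b]) :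
    O.effVec b = O.effVec (H.disc A) - O.effVec a := by
  have := effVec_eq_sum (O := O) (b := H.disc A) (c := fun _ : Fin 2 => 1) (a := ![a, b])
    fun ρ => by simp [H.stVec_compl h]
  simp only [Fin.sum_univ_two, one_smul, Matrix.cons_val_zero, Matrix.cons_val_one] at this
  rw [this, add_sub_cancel_left]

/-- Every element of the span of the effects is, up to a multiple of the deterministic effect, a
nonnegative multiple of an effect. -/
lemma exists_effect_of_mem_EffR {A : C} {w : Module.Dual ℝ (O.StR A)} (hw : w ∈ O.EffR A) :
    ∃ (N c : ℝ) (b : A ⟶ 𝟙_ C), 0 ≤ N ∧ w = N • O.effVec b + c • O.effVec (H.disc A) := by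
  induction hw using Submodule.span_induction with
  | mem w hw =>
    obtain ⟨b, rfl⟩ := hw
    exact ⟨1, 0, b, zero_le_one, by simp⟩
  | zero => exact ⟨0, 0, H.disc A, le_rfl, by simp⟩
  | add w w' _ _ h h' =>
    obtain ⟨N, c, b, hN, rfl⟩ := h
    obtain ⟨N', c', b', hN', rfl⟩ := h'
    rcases (add_nonneg hN hN').eq_or_lt with h0 | h0
    · have h1 : N = 0 := by linarith
      have h2 : N' = 0 := by linarith
      exact ⟨0, c + c', b, le_rfl, by rw [h1, h2]; module⟩
    · obtain ⟨m, hm⟩ := H.exists_mix (p := N / (N + N')) (by positivity)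
        ((div_le_one h0).2 (by linarith)) b b'
      have hme : O.effVec m = (N / (N + N')) • O.effVec b + (1 - N / (N + N')) • O.effVec b' := by
        have := effVec_eq_sum (O := O) (b := m) (c := ![N / (N + N'), 1 - N / (N + N')])
          (a := ![b, b']) fun ρ => by
            have := congrFun hm (simpleContext ρ (𝟙 _))
            simpa [transfVec_simpleContext, stVec] using this
        simpa using this
      refine ⟨N + N', c + c', m, h0.le, ?_⟩
      rw [hme, smul_add, smul_smul, smul_smul, mul_div_cancel₀ _ h0.ne', mul_sub, mul_one,
        mul_div_cancel₀ _ h0.ne', add_sub_cancel_left, add_smul]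
      abel
  | smul r w _ h =>
    obtain ⟨N, c, b, hN, rfl⟩ := h
    rcases le_total 0 r with hr | hr
    · exact ⟨r * N, r * c, b, by positivity, by rw [smul_add, mul_smul, mul_smul]⟩
    · obtain ⟨b', hb'⟩ := H.exists_compl b
      refine ⟨-r * N, r * (c + N), b', mul_nonneg (by linarith) hN, ?_⟩
      rw [H.effVec_compl hb']
      module

/-- Diagonalization of the elements of the span of the effects. -/
lemma exists_diagonal_of_mem_EffR (hb : O.HasBit) {A : C} {w : Module.Dual ℝ (O.StR A)}
    (hw : w ∈ O.EffR A) : ∃ (n : ℕ) (α : Fin n → (𝟙_ C ⟶ A)) (a : Fin n → (A ⟶ 𝟙_ C))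
      (d : Fin n → ℝ), O.IsPureMaximal α ∧ O.IsPureDiscriminating a ∧
        w = ∑ x, d x • O.effVec (a x) := by
  obtain ⟨N, c, b, -, rfl⟩ := H.exists_effect_of_mem_EffR hw
  obtain ⟨n, α, a, d, hα, ha, hbs⟩ := H.exists_diagonal_effect hb b
  refine ⟨n, α, a, fun x => N * d x + c, hα, ⟨H.isPure_of_discriminates hb hα ha, α, ha⟩, ?_⟩
  rw [effVec_eq_sum hbs, effVec_eq_sum (b := H.disc A) (c := fun _ => 1) (a := a)
    fun ρ => by simp [H.sum_stVec ha.1], Finset.smul_sum, Finset.smul_sum,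
    ← Finset.sum_add_distrib]
  exact Finset.sum_congr rfl fun x _ => by module

/-- Every element of the span of the states becomes a state by adding a multiple of a faithful
state and rescaling. -/
lemma exists_state_of_mem_StR {A : C} {v : (A ⟶ 𝟙_ C) → ℝ} (hv : v ∈ O.StR A) {χ : 𝟙_ C ⟶ A}
    (hχ : O.Faithful χ) : ∃ (N t : ℝ) (ρ : 𝟙_ C ⟶ A), v = N • O.stVec ρ - t • O.stVec χ := by
  obtain ⟨u, w, hu, hw, rfl⟩ := H.exists_sub hv
  obtain ⟨s, σ, hs, rfl⟩ := hw
  obtain ⟨r, hr, hcone⟩ := hχ σ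
  obtain ⟨N, ρ, -, hρ⟩ := H.inCone_add hu (hcone.smul (div_nonneg hs hr.le))
  refine ⟨N, s / r, ρ, ?_⟩
  rw [← hρ, smul_sub, smul_smul, div_mul_cancel₀ _ hr.ne']
  abel

/-- Diagonalization of the elements of the span of the states. -/
lemma exists_diagonal_of_mem_StR (hb : O.HasBit) {A : C} {v : (A ⟶ 𝟙_ C) → ℝ} (hv : v ∈ O.StR A) :
    ∃ (n : ℕ) (α : Fin n → (𝟙_ C ⟶ A)) (c : Fin n → ℝ), O.IsPureMaximal α ∧
      v = ∑ x, c x • O.stVec (α x) := by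
  classical
  obtain ⟨χ, p, hχ⟩ := H.exists_balanced hb A
  obtain ⟨N, t, ρ, rfl⟩ := H.exists_state_of_mem_StR hv hχ.faithful
  obtain ⟨B, Φ, hΦ, rfl, hf⟩ := H.exists_faithful_purification hχ.det
  -- Diagonalizing the effect `b` that prepares `ρ` diagonalizes `ρ`, because the pure components of
  -- `b` prepare `p` times pure states.
  obtain ⟨r, b, hr, hbρ⟩ := H.exists_steering_faithful hb hΦ hχ.faithful ρ
  obtain ⟨n, β, m, d, hβ, hm, hbs⟩ := H.exists_diagonal_effect hb b
  have hmp := H.isPure_of_discriminates hb hβ hm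
  have hβd := H.isDet_of_pd hβ.2.1
  have hne := nonempty_of_pd H hβ.2.1
  rw [discriminates_iff] at hm
  choose α hα hαs using fun y => H.exists_det_smul (inCone_stVec (O := O) (cond Φ (m y)))
  have hαs' : ∀ y, O.stVec (cond Φ (m y)) = p • O.stVec (α y) := fun y => by
    rw [hαs y, H.stVec_marginal hb hΦ hχ hf (hmp y) (hβd y) (by simp [hm.2])]
  have hαp : ∀ y, O.IsPure (α y) := fun y =>
    H.isPure_stVec_smul (H.isPure_cond hb hΦ (hmp y)) hχ.pos (hαs' y)
  have hsum : O.stVec (cond Φ (H.disc B)) = ∑ y, p • O.stVec (α y) := by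
    ext a
    simp only [← hαs', Finset.sum_apply, ← stVec_cond_swap Φ]
    rw [H.sum_stVec hm.1]
  have hρ : r • O.stVec ρ = ∑ y, (d y * p) • O.stVec (α y) := by
    rw [← hbρ]
    ext a
    simp only [mul_smul, ← hαs', Finset.sum_apply, Pi.smul_apply, ← stVec_cond_swap Φ,
      smul_eq_mul]
    exact hbs _
  choose a ha haα using fun y => H.exists_pure_effect hb (hαp y) (hα y)
  -- The state `χ` is `p` times the sum of the `α y` and gives `a x` probability `p`. The term `y =
  -- x` already accounts for all of it, so the others vanish.
  have hort : ∀ x y, O.stVec (α y) (a x) = if x = y then 1 else 0 := fun x y => by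
    split_ifs with h
    · rw [← h, haα]
    have h1 := congrFun hsum (a x)
    rw [hχ.effect _ (ha x) (α x) (hα x) (haα x), ← Finset.smul_sum, Pi.smul_apply,
      Finset.sum_apply, ← Finset.add_sum_erase _ _ (Finset.mem_univ x), haα, smul_eq_mul, mul_add,
      mul_one, left_eq_add, mul_eq_zero] at h1
    exact (Finset.sum_eq_zero_iff_of_nonneg fun z _ => stVec_nonneg _ _).1
      (h1.resolve_left hχ.pos.ne') y (Finset.mem_erase.2 ⟨Ne.symm h, Finset.mem_univ y⟩)
  have hpd := (H.pd_of_biorthogonal hb hα hort).resolve_left (not_isEmpty_iff.2 hne)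
  refine ⟨n, α, fun y => N * r⁻¹ * (d y * p) - t * p,
    isPureMaximal_of_faithful hαp hpd hχ.faithful _ hsum, ?_⟩
  have hρ' : O.stVec ρ = r⁻¹ • ∑ y, (d y * p) • O.stVec (α y) := by
    rw [← hρ, inv_smul_smul₀ hr.ne']
  rw [hρ', hsum, Finset.smul_sum, Finset.smul_sum, Finset.smul_sum, ← Finset.sum_sub_distrib]
  exact Finset.sum_congr rfl fun y _ => by module

/-! ### Systems with a single deterministic state -/

/-- A system with two deterministic states contains a bit. -/
lemma hasBit_of_ne {A : C} {ρ σ : 𝟙_ C ⟶ A} (hρ : O.IsDet ρ) (hσ : O.IsDet σ) (hne : ρ ≠ σ) :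
    O.HasBit := by
  classical
  obtain ⟨α, hα, hαp⟩ := H.exists_pure_det A
  -- A pure state is refined only by its own multiples, so a faithful one would be the only
  -- deterministic state. Not being faithful, `α` is not internal, and Perfect State Discrimination
  -- provides the bit.
  have hf : ¬ O.Faithful α := fun hf => by
    have key : ∀ τ : 𝟙_ C ⟶ A, O.IsDet τ → τ = α := fun τ hτ => by
      obtain ⟨r, hr, hcone⟩ := hf τ
      obtain ⟨q, hq⟩ := H.isPure_state_elim hαp zero_le_one ((inCone_stVec τ).smul hr.le) hcone
        (by rw [one_smul]; abel)
      rw [mul_one] at hq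
      have h1 := congrFun hq (H.disc A)
      rw [Pi.smul_apply, Pi.smul_apply, H.norm_of_isDet hτ, H.norm_of_isDet hα] at h1
      simp only [smul_eq_mul, mul_one] at h1
      exact H.state_ext (smul_right_injective _ hr.ne' (h1 ▸ hq))
    exact hne ((key ρ hρ).trans (key σ hσ).symm)
  obtain ⟨τ, m, hm⟩ := H.pdisc A α (H.isNormalized_of_isDet hα)
    (fun hint => hf (faithful_of_isInternal hint))
  exact ⟨A, _, m, discriminates_iff.1 hm⟩

lemma isPureMaximal_of_unique {A : C} {ω : 𝟙_ C ⟶ A} (hω : O.IsDet ω)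
    (huniq : ∀ ρ : 𝟙_ C ⟶ A, O.IsDet ρ → ρ = ω) : O.IsPureMaximal (fun _ : Fin 1 => ω) := by
  obtain ⟨α, hα, hαp⟩ := H.exists_pure_det A
  refine ⟨fun _ => huniq α hα ▸ hαp, H.pd_single fun _ => hω, fun Y _ σ hσ h => h.antisymm' ?_⟩
  rintro _ ⟨y, rfl⟩
  exact ⟨0, (huniq _ (H.isDet_of_pd hσ y)).symm⟩

lemma card_of_unique {A : C} {ω : 𝟙_ C ⟶ A}
    (huniq : ∀ ρ : 𝟙_ C ⟶ A, O.IsDet ρ → ρ = ω) {X : Type} [Finite X] {α : X → (𝟙_ C ⟶ A)}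
    (hα : O.PerfectlyDistinguishable α) : Nat.card X = 1 := by
  classical
  have hne := nonempty_of_pd H hα
  have hd := H.isDet_of_pd hα
  obtain ⟨m, hm⟩ := hα
  rw [discriminates_iff] at hm
  refine Nat.card_eq_one_iff_unique.2 ⟨⟨fun x y => ?_⟩, hne⟩
  by_contra hxy
  have h1 := hm.2 x x
  have h2 := hm.2 x y
  rw [if_pos rfl, huniq _ (hd x), ← huniq _ (hd y), h2, if_neg hxy] at h1
  exact zero_ne_one h1

lemma stVec_of_unique {A : C} {ω : 𝟙_ C ⟶ A} (huniq : ∀ ρ : 𝟙_ C ⟶ A, O.IsDet ρ → ρ = ω)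
    (ρ : 𝟙_ C ⟶ A) : O.stVec ρ = O.stVec ρ (H.disc A) • O.stVec ω := by
  obtain ⟨σ, hσ, h⟩ := H.exists_det_smul (inCone_stVec (O := O) ρ)
  rwa [huniq σ hσ] at h

lemma exists_smul_of_unique {A : C} {ω : 𝟙_ C ⟶ A} (huniq : ∀ ρ : 𝟙_ C ⟶ A, O.IsDet ρ → ρ = ω)
    {v : (A ⟶ 𝟙_ C) → ℝ} (hv : v ∈ O.StR A) : ∃ c : ℝ, v = c • O.stVec ω := by
  induction hv using Submodule.span_induction with
  | mem v hv =>
    obtain ⟨ρ, rfl⟩ := hv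
    exact ⟨_, H.stVec_of_unique huniq ρ⟩
  | zero => exact ⟨0, by simp⟩
  | add v w _ _ hv hw =>
    obtain ⟨c, rfl⟩ := hv
    obtain ⟨d, rfl⟩ := hw
    exact ⟨c + d, (add_smul _ _ _).symm⟩
  | smul r v _ hv =>
    obtain ⟨c, rfl⟩ := hv
    exact ⟨r * c, (mul_smul _ _ _).symm⟩

lemma exists_smul_disc_of_unique {A : C} {ω : 𝟙_ C ⟶ A} (hω : O.IsDet ω)
    (huniq : ∀ ρ : 𝟙_ C ⟶ A, O.IsDet ρ → ρ = ω) {w : Module.Dual ℝ (O.StR A)}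
    (hw : w ∈ O.EffR A) : ∃ d : ℝ, w = d • O.effVec (H.disc A) := by
  obtain ⟨N, c, b, -, rfl⟩ := H.exists_effect_of_mem_EffR hw
  have := effVec_eq_sum (O := O) (b := b) (c := fun _ : Unit => O.stVec ω b)
    (a := fun _ => H.disc A) fun ρ => by
      rw [H.stVec_of_unique huniq ρ]
      simp [mul_comm, H.norm_of_isDet hω]
  rw [this, Fintype.sum_unique]
  exact ⟨N * O.stVec ω b + c, by module⟩

lemma isPureDiscriminating_of_unique {A : C} {ω : 𝟙_ C ⟶ A} (hω : O.IsDet ω)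
    (huniq : ∀ ρ : 𝟙_ C ⟶ A, O.IsDet ρ → ρ = ω) :
    O.IsPureDiscriminating (fun _ : Fin 1 => H.disc A) := by
  classical
  refine ⟨fun _ => H.isPure_effect_intro fun a a' _ _ => ⟨O.stVec ω a, fun ρ => ?_⟩,
    fun _ => ω, discriminates_iff.2 ⟨H.isTest_reindex (H.isDet_disc A)
      (Equiv.ofUnique (Fin 1) Unit), fun x y => ?_⟩⟩
  · rw [H.stVec_of_unique huniq ρ]
    simp [mul_comm, H.norm_of_isDet hω]
  · rw [if_pos (Subsingleton.elim x y), H.norm_of_isDet hω]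

omit H in
lemma infoDim_eq {A : C} {n : ℕ} {α : Fin n → (𝟙_ C ⟶ A)} (hα : O.IsPureMaximal α)
    (h : ∀ (k : ℕ) (β : Fin k → (𝟙_ C ⟶ A)), O.IsPureMaximal β → k = n) : O.infoDim A = n := by
  obtain ⟨β, hβ⟩ := Nat.sInf_mem (s := {n | ∃ α : Fin n → (𝟙_ C ⟶ A), O.IsPureMaximal α})
    ⟨n, α, hα⟩
  exact h _ β hβ

lemma card_eq_infoDim (hb : O.HasBit) {A : C} {X : Type} [Finite X] {α : X → (𝟙_ C ⟶ A)}
    (hα : O.IsPureMaximal α) : Nat.card X = O.infoDim A := by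
  obtain ⟨n, β, hβ⟩ := H.exists_pureMaximal hb A
  rw [infoDim_eq hβ fun k γ hγ => by simpa using H.card_eq_card hb hγ hβ]
  simpa using H.card_eq_card hb hα hβ

end Principles
end OPT

/-! ### The spectral decomposition -/

theorem mainTheorem2 {C : Type u} [Category.{v} C] [MonoidalCategory C] [SymmetricCategory C]
    (O : OPT C)
    (hsep : O.Separation) (hcg : O.ClosedUnderCoarseGraining)
    (hfin : O.FiniteDimensionality) (hnd : O.NonDeterminism) (hlim : O.ClosedUnderLimits)
    (hcaus : O.Causality) (hpur : O.PurityOfComposition) (hloc : O.LocalTomography)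
    (hdisc : O.PerfectStateDiscrimination) (hcomp : O.IdealCompression)
    (hpurif : O.Purification) (A : C) :
    (∀ (X : Type) [Finite X] (α : X → (𝟙_ C ⟶ A)), O.IsPureMaximal α →
      Nat.card X = O.infoDim A) ∧
    (∀ v ∈ O.StR A, ∃ (α : Fin (O.infoDim A) → (𝟙_ C ⟶ A)) (c : Fin (O.infoDim A) → ℝ),
      O.IsPureMaximal α ∧ v = ∑ x, c x • O.stVec (α x)) ∧
    (∀ w ∈ O.EffR A, ∃ (a : Fin (O.infoDim A) → (A ⟶ 𝟙_ C)) (d : Fin (O.infoDim A) → ℝ),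
      O.IsPureDiscriminating a ∧ w = ∑ x, d x • O.effVec (a x)) := by
  have H : O.Principles :=
    ⟨hsep, hcg, hfin, hnd, hlim, hcaus, hpur, hloc, hdisc, hcomp, hpurif⟩
  obtain ⟨ω, hω⟩ := H.exists_isDet_state A
  -- With a single deterministic state no bit need exist, so steering is unavailable; but then
  -- states and effects each span a line and the dimension is one.
  by_cases huniq : ∀ ρ : 𝟙_ C ⟶ A, O.IsDet ρ → ρ = ω
  · have hmax := H.isPureMaximal_of_unique hω huniq
    have hdim : O.infoDim A = 1 := OPT.Principles.infoDim_eq hmax fun k β hβ => by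
      simpa using H.card_of_unique huniq hβ.2.1
    rw [hdim]
    refine ⟨fun X _ α hα => H.card_of_unique huniq hα.2.1, fun v hv => ?_, fun w hw => ?_⟩
    · obtain ⟨c, hc⟩ := H.exists_smul_of_unique huniq hv
      exact ⟨_, fun _ => c, hmax, by simpa using hc⟩
    · obtain ⟨d, hd⟩ := H.exists_smul_disc_of_unique hω huniq hw
      exact ⟨_, fun _ => d, H.isPureDiscriminating_of_unique hω huniq, by simpa using hd⟩
  · push Not at huniq
    obtain ⟨ρ, hρ, hne⟩ := huniq
    have hb := H.hasBit_of_ne hρ hω hne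
    refine ⟨fun X _ α hα => H.card_eq_infoDim hb hα, fun v hv => ?_, fun w hw => ?_⟩
    · obtain ⟨n, α, c, hα, hv⟩ := H.exists_diagonal_of_mem_StR hb hv
      obtain rfl : n = O.infoDim A := by simpa using H.card_eq_infoDim hb hα
      exact ⟨α, c, hα, hv⟩
    · obtain ⟨n, α, a, d, hα, ha, hw⟩ := H.exists_diagonal_of_mem_EffR hb hw
      obtain rfl : n = O.infoDim A := by simpa using H.card_eq_infoDim hb hα
      exact ⟨a, d, ha, hw⟩
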